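/- Fix $\omega_c>0$, $\omega_3\ge 0$, $\lambda>0$, $\kappa>0$, $z_0=(q,p)\in\mathbb R^2$ and $\theta,\varphi\in\mathbb R$. For a half-integer spin number $\mathsf s\in\{\tfrac12,1,\tfrac32,\dots\}$ put $\hbar=\kappa/\mathsf s$ (so $\hbar\searrow0$ means $\mathsf s\to\infty$). Let $\mathcal H_{2\mathsf s+1}$ be the irreducible spin space of dimension $N=2\mathsf s+1$, with spin operators $S_1,S_2,S_3$, $S_\pm=S_1\pm iS_2$, and let $$\hat H=\frac{\omega_c}{2}\left(-\hbar^2\partial_x^2+x^2\right)+\omega_3\,\hbar S_3+\frac{2\lambda}{\sqrt{N\hbar}}\,x\,\hbar S_1$$ be the Dicke Hamiltonian, the self-adjoint operator in $L^2(\mathbb R)\otimes\mathcal H_{2\mathsf s+1}=L^2(\mathbb R,\mathcal H_{2\mathsf s+1})$ that is the closure of this expression on Schwartz functions. Let $$\varphi_{z_0}(x)=(\pi\hbar)^{-1/4}\,e^{\frac{i}{\hbar}\left(px-\frac{pq}{2}\right)}\,e^{-\frac{(x-q)^2}{2\hbar}}$$ be the Schrödinger coherent state at $z_0$, and let $\psi_{\mathbf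 n_0}=\exp\left(\tfrac{\theta}{2}(e^{i\varphi}S_--e^{-i\varphi}S_+)\right)\mathscr D_{-\mathsf s}$ be the spin coherent state at $\mathbf n_0=(\sin\theta\cos\varphi,\sin\theta\sin\varphi,\cos\theta)$, where $\mathscr D_{-\mathsf s}$ is the unit eigenvector of $S_3$ with eigenvalue $-\mathsf s$. Assume $\mathbf n_0\ne(\pm1,0,0)$. Let $\Psi(t)=e^{-\frac{it}{\hbar}\hat H}(\varphi_{z_0}\otimes\psi_{\mathbf n_0})$, that is, the solution of $i\hbar\,\partial_t\Psi=\hat H\Psi$ with this initial value, let $\Pi_{\Psi(t)}$ be the orthogonal projector on the line spanned by $\Psi(t)$, and let $\rho_O(t)=\mathrm{tr}_{\mathcal H_{2\mathsf s+1}}\Pi_{\Psi(t)}$ be its partial trace over the spin space, an operator in $L^2(\mathbb R)$. Then there are $c_0>0$ and $t_0>0$, which depend only on $\omega_c,\omega_3,\lambda,\kappa,z_0,\theta,\varphi$, such that for every $0<\mu<1/2$ there are $C$ and $\hbar_0>0$ with $$\mathrm{tr}\left[\rho_O(t)^2\right]\le\left(1+c_0\kappa t^2\right)^{-1/2}+C\hbar^{\mu}\qquad\text{for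 all }t\in[0,t_0]\text{ and all }\hbar=\kappa/\mathsf s\le\hbar_0 .$$ Consequently, for every $t\in(0,t_0]$ and all sufficiently small $\hbar$ (depending on $t$), the orbital state $\rho_O(t)$ is mixed, that is, it is not an orthogonal projector on a line $\mathbb Cf$, $f\in L^2(\mathbb R)$, and $\Psi(t)$ is entangled, that is, it is not of the form $f\otimes v$ with $f\in L^2(\mathbb R)$, $v\in\mathcal H_{2\mathsf s+1}$. -/

import Mathlib

open MeasureTheory Matrix
open scoped SchwartzMap InnerProductSpace

noncomputable section

/-! Throughout, `n = 2s` is twice the spin number, so the spin space has dimension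
`n + 1 = 2s + 1`, and `ħ` is a positive real number. -/

/-- The spin space `H_{2s+1}` with its orthonormal basis of Dicke states `D_m`, `-s ≤ m ≤ s`.
The index `k = s + m` runs through `0, …, n`. -/
abbrev SpinSpace (n : ℕ) : Type := EuclideanSpace ℂ (Fin (n + 1))

/-- The orbital space `L²(ℝ)`. -/
abbrev OrbitalSpace : Type := Lp ℂ 2 (volume : Measure ℝ)

/-- The total space `L²(ℝ) ⊗ H_{2s+1} = L²(ℝ, H_{2s+1})`. -/
abbrev TotalSpace (n : ℕ) : Type := Lp (SpinSpace n) 2 (volume : Measure ℝ)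

/-- `S₊ D_m = √((s-m)(s+m+1)) D_{m+1}`, that is `S₊ e_k = √((n-k)(k+1)) e_{k+1}`. -/
def spinRaise (n : ℕ) : Matrix (Fin (n + 1)) (Fin (n + 1)) ℂ :=
  Matrix.of fun i j =>
    if (i : ℕ) = (j : ℕ) + 1 then ((Real.sqrt (((n : ℝ) - (j : ℕ)) * ((j : ℕ) + 1)) : ℝ) : ℂ) else 0

/-- `S₋`, the adjoint of `S₊`. -/
def spinLower (n : ℕ) : Matrix (Fin (n + 1)) (Fin (n + 1)) ℂ := (spinRaise n)ᴴ

/-- `S₁ = (S₊ + S₋) / 2`. -/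
def spinOne (n : ℕ) : Matrix (Fin (n + 1)) (Fin (n + 1)) ℂ :=
  (1 / 2 : ℂ) • (spinRaise n + spinLower n)

/-- `S₃ D_m = m D_m`, that is `S₃ e_k = (k - n/2) e_k`. -/
def spinThree (n : ℕ) : Matrix (Fin (n + 1)) (Fin (n + 1)) ℂ :=
  Matrix.diagonal fun k => ((k : ℕ) : ℂ) - (n : ℂ) / 2

/-- The spin coherent state `ψ_𝐧` at `𝐧 = (sin θ cos φ, sin θ sin φ, cos θ)`: the image of the
lowest Dicke state `D_{-s}` under `exp ((θ/2) (e^{iφ} S₋ - e^{-iφ} S₊))`. -/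
def spinCoherent (n : ℕ) (θ φ : ℝ) : SpinSpace n :=
  Matrix.toEuclideanLin
    (NormedSpace.exp (((θ / 2 : ℝ) : ℂ) •
      (Complex.exp (Complex.I * φ) • spinLower n - Complex.exp (-(Complex.I * φ)) • spinRaise n)))
    (EuclideanSpace.single 0 1)

/-- The Schrödinger coherent state `φ_z = T(z) φ_0`, `z = (q, p)`, where
`φ_0(x) = (πħ)^{-1/4} exp (-x²/(2ħ))` and `T(z) = exp ((i/ħ)(p x̂ - q p̂))`, which acts by
`(T(z) f)(x) = exp (-ipq/(2ħ)) exp (ipx/ħ) f(x - q)`. -/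
def orbitalCoherent (ħ q p x : ℝ) : ℂ :=
  (((Real.pi * ħ) ^ (-(1 / 4 : ℝ)) : ℝ) : ℂ) *
    Complex.exp (Complex.I * ((p * x - p * q / 2) / ħ : ℝ)) *
    ((Real.exp (-(x - q) ^ 2 / (2 * ħ)) : ℝ) : ℂ)

/-- The Dicke Hamiltonian as a differential expression,
`(ω_c/2)(-ħ² ∂ₓ² + x²) + ω₃ ħ S₃ + (2 lam / √(N ħ)) x ħ S₁` with `N = 2s + 1 = n + 1`. -/
def dickeExpr (n : ℕ) (ħ ωc ω₃ lam : ℝ) (u : ℝ → SpinSpace n) (x : ℝ) : SpinSpace n :=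
  ((ωc / 2 : ℝ) : ℂ) • (((-ħ ^ 2 : ℝ) : ℂ) • deriv (deriv u) x + ((x ^ 2 : ℝ) : ℂ) • u x)
    + ((ω₃ * ħ : ℝ) : ℂ) • Matrix.toEuclideanLin (spinThree n) (u x)
    + ((2 * lam / Real.sqrt (((n : ℝ) + 1) * ħ) * x * ħ : ℝ) : ℂ) •
        Matrix.toEuclideanLin (spinOne n) (u x)

/-- The graph of the Dicke Hamiltonian on Schwartz functions. -/
def dickeCoreGraph (n : ℕ) (ħ ωc ω₃ lam : ℝ) : Set (TotalSpace n × TotalSpace n) :=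
  {w | ∃ u : 𝓢(ℝ, SpinSpace n), w.1 =ᵐ[volume] (fun x => u x) ∧
    w.2 =ᵐ[volume] dickeExpr n ħ ωc ω₃ lam (fun x => u x)}

/-- The graph of the self-adjoint Dicke Hamiltonian, which is the closure of its restriction to
Schwartz functions: `(u, v)` belongs to it iff `u` is in the domain and `v = Ĥ u`. -/
def dickeGraph (n : ℕ) (ħ ωc ω₃ lam : ℝ) : Set (TotalSpace n × TotalSpace n) :=
  closure (dickeCoreGraph n ħ ωc ω₃ lam)

/-- `Ψ(t) = exp (-itĤ/ħ) Ψ(0)` with `Ψ(0) = φ_z ⊗ ψ_𝐧`: the solution of the Schrödinger equation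
`iħ Ψ'(t) = Ĥ Ψ(t)` in `L²(ℝ, H_{2s+1})`, with `Ψ(t)` in the domain of `Ĥ` for all `t`, that
starts from the product of the coherent states. -/
def IsDickeEvolution (n : ℕ) (ħ ωc ω₃ lam q p θ φ : ℝ) (Ψ : ℝ → TotalSpace n) : Prop :=
  Ψ 0 =ᵐ[volume] (fun x => orbitalCoherent ħ q p x • spinCoherent n θ φ) ∧
  ∀ t : ℝ, ∃ Ψ' : TotalSpace n, HasDerivAt Ψ Ψ' t ∧
    (Ψ t, (Complex.I * (ħ : ℂ)) • Ψ') ∈ dickeGraph n ħ ωc ω₃ lam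

/-- The orthogonal projector `Π_Ψ` on the line spanned by `Ψ`. -/
def pureProj {H : Type*} [NormedAddCommGroup H] [InnerProductSpace ℂ H] (Ψ : H) : H →L[ℂ] H :=
  (Submodule.span ℂ {Ψ}).starProjection

/-- The isometry `f ↦ f ⊗ e_k` of `L²(ℝ)` into `L²(ℝ, H_{2s+1})`. -/
def tensorBasis (n : ℕ) (k : Fin (n + 1)) : OrbitalSpace →L[ℂ] TotalSpace n :=
  ContinuousLinearMap.compLpL 2 volume
    (ContinuousLinearMap.toSpanSingleton ℂ (EuclideanSpace.single k (1 : ℂ) : SpinSpace n))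

/-- The partial trace over the spin space: `⟨f, (tr_spin A) g⟩ = ∑ₖ ⟨f ⊗ e_k, A (g ⊗ e_k)⟩`. -/
def spinPartialTrace (n : ℕ) (A : TotalSpace n →L[ℂ] TotalSpace n) :
    OrbitalSpace →L[ℂ] OrbitalSpace :=
  ∑ k, (ContinuousLinearMap.adjoint (tensorBasis n k)).comp (A.comp (tensorBasis n k))

/-- The orbital reduced density matrix `ρ_O = tr_spin Π_Ψ`. -/
def orbitalDensity (n : ℕ) (Ψ : TotalSpace n) : OrbitalSpace →L[ℂ] OrbitalSpace :=
  spinPartialTrace n (pureProj Ψ)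

/-- The trace `∑ᵢ ⟨bᵢ, T bᵢ⟩` of an operator on a Hilbert space, for a Hilbert basis `b`. Its value
on trace class operators, the only ones it is used for, does not depend on `b`. -/
def hilbertTrace {H : Type*} [NormedAddCommGroup H] [InnerProductSpace ℂ H] [CompleteSpace H]
    (T : H →L[ℂ] H) : ℂ :=
  ∑' i, ⟪(exists_hilbertBasis ℂ H).choose_spec.choose i,
    T ((exists_hilbertBasis ℂ H).choose_spec.choose i)⟫_ℂ

/-- The purity `tr (ρ_O²)` of the orbital reduced density matrix. -/
def orbitalPurity (n : ℕ) (Ψ : TotalSpace n) : ℝ :=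
  (hilbertTrace ((orbitalDensity n Ψ).comp (orbitalDensity n Ψ))).re

end

/-! ### Gaussian wave packets -/

/-! Let `ε = 2 lam / √((n + 1) ħ)` be the coupling; it stays bounded because `(n + 1) ħ = 2κ + ħ`.
Take a coherent wave packet with centre `ζ = q + ip` and a spin coherent state with spinor `(u, v)`,
moved by the self-consistent mean field equations. Writing `m` for the mean of `S₁ / n`, the
interaction splits as `x S₁ = q S₁ + n m x - q n m + (x - q)(S₁ - n m)`. The first three terms and
the free part keep products of coherent states exactly, so the mean field state `Φ` solves the
Schrödinger equation up to `ħ ε` times the excited state `e = (x - q)(S₁ - n m) Φ`.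

The norm of `e` is `√κ |u² - v²| / 2`: the factor `√(ħ/2)` of the packet and the factor `√n` of the
spin compensate exactly. The residual of `e` is likewise `ħ` times a vector bounded by a constant
`R` uniformly in `ħ`. After division by `ħ`, overlaps of the true solution `Ψ` with these two states
satisfy differential relations uniform in `ħ`: `⟨e, Ψ⟩` starts at `0` and is `O(t)`, hence `⟨Φ, Ψ⟩ =
1 + O(t²)` and `‖Ψ - Φ‖ = O(t)` (`norm_inner_meanState_sub_one_le`, `norm_sub_meanState_sq_le`). To
first order, `|⟨e, Ψ⟩|` is `ε κ (1/4 - m₀²) t` (`le_norm_inner_excitedState`), where `m₀ = -sin θ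
cos φ / 2`; the rate is positive exactly because the initial direction is not `(±1, 0, 0)`.

Entanglement is read off a `2 × 2` minor. In terms of partial inner products, `1 - tr ρ²` is a sum
of nonnegative Gram determinants, each of which dominates the square of any of its `2 × 2` minors of
amplitudes in orthonormal vectors (`norm_inner_minor_sq_le`, `orbitalPurity_le`). For the packet,
its first excitation, the spin coherent state and its tangent, the product of the diagonal
amplitudes is at least of order `t`, while the off-diagonal product is `O(t²)`. So `tr ρ² ≤ 1 - 2 (b
t)²` for short times, uniformly in `ħ` (`exists_orbitalPurity_le`), and `1 - x/2 ≤ (1 + x)^(-1/2)`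
gives the stated form, without any error term in `ħ`.

The solution is only tested against Gaussian vectors in the domain of the adjoint (`IsAdjointPair`),
so neither self-adjointness nor a propagator is needed. -/

lemma abs_pow_mul_exp_le (r : ℝ) {b : ℝ} (hb : 0 < b) (k : ℕ) (x : ℝ) :
    |x| ^ k * Real.exp (r * |x| - 2 * b * x ^ 2) ≤
      (k.factorial * Real.exp ((r + 1) ^ 2 / (4 * b))) * Real.exp (-b * x ^ 2) := by
  have h1 : |x| ^ k ≤ k.factorial * Real.exp |x| := by
    have := Real.pow_div_factorial_le_exp |x| (abs_nonneg x) k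
    rw [div_le_iff₀ (by positivity)] at this
    linarith
  -- Half of the Gaussian decay absorbs the linear exponent, by completing the square.
  have h2 : |x| + (r * |x| - 2 * b * x ^ 2) ≤ (r + 1) ^ 2 / (4 * b) + -b * x ^ 2 := by
    have : (r + 1) ^ 2 / (4 * b) - (r + 1) * |x| + b * x ^ 2
        = (r + 1 - 2 * b * |x|) ^ 2 / (4 * b) := by
      field_simp
      rw [← sq_abs x]
      ring
    have h3 : 0 ≤ (r + 1 - 2 * b * |x|) ^ 2 / (4 * b) := by positivity
    linarith
  calc |x| ^ k * Real.exp (r * |x| - 2 * b * x ^ 2)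
      ≤ k.factorial * Real.exp |x| * Real.exp (r * |x| - 2 * b * x ^ 2) := by gcongr
    _ = k.factorial * Real.exp (|x| + (r * |x| - 2 * b * x ^ 2)) := by
        rw [Real.exp_add]; ring
    _ ≤ k.factorial * Real.exp ((r + 1) ^ 2 / (4 * b) + -b * x ^ 2) := by gcongr
    _ = _ := by rw [Real.exp_add]; ring

lemma memLp_exp_neg_mul_sq {b : ℝ} (hb : 0 < b) :
    MemLp (fun x : ℝ => Real.exp (-b * x ^ 2)) 2 volume := by
  rw [memLp_two_iff_integrable_sq (by fun_prop)]
  convert integrable_exp_neg_mul_sq (b := 2 * b) (by positivity) using 2 with x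
  rw [← Real.exp_nat_mul]
  congr 1
  push_cast
  ring

/-- The function `x ^ k exp ((ζ x - x² / 2) / ħ)`. -/
noncomputable def gaussFun (ħ : ℝ) (ζ : ℂ) (k : ℕ) (x : ℝ) : ℂ :=
  (x : ℂ) ^ k * Complex.exp ((ζ * x - x ^ 2 / 2) / ħ)

lemma continuous_gaussFun (ħ : ℝ) (ζ : ℂ) (k : ℕ) : Continuous (gaussFun ħ ζ k) := by
  unfold gaussFun
  fun_prop

lemma norm_gaussFun_le {ħ : ℝ} (hħ : 0 < ħ) (ζ : ℂ) (k : ℕ) (x : ℝ) :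
    ‖gaussFun ħ ζ k x‖ ≤ |x| ^ k * Real.exp (‖ζ‖ / ħ * |x| - 2 * (1 / (4 * ħ)) * x ^ 2) := by
  unfold gaussFun
  rw [norm_mul, norm_pow, Complex.norm_real, Real.norm_eq_abs, Complex.norm_exp]
  gcongr
  have h1 : ((ζ * x - (x : ℂ) ^ 2 / 2) / ħ).re = (ζ.re * x - x ^ 2 / 2) / ħ := by
    have : ((ζ * x - (x : ℂ) ^ 2 / 2) / ħ) =
      ((ζ.re * x - x ^ 2 / 2) / ħ : ℝ) + ((ζ.im * x) / ħ : ℝ) * Complex.I := by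
      conv_lhs => rw [← Complex.re_add_im ζ]
      push_cast
      ring
    rw [this]
    simp only [Complex.add_re, Complex.ofReal_re, Complex.re_ofReal_mul, Complex.I_re, mul_zero,
      add_zero]
  rw [h1]
  have h2 : ζ.re * x ≤ ‖ζ‖ * |x| := by
    calc ζ.re * x ≤ |ζ.re * x| := le_abs_self _
      _ = |ζ.re| * |x| := abs_mul _ _
      _ ≤ _ := by gcongr; exact Complex.abs_re_le_norm ζ
  have : ‖ζ‖ / ħ * |x| - 2 * (1 / (4 * ħ)) * x ^ 2 = (‖ζ‖ * |x| - x ^ 2 / 2) / ħ := by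
    field_simp; ring
  rw [this]
  gcongr

lemma memLp_gaussFun {ħ : ℝ} (hħ : 0 < ħ) (ζ : ℂ) (k : ℕ) :
    MemLp (gaussFun ħ ζ k) 2 volume := by
  have hb : 0 < 1 / (4 * ħ) := by positivity
  refine MemLp.of_le_mul (memLp_exp_neg_mul_sq hb) (continuous_gaussFun ħ ζ k).aestronglyMeasurable
    (c := k.factorial * Real.exp ((‖ζ‖ / ħ + 1) ^ 2 / (4 * (1 / (4 * ħ)))))
    (Filter.Eventually.of_forall fun x => ?_)
  rw [Real.norm_of_nonneg (Real.exp_pos _).le]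
  exact (norm_gaussFun_le hħ ζ k x).trans (abs_pow_mul_exp_le _ hb k x)

lemma hasDerivAt_gaussFun_zero {ħ : ℝ} (ζ : ℂ) (x : ℝ) :
    HasDerivAt (gaussFun ħ ζ 0)
      (ζ / ħ * gaussFun ħ ζ 0 x - 1 / ħ * gaussFun ħ ζ 1 x) x := by
  have h : HasDerivAt (fun y : ℂ => Complex.exp ((ζ * y - y ^ 2 / 2) / ħ))
      (Complex.exp ((ζ * x - x ^ 2 / 2) / ħ) * ((ζ * 1 - (2 : ℕ) * (x : ℂ) ^ 1 / 2) / ħ)) (x : ℂ) := by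
    refine HasDerivAt.cexp ?_
    refine HasDerivAt.div_const ?_ _
    refine HasDerivAt.sub ((hasDerivAt_id _).const_mul ζ) ?_
    exact (hasDerivAt_pow 2 (x : ℂ)).div_const 2
  have h' := h.comp_ofReal
  have e : gaussFun ħ ζ 0 = fun y : ℝ => Complex.exp ((ζ * y - (y : ℂ) ^ 2 / 2) / ħ) := by
    ext y; simp [gaussFun]
  rw [e]
  convert h' using 1
  simp only [gaussFun]
  push_cast
  ring

lemma gaussFun_eq (ħ : ℝ) (ζ : ℂ) (k : ℕ) :
    gaussFun ħ ζ k = fun x : ℝ => (x : ℂ) ^ k * gaussFun ħ ζ 0 x := by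
  ext x; simp [gaussFun]

lemma gaussFun_add (ħ : ℝ) (ζ : ℂ) (k j : ℕ) (x : ℝ) :
    gaussFun ħ ζ (k + j) x = (x : ℂ) ^ k * gaussFun ħ ζ j x := by
  simp [gaussFun, pow_add]; ring

lemma hasDerivAt_gaussFun {ħ : ℝ} (ζ : ℂ) (k : ℕ) (x : ℝ) :
    HasDerivAt (gaussFun ħ ζ k)
      (k * gaussFun ħ ζ (k - 1) x + ζ / ħ * gaussFun ħ ζ k x
        - 1 / ħ * gaussFun ħ ζ (k + 1) x) x := by
  rw [gaussFun_eq ħ ζ k]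
  have h1 : HasDerivAt (fun y : ℝ => (y : ℂ) ^ k) (k * (x : ℂ) ^ (k - 1)) x :=
    (hasDerivAt_pow k (x : ℂ)).comp_ofReal
  refine (h1.mul (hasDerivAt_gaussFun_zero (ħ := ħ) ζ x)).congr_deriv ?_
  simp only [gaussFun]
  ring

/-- `gaussFun` as an element of `L²(ℝ)`. -/
noncomputable def gaussLp {ħ : ℝ} (hħ : 0 < ħ) (ζ : ℂ) (k : ℕ) : OrbitalSpace :=
  (memLp_gaussFun hħ ζ k).toLp _

lemma coeFn_gaussLp {ħ : ℝ} (hħ : 0 < ħ) (ζ : ℂ) (k : ℕ) :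
    gaussLp hħ ζ k =ᵐ[volume] gaussFun ħ ζ k := MemLp.coeFn_toLp _

/-- Second order Taylor remainder of `exp (h x / ħ)`, dominated by one fixed Gaussian for all `‖h‖ ≤
1`. This makes the packets differentiable in `L²` with respect to the complex parameter. -/
lemma norm_gaussLp_sub_le {ħ : ℝ} (hħ : 0 < ħ) (ζ : ℂ) (k : ℕ) : ∃ C : ℝ, ∀ h : ℂ, ‖h‖ ≤ 1 →
    ‖gaussLp hħ (ζ + h) k - gaussLp hħ ζ k - (h / ħ) • gaussLp hħ ζ (k + 1)‖ ≤ C * ‖h‖ ^ 2 := by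
  have hb : 0 < 1 / (4 * ħ) := by positivity
  set K : ℝ := (1 / ħ) ^ 2 *
    ((k + 2).factorial * Real.exp (((‖ζ‖ + 1) / ħ + 1) ^ 2 / (4 * (1 / (4 * ħ))))) with hK
  have hK0 : 0 ≤ K := by positivity
  set E := (memLp_exp_neg_mul_sq hb).toLp _ with hE
  refine ⟨K * ‖E‖, fun h hh => ?_⟩
  have key : ‖gaussLp hħ (ζ + h) k - gaussLp hħ ζ k - (h / ħ) • gaussLp hħ ζ (k + 1)‖ ≤
      (K * ‖h‖ ^ 2) * ‖E‖ := by
    refine Lp.norm_le_mul_norm_of_ae_le_mul ?_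
    filter_upwards [Lp.coeFn_sub (gaussLp hħ (ζ + h) k - gaussLp hħ ζ k)
      ((h / ħ) • gaussLp hħ ζ (k + 1)), Lp.coeFn_sub (gaussLp hħ (ζ + h) k) (gaussLp hħ ζ k),
      Lp.coeFn_smul (h / (ħ : ℂ)) (gaussLp hħ ζ (k + 1)), coeFn_gaussLp hħ (ζ + h) k,
      coeFn_gaussLp hħ ζ k, coeFn_gaussLp hħ ζ (k + 1),
      MemLp.coeFn_toLp (memLp_exp_neg_mul_sq hb)] with x h1 h2 h3 h4 h5 h6 h7
    rw [h1, Pi.sub_apply, h2, Pi.sub_apply, h3, Pi.smul_apply, h4, h5, h6, hE, h7,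
      Real.norm_of_nonneg (Real.exp_pos _).le]
    have e1 : gaussFun ħ (ζ + h) k x - gaussFun ħ ζ k x - (h / ħ) • gaussFun ħ ζ (k + 1) x
        = gaussFun ħ ζ k x * (Complex.exp (h * x / ħ) -
            ∑ m ∈ Finset.range 2, (h * x / ħ) ^ m / m.factorial) := by
      have : (((ζ + h) * x - (x : ℂ) ^ 2 / 2) / ħ) =
        (ζ * x - (x : ℂ) ^ 2 / 2) / ħ + h * x / ħ := by ring
      simp only [gaussFun, this, Complex.exp_add, smul_eq_mul, Finset.sum_range_succ,
        Finset.sum_range_zero, Nat.factorial]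
      push_cast
      ring
    rw [e1, norm_mul]
    have e2 := Complex.norm_exp_sub_sum_le_norm_mul_exp (h * x / ħ) 2
    have e3 : ‖h * x / ħ‖ = ‖h‖ * |x| / ħ := by
      simp [abs_of_pos hħ]
    rw [e3] at e2
    have e4 : Real.exp (‖h‖ * |x| / ħ) ≤ Real.exp (|x| / ħ) := by
      gcongr
      nlinarith [abs_nonneg x]
    calc ‖gaussFun ħ ζ k x‖ * ‖_‖
        ≤ (|x| ^ k * Real.exp (‖ζ‖ / ħ * |x| - 2 * (1 / (4 * ħ)) * x ^ 2)) *
          ((‖h‖ * |x| / ħ) ^ 2 * Real.exp (|x| / ħ)) := by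
          refine mul_le_mul (norm_gaussFun_le hħ ζ k x) (e2.trans ?_) (norm_nonneg _)
            (by positivity)
          gcongr
      _ = ((1 / ħ) ^ 2 * ‖h‖ ^ 2) *
          (|x| ^ (k + 2) * Real.exp ((‖ζ‖ + 1) / ħ * |x| - 2 * (1 / (4 * ħ)) * x ^ 2)) := by
          have : (‖ζ‖ + 1) / ħ * |x| - 2 * (1 / (4 * ħ)) * x ^ 2 =
            (‖ζ‖ / ħ * |x| - 2 * (1 / (4 * ħ)) * x ^ 2) + |x| / ħ := by ring
          rw [this, Real.exp_add]; ring
      _ ≤ ((1 / ħ) ^ 2 * ‖h‖ ^ 2) *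
          (((k + 2).factorial * Real.exp (((‖ζ‖ + 1) / ħ + 1) ^ 2 / (4 * (1 / (4 * ħ))))) *
            Real.exp (-(1 / (4 * ħ)) * x ^ 2)) := by
          refine mul_le_mul_of_nonneg_left (abs_pow_mul_exp_le _ hb _ x) (by positivity)
      _ = _ := by rw [hK]; ring
  calc _ ≤ _ := key
    _ = _ := by ring

lemma hasDerivAt_gaussLp {ħ : ℝ} (hħ : 0 < ħ) (ζ : ℂ) (k : ℕ) :
    HasDerivAt (fun z => gaussLp hħ z k) ((1 / ħ : ℂ) • gaussLp hħ ζ (k + 1)) ζ := by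
  obtain ⟨C, hC⟩ := norm_gaussLp_sub_le hħ ζ k
  rw [hasDerivAt_iff_isLittleO_nhds_zero]
  have h1 : (fun h : ℂ => gaussLp hħ (ζ + h) k - gaussLp hħ ζ k -
      h • ((1 / ħ : ℂ) • gaussLp hħ ζ (k + 1))) =O[nhds 0] fun h => ‖h‖ ^ 2 := by
    refine Asymptotics.IsBigO.of_bound C ?_
    filter_upwards [Metric.closedBall_mem_nhds (0 : ℂ) one_pos] with h hh
    rw [mem_closedBall_zero_iff] at hh
    have := hC h hh
    rw [smul_smul, mul_one_div, norm_pow, norm_norm]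
    exact this
  refine h1.trans_isLittleO ?_
  have : (fun h : ℂ => ‖h‖ ^ 2) =o[nhds 0] fun h : ℂ => ‖h‖ ^ 1 :=
    Asymptotics.isLittleO_norm_pow_norm_pow one_lt_two
  simp only [pow_one] at this
  exact this.of_norm_right

/-! ### Gaussian moments -/

lemma integrable_pow_mul_gaussian {b : ℝ} (hb : 0 < b) (j : ℕ) :
    Integrable (fun x : ℝ => x ^ j * Real.exp (-b * x ^ 2)) := by
  have := integrable_rpow_mul_exp_neg_mul_sq hb (s := j) (by linarith [Nat.cast_nonneg (α := ℝ) j])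
  simpa using this

/-- The derivative of `x ^ j exp (-b x²)` has integral zero. At `j = 0` the truncated `j - 1` is
harmless, as its coefficient vanishes. -/
lemma integral_pow_mul_gaussian_succ {b : ℝ} (hb : 0 < b) (j : ℕ) :
    2 * b * ∫ x : ℝ, x ^ (j + 1) * Real.exp (-b * x ^ 2) =
      j * ∫ x : ℝ, x ^ (j - 1) * Real.exp (-b * x ^ 2) := by
  have h1 : ∀ x : ℝ, HasDerivAt (fun x : ℝ => x ^ j * Real.exp (-b * x ^ 2))
      (j * (x ^ (j - 1) * Real.exp (-b * x ^ 2)) -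
        2 * b * (x ^ (j + 1) * Real.exp (-b * x ^ 2))) x := fun x => by
    refine ((hasDerivAt_pow j x).mul (((hasDerivAt_pow 2 x).const_mul (-b)).exp)).congr_deriv ?_
    push_cast
    ring
  have h2 := integral_eq_zero_of_hasDerivAt_of_integrable h1
    (((integrable_pow_mul_gaussian hb _).const_mul _).sub
      ((integrable_pow_mul_gaussian hb _).const_mul _)) (integrable_pow_mul_gaussian hb j)
  rw [integral_sub ((integrable_pow_mul_gaussian hb _).const_mul _)
      ((integrable_pow_mul_gaussian hb _).const_mul _), integral_const_mul,
      integral_const_mul] at h2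
  linarith

lemma integral_pow_mul_gaussian_inv {ħ : ℝ} (hħ : 0 < ħ) :
    (∫ x : ℝ, x ^ 0 * Real.exp (-(1 / ħ) * x ^ 2) = √(Real.pi * ħ)) ∧
    (∫ x : ℝ, x ^ 1 * Real.exp (-(1 / ħ) * x ^ 2) = 0) ∧
    (∫ x : ℝ, x ^ 2 * Real.exp (-(1 / ħ) * x ^ 2) = ħ / 2 * √(Real.pi * ħ)) ∧
    (∫ x : ℝ, x ^ 4 * Real.exp (-(1 / ħ) * x ^ 2) = 3 * ħ ^ 2 / 4 * √(Real.pi * ħ)) := by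
  have hb : 0 < 1 / ħ := by positivity
  have h0 : ∫ x : ℝ, x ^ 0 * Real.exp (-(1 / ħ) * x ^ 2) = √(Real.pi * ħ) := by
    simp only [pow_zero, one_mul]
    rw [integral_gaussian]
    congr 1
    field_simp
  have h1 := integral_pow_mul_gaussian_succ hb 0
  have h2 := integral_pow_mul_gaussian_succ hb 1
  have h4 := integral_pow_mul_gaussian_succ hb 3
  have e : ħ * (1 / ħ) = 1 := by field_simp
  simp only [zero_add, Nat.cast_zero, zero_mul] at h1
  simp only [Nat.reduceAdd, Nat.sub_self, Nat.cast_one, one_mul, h0, Nat.reduceSub] at h2 h4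
  have h1' : ∫ x : ℝ, x ^ 1 * Real.exp (-(1 / ħ) * x ^ 2) = 0 := by
    rcases mul_eq_zero.1 h1 with h | h
    · exact absurd h (by positivity)
    · exact h
  have h2' : ∫ x : ℝ, x ^ 2 * Real.exp (-(1 / ħ) * x ^ 2) = ħ / 2 * √(Real.pi * ħ) := by
    rw [← h2]; field_simp
  refine ⟨h0, h1', h2', ?_⟩
  rw [h2'] at h4
  have : ∫ x : ℝ, x ^ 4 * Real.exp (-(1 / ħ) * x ^ 2) =
      ħ / 2 * (2 * (1 / ħ) * ∫ x : ℝ, x ^ 4 * Real.exp (-(1 / ħ) * x ^ 2)) := by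
    field_simp
  rw [this, h4]
  push_cast
  ring

/-- The wave packet `A exp ((ζ x - x² / 2) / ħ)`, centred at `Re ζ`. -/
noncomputable def packet {ħ : ℝ} (hħ : 0 < ħ) (A ζ : ℂ) : OrbitalSpace := A • gaussLp hħ ζ 0

/-- The wave packet multiplied by `x - Re ζ`. -/
noncomputable def packetOne {ħ : ℝ} (hħ : 0 < ħ) (A ζ : ℂ) : OrbitalSpace :=
  A • (gaussLp hħ ζ 1 - (ζ.re : ℂ) • gaussLp hħ ζ 0)

/-- The wave packet multiplied by `(x - Re ζ)²`. -/
noncomputable def packetTwo {ħ : ℝ} (hħ : 0 < ħ) (A ζ : ℂ) : OrbitalSpace :=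
  A • (gaussLp hħ ζ 2 - (2 * ζ.re : ℂ) • gaussLp hħ ζ 1 + (ζ.re ^ 2 : ℂ) • gaussLp hħ ζ 0)

lemma coeFn_packet {ħ : ℝ} (hħ : 0 < ħ) (A ζ : ℂ) : packet hħ A ζ =ᵐ[volume]
    fun x : ℝ => A * ((x - ζ.re : ℝ) : ℂ) ^ 0 * gaussFun ħ ζ 0 x := by
  filter_upwards [Lp.coeFn_smul A (gaussLp hħ ζ 0), coeFn_gaussLp hħ ζ 0] with x h1 h2
  rw [packet, h1, Pi.smul_apply, h2]
  simp

lemma coeFn_packetOne {ħ : ℝ} (hħ : 0 < ħ) (A ζ : ℂ) : packetOne hħ A ζ =ᵐ[volume]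
    fun x : ℝ => A * ((x - ζ.re : ℝ) : ℂ) ^ 1 * gaussFun ħ ζ 0 x := by
  filter_upwards [Lp.coeFn_smul A (gaussLp hħ ζ 1 - (ζ.re : ℂ) • gaussLp hħ ζ 0),
    Lp.coeFn_sub (gaussLp hħ ζ 1) ((ζ.re : ℂ) • gaussLp hħ ζ 0),
    Lp.coeFn_smul (ζ.re : ℂ) (gaussLp hħ ζ 0), coeFn_gaussLp hħ ζ 0,
    coeFn_gaussLp hħ ζ 1] with x h1 h2 h3 h4 h5
  rw [packetOne, h1, Pi.smul_apply, h2, Pi.sub_apply, h3, Pi.smul_apply, h4, h5]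
  simp only [gaussFun, smul_eq_mul]
  push_cast
  ring

lemma coeFn_packetTwo {ħ : ℝ} (hħ : 0 < ħ) (A ζ : ℂ) : packetTwo hħ A ζ =ᵐ[volume]
    fun x : ℝ => A * ((x - ζ.re : ℝ) : ℂ) ^ 2 * gaussFun ħ ζ 0 x := by
  filter_upwards [Lp.coeFn_smul A (gaussLp hħ ζ 2 - (2 * ζ.re : ℂ) • gaussLp hħ ζ 1 +
      (ζ.re ^ 2 : ℂ) • gaussLp hħ ζ 0),
    Lp.coeFn_add (gaussLp hħ ζ 2 - (2 * ζ.re : ℂ) • gaussLp hħ ζ 1)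
      ((ζ.re ^ 2 : ℂ) • gaussLp hħ ζ 0),
    Lp.coeFn_sub (gaussLp hħ ζ 2) ((2 * ζ.re : ℂ) • gaussLp hħ ζ 1),
    Lp.coeFn_smul (2 * ζ.re : ℂ) (gaussLp hħ ζ 1), Lp.coeFn_smul (ζ.re ^ 2 : ℂ) (gaussLp hħ ζ 0),
    coeFn_gaussLp hħ ζ 0, coeFn_gaussLp hħ ζ 1, coeFn_gaussLp hħ ζ 2] with
    x h1 h2 h3 h4 h5 h6 h7 h8
  rw [packetTwo, h1, Pi.smul_apply, h2, Pi.add_apply, h3, Pi.sub_apply, h4, h5, Pi.smul_apply,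
    Pi.smul_apply, h6, h7, h8]
  simp only [gaussFun, smul_eq_mul]
  push_cast
  ring

lemma norm_gaussFun_zero_sq {ħ : ℝ} (hħ : 0 < ħ) (ζ : ℂ) (x : ℝ) :
    ‖gaussFun ħ ζ 0 x‖ ^ 2 = Real.exp (ζ.re ^ 2 / ħ) * Real.exp (-(1 / ħ) * (x - ζ.re) ^ 2) := by
  have h1 : ((ζ * x - (x : ℂ) ^ 2 / 2) / ħ).re = (ζ.re * x - x ^ 2 / 2) / ħ := by
    have : ((ζ * x - (x : ℂ) ^ 2 / 2) / ħ) =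
      ((ζ.re * x - x ^ 2 / 2) / ħ : ℝ) + ((ζ.im * x) / ħ : ℝ) * Complex.I := by
      conv_lhs => rw [← Complex.re_add_im ζ]
      push_cast
      ring
    rw [this]
    simp only [Complex.add_re, Complex.ofReal_re, Complex.re_ofReal_mul, Complex.I_re, mul_zero,
      add_zero]
  rw [gaussFun, pow_zero, one_mul, Complex.norm_exp, h1, ← Real.exp_nat_mul, ← Real.exp_add]
  congr 1
  field_simp
  push_cast
  ring

/-- The squared modulus of the Gaussian is a real Gaussian centred at `Re ζ`, so a translation
reduces every inner product needed to a centred moment. -/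
lemma inner_packet_of_ae {ħ : ℝ} (hħ : 0 < ħ) (A ζ : ℂ) {f g : OrbitalSpace} {i j : ℕ}
    (hf : f =ᵐ[volume] fun x : ℝ => A * ((x - ζ.re : ℝ) : ℂ) ^ i * gaussFun ħ ζ 0 x)
    (hg : g =ᵐ[volume] fun x : ℝ => A * ((x - ζ.re : ℝ) : ℂ) ^ j * gaussFun ħ ζ 0 x) :
    ⟪f, g⟫_ℂ = ((‖A‖ ^ 2 * Real.exp (ζ.re ^ 2 / ħ) *
      ∫ x : ℝ, x ^ (i + j) * Real.exp (-(1 / ħ) * x ^ 2) : ℝ) : ℂ) := by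
  rw [L2.inner_def]
  have h1 : ∀ᵐ x : ℝ, ⟪f x, g x⟫_ℂ = ((‖A‖ ^ 2 * Real.exp (ζ.re ^ 2 / ħ) *
      ((x - ζ.re) ^ (i + j) * Real.exp (-(1 / ħ) * (x - ζ.re) ^ 2)) : ℝ) : ℂ) := by
    filter_upwards [hf, hg] with x h1 h2
    rw [h1, h2, RCLike.inner_apply]
    have e := norm_gaussFun_zero_sq hħ ζ x
    have : ‖A‖ ^ 2 * Real.exp (ζ.re ^ 2 / ħ) *
      ((x - ζ.re) ^ (i + j) * Real.exp (-(1 / ħ) * (x - ζ.re) ^ 2)) =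
      ‖A‖ ^ 2 * (x - ζ.re) ^ (i + j) * ‖gaussFun ħ ζ 0 x‖ ^ 2 := by rw [e]; ring
    rw [this]
    simp only [Complex.ofReal_mul, Complex.ofReal_pow, ← Complex.mul_conj', map_mul, map_pow,
      Complex.conj_ofReal]
    ring
  rw [integral_congr_ae h1, integral_complex_ofReal, integral_const_mul]
  congr 2
  exact integral_sub_right_eq_self (fun x : ℝ => x ^ (i + j) * Real.exp (-(1 / ħ) * x ^ 2)) ζ.re

lemma inner_packet_packet {ħ : ℝ} (hħ : 0 < ħ) {A ζ : ℂ}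
    (hA : ‖A‖ ^ 2 * Real.exp (ζ.re ^ 2 / ħ) * √(Real.pi * ħ) = 1) :
    ⟪packet hħ A ζ, packet hħ A ζ⟫_ℂ = 1 := by
  rw [inner_packet_of_ae hħ A ζ (coeFn_packet hħ A ζ) (coeFn_packet hħ A ζ),
    (integral_pow_mul_gaussian_inv hħ).1, hA, Complex.ofReal_one]

lemma inner_packetOne_packet {ħ : ℝ} (hħ : 0 < ħ) (A ζ : ℂ) :
    ⟪packetOne hħ A ζ, packet hħ A ζ⟫_ℂ = 0 := by
  rw [inner_packet_of_ae hħ A ζ (coeFn_packetOne hħ A ζ) (coeFn_packet hħ A ζ),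
    (integral_pow_mul_gaussian_inv hħ).2.1, mul_zero, Complex.ofReal_zero]

lemma inner_packetTwo_packet {ħ : ℝ} (hħ : 0 < ħ) {A ζ : ℂ}
    (hA : ‖A‖ ^ 2 * Real.exp (ζ.re ^ 2 / ħ) * √(Real.pi * ħ) = 1) :
    ⟪packetTwo hħ A ζ, packet hħ A ζ⟫_ℂ = (ħ / 2 : ℝ) := by
  rw [inner_packet_of_ae hħ A ζ (coeFn_packetTwo hħ A ζ) (coeFn_packet hħ A ζ),
    (integral_pow_mul_gaussian_inv hħ).2.2.1]
  congr 1
  linear_combination (ħ / 2) * hA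

lemma inner_packetOne_packetOne {ħ : ℝ} (hħ : 0 < ħ) {A ζ : ℂ}
    (hA : ‖A‖ ^ 2 * Real.exp (ζ.re ^ 2 / ħ) * √(Real.pi * ħ) = 1) :
    ⟪packetOne hħ A ζ, packetOne hħ A ζ⟫_ℂ = (ħ / 2 : ℝ) := by
  rw [inner_packet_of_ae hħ A ζ (coeFn_packetOne hħ A ζ) (coeFn_packetOne hħ A ζ),
    (integral_pow_mul_gaussian_inv hħ).2.2.1]
  congr 1
  linear_combination (ħ / 2) * hA

lemma inner_packetTwo_packetTwo {ħ : ℝ} (hħ : 0 < ħ) {A ζ : ℂ}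
    (hA : ‖A‖ ^ 2 * Real.exp (ζ.re ^ 2 / ħ) * √(Real.pi * ħ) = 1) :
    ⟪packetTwo hħ A ζ, packetTwo hħ A ζ⟫_ℂ = (3 * ħ ^ 2 / 4 : ℝ) := by
  rw [inner_packet_of_ae hħ A ζ (coeFn_packetTwo hħ A ζ) (coeFn_packetTwo hħ A ζ),
    (integral_pow_mul_gaussian_inv hħ).2.2.2]
  congr 1
  linear_combination (3 * ħ ^ 2 / 4) * hA

/-! ### Spin operators and spin coherent states -/

/-- A matrix acting on the spin space. -/
noncomputable def spinAct {n : ℕ} (M : Matrix (Fin (n + 1)) (Fin (n + 1)) ℂ) (x : SpinSpace n) :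
    SpinSpace n := Matrix.toEuclideanLin M x

section spinAct

variable {n : ℕ} (M M' : Matrix (Fin (n + 1)) (Fin (n + 1)) ℂ) (x y : SpinSpace n) (c : ℂ)

lemma spinAct_apply (i : Fin (n + 1)) : spinAct M x i = ∑ j, M i j * x j := rfl

lemma spinAct_add_left : spinAct (M + M') x = spinAct M x + spinAct M' x := by
  simp [spinAct]

lemma spinAct_sub_left : spinAct (M - M') x = spinAct M x - spinAct M' x := by
  simp [spinAct]

lemma spinAct_smul_left : spinAct (c • M) x = c • spinAct M x := by
  simp [spinAct]

lemma spinAct_mul : spinAct (M * M') x = spinAct M (spinAct M' x) := by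
  ext i
  simp only [spinAct_apply, Matrix.mul_apply, Finset.sum_mul, Finset.mul_sum]
  rw [Finset.sum_comm]
  simp only [mul_assoc]

lemma spinAct_add : spinAct M (x + y) = spinAct M x + spinAct M y := by
  simp [spinAct]

lemma spinAct_sub : spinAct M (x - y) = spinAct M x - spinAct M y := by
  simp [spinAct]

lemma spinAct_smul : spinAct M (c • x) = c • spinAct M x := by
  simp [spinAct]

lemma inner_spinAct_left : ⟪spinAct M x, y⟫_ℂ = ⟪x, spinAct Mᴴ y⟫_ℂ := by
  simp only [PiLp.inner_apply, RCLike.inner_apply, spinAct_apply, map_sum, map_mul,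
    Finset.mul_sum, Finset.sum_mul, Matrix.conjTranspose_apply, RCLike.star_def]
  rw [Finset.sum_comm]
  refine Finset.sum_congr rfl fun i _ => Finset.sum_congr rfl fun j _ => ?_
  ring

lemma inner_spinAct_right : ⟪x, spinAct M y⟫_ℂ = ⟪spinAct Mᴴ x, y⟫_ℂ := by
  rw [inner_spinAct_left, Matrix.conjTranspose_conjTranspose]

end spinAct

/-! ### Adjoints and commutation relations of the spin operators -/

lemma conjTranspose_spinThree (n : ℕ) : (spinThree n)ᴴ = spinThree n := by
  rw [spinThree, Matrix.diagonal_conjTranspose]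
  congr 1
  ext k
  simp

lemma conjTranspose_spinLower (n : ℕ) : (spinLower n)ᴴ = spinRaise n := by
  rw [spinLower, Matrix.conjTranspose_conjTranspose]

lemma conjTranspose_spinOne (n : ℕ) : (spinOne n)ᴴ = spinOne n := by
  rw [spinOne, Matrix.conjTranspose_smul, Matrix.conjTranspose_add, conjTranspose_spinLower,
    ← spinLower, add_comm (spinLower n) (spinRaise n)]
  simp

lemma spinThree_commutator_spinRaise (n : ℕ) :
    spinThree n * spinRaise n - spinRaise n * spinThree n = spinRaise n := by
  ext i j
  rw [Matrix.sub_apply, spinThree, Matrix.diagonal_mul, Matrix.mul_diagonal]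
  simp only [spinRaise, Matrix.of_apply]
  split_ifs with h
  · rw [h]; push_cast; ring
  · simp

lemma spinThree_commutator_spinLower (n : ℕ) :
    spinThree n * spinLower n - spinLower n * spinThree n = -spinLower n := by
  have := congrArg Matrix.conjTranspose (spinThree_commutator_spinRaise n)
  rw [Matrix.conjTranspose_sub, Matrix.conjTranspose_mul, Matrix.conjTranspose_mul,
    conjTranspose_spinThree] at this
  change spinLower n * spinThree n - spinThree n * spinLower n = spinLower n at this
  rw [← neg_sub, this]

lemma spinLower_apply (n : ℕ) (i j : Fin (n + 1)) : spinLower n i j =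
    if (j : ℕ) = (i : ℕ) + 1 then ((√(((n : ℝ) - (i : ℕ)) * ((i : ℕ) + 1)) : ℝ) : ℂ) else 0 := by
  simp only [spinLower, Matrix.conjTranspose_apply, spinRaise, Matrix.of_apply]
  split_ifs <;> simp

lemma spinRaise_apply (n : ℕ) (i j : Fin (n + 1)) : spinRaise n i j =
    if (i : ℕ) = (j : ℕ) + 1 then ((√(((n : ℝ) - (j : ℕ)) * ((j : ℕ) + 1)) : ℝ) : ℂ) else 0 := rfl

lemma spinAct_spinRaise_zero (n : ℕ) (x : SpinSpace n) : spinAct (spinRaise n) x 0 = 0 := by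
  rw [spinAct_apply]
  refine Finset.sum_eq_zero fun j _ => ?_
  rw [spinRaise_apply, if_neg (by simp), zero_mul]

lemma spinAct_spinRaise_succ (n k : ℕ) (hk : k + 1 < n + 1) (x : SpinSpace n) :
    spinAct (spinRaise n) x ⟨k + 1, hk⟩ =
      ((√(((n : ℝ) - k) * (k + 1)) : ℝ) : ℂ) * x ⟨k, by omega⟩ := by
  rw [spinAct_apply, Finset.sum_eq_single ⟨k, by omega⟩]
  · rw [spinRaise_apply, if_pos rfl]
  · intro j _ hj
    rw [spinRaise_apply, if_neg, zero_mul]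
    intro h
    exact hj (Fin.ext (by simpa using h.symm))
  · simp

lemma spinAct_spinLower_last (n : ℕ) (x : SpinSpace n) :
    spinAct (spinLower n) x ⟨n, by omega⟩ = 0 := by
  rw [spinAct_apply]
  refine Finset.sum_eq_zero fun j _ => ?_
  rw [spinLower_apply, if_neg (by have := j.2; simp only; omega), zero_mul]

lemma spinAct_spinLower_of_lt (n k : ℕ) (hk : k < n) (x : SpinSpace n) :
    spinAct (spinLower n) x ⟨k, by omega⟩ =
      ((√(((n : ℝ) - k) * (k + 1)) : ℝ) : ℂ) * x ⟨k + 1, by omega⟩ := by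
  rw [spinAct_apply, Finset.sum_eq_single ⟨k + 1, by omega⟩]
  · rw [spinLower_apply, if_pos rfl]
  · intro j _ hj
    rw [spinLower_apply, if_neg, zero_mul]
    intro h
    exact hj (Fin.ext (by simpa using h))
  · simp

lemma spinAct_spinThree (n : ℕ) (x : SpinSpace n) (k : Fin (n + 1)) :
    spinAct (spinThree n) x k = (((k : ℕ) : ℂ) - n / 2) * x k := by
  rw [spinAct_apply, Finset.sum_eq_single k]
  · simp [spinThree]
  · intro j _ hj
    rw [spinThree, Matrix.diagonal_apply_ne _ (Ne.symm hj), zero_mul]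
  · simp

lemma spinAct_ext {n : ℕ} {M M' : Matrix (Fin (n + 1)) (Fin (n + 1)) ℂ}
    (h : ∀ x, spinAct M x = spinAct M' x) : M = M' := by
  refine Matrix.toEuclideanLin.injective (LinearMap.ext h)

lemma spinRaise_commutator_spinLower (n : ℕ) :
    spinRaise n * spinLower n - spinLower n * spinRaise n = (2 : ℂ) • spinThree n := by
  refine spinAct_ext fun x => ?_
  rw [spinAct_sub_left, spinAct_mul, spinAct_mul, spinAct_smul_left]
  have hsq : ∀ k : ℕ, k ≤ n → ((√(((n : ℝ) - k) * (k + 1)) : ℝ) : ℂ) *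
      ((√(((n : ℝ) - k) * (k + 1)) : ℝ) : ℂ) = ((n : ℂ) - k) * (k + 1) := fun k hk => by
    rw [← Complex.ofReal_mul, Real.mul_self_sqrt]
    · push_cast; ring
    · have : (k : ℝ) ≤ n := by exact_mod_cast hk
      have : 0 ≤ (n : ℝ) - k := by linarith
      positivity
  have h1 : ∀ k : Fin (n + 1), spinAct (spinRaise n) (spinAct (spinLower n) x) k =
      ((n : ℂ) - (k : ℕ) + 1) * (k : ℕ) * x k := by
    rintro ⟨k, hk⟩
    cases k with
    | zero => simpa using spinAct_spinRaise_zero n (spinAct (spinLower n) x)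
    | succ k =>
      rw [spinAct_spinRaise_succ, spinAct_spinLower_of_lt n k (by omega), ← mul_assoc,
        hsq k (by omega)]
      push_cast
      ring
  have h2 : ∀ k : Fin (n + 1), spinAct (spinLower n) (spinAct (spinRaise n) x) k =
      ((n : ℂ) - (k : ℕ)) * ((k : ℕ) + 1) * x k := by
    rintro ⟨k, hk⟩
    rcases Nat.lt_or_ge k n with h | h
    · rw [spinAct_spinLower_of_lt n k h, spinAct_spinRaise_succ, ← mul_assoc, hsq k h.le]
    · obtain rfl : k = n := by omega
      rw [spinAct_spinLower_last]
      simp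
  ext k
  simp only [PiLp.sub_apply, PiLp.smul_apply, h1, h2, spinAct_spinThree, smul_eq_mul]
  ring

/-- The vector with coordinates `√C(n,k) u ^ k v ^ (n - k)`: the spin coherent state of the
spinor `(u, v)`. -/
noncomputable def spinorPow (n : ℕ) (u v : ℂ) : SpinSpace n :=
  WithLp.toLp 2 fun k => ((√(n.choose k) : ℝ) : ℂ) * (u ^ (k : ℕ) * v ^ (n - k : ℕ))

/-- The derivative of `spinorPow n u v` in `u`. -/
noncomputable def spinorPowFst (n : ℕ) (u v : ℂ) : SpinSpace n :=
  WithLp.toLp 2 fun k => ((√(n.choose k) : ℝ) : ℂ) * ((k : ℕ) * u ^ ((k : ℕ) - 1) * v ^ (n - k : ℕ))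

/-- The derivative of `spinorPow n u v` in `v`. -/
noncomputable def spinorPowSnd (n : ℕ) (u v : ℂ) : SpinSpace n :=
  WithLp.toLp 2 fun k => ((√(n.choose k) : ℝ) : ℂ) *
    (u ^ (k : ℕ) * ((n - k : ℕ) * v ^ ((n - k : ℕ) - 1)))

lemma sqrt_choose_mul_sqrt {n k : ℕ} (hk : k < n) :
    √(n.choose k) * √(((n : ℝ) - k) * (k + 1)) = √(n.choose (k + 1)) * (k + 1) := by
  have h : (n.choose (k + 1) : ℝ) * (k + 1) = n.choose k * ((n : ℝ) - k) := by
    have := Nat.choose_succ_right_eq n k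
    have h' : ((n.choose (k + 1) * (k + 1) : ℕ) : ℝ) = (n.choose k * (n - k) : ℕ) := by rw [this]
    rw [Nat.cast_mul, Nat.cast_mul, Nat.cast_sub hk.le] at h'
    simpa using h'
  rw [← Real.sqrt_mul (by positivity), ← mul_assoc, ← h]
  rw [show (n.choose (k + 1) : ℝ) * (k + 1) * (k + 1) = n.choose (k + 1) * ((k : ℝ) + 1) ^ 2 by ring,
    Real.sqrt_mul (by positivity), Real.sqrt_sq (by positivity)]

lemma sqrt_choose_succ_mul_sqrt {n k : ℕ} (hk : k < n) :
    √(n.choose (k + 1)) * √(((n : ℝ) - k) * (k + 1)) = √(n.choose k) * ((n : ℝ) - k) := by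
  have h : (n.choose (k + 1) : ℝ) * (k + 1) = n.choose k * ((n : ℝ) - k) := by
    have := Nat.choose_succ_right_eq n k
    have h' : ((n.choose (k + 1) * (k + 1) : ℕ) : ℝ) = (n.choose k * (n - k) : ℕ) := by rw [this]
    rw [Nat.cast_mul, Nat.cast_mul, Nat.cast_sub hk.le] at h'
    simpa using h'
  have h0 : 0 ≤ (n : ℝ) - k := by
    have : (k : ℝ) ≤ n := by exact_mod_cast hk.le
    linarith
  rw [← Real.sqrt_mul (by positivity),
    show (n.choose (k + 1) : ℝ) * (((n : ℝ) - k) * (k + 1)) = n.choose k * ((n : ℝ) - k) ^ 2 by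
      linear_combination ((n : ℝ) - k) * h,
    Real.sqrt_mul (by positivity), Real.sqrt_sq h0]

lemma spinAct_spinRaise_spinorPow (n : ℕ) (u v : ℂ) :
    spinAct (spinRaise n) (spinorPow n u v) = v • spinorPowFst n u v := by
  ext ⟨k, hk⟩
  cases k with
  | zero => simpa [spinorPowFst] using spinAct_spinRaise_zero n (spinorPow n u v)
  | succ k =>
    rw [spinAct_spinRaise_succ]
    have h := congrArg (fun r : ℝ => (r : ℂ)) (sqrt_choose_mul_sqrt (n := n) (k := k) (by omega))
    simp only [Complex.ofReal_mul, Complex.ofReal_add, Complex.ofReal_natCast,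
      Complex.ofReal_one] at h
    simp only [spinorPow, spinorPowFst, PiLp.smul_apply, smul_eq_mul]
    rw [show n - k = (n - (k + 1)) + 1 by omega, pow_succ v]
    push_cast
    linear_combination (u ^ k * (v ^ (n - (k + 1)) * v)) * h

lemma spinAct_spinLower_spinorPow (n : ℕ) (u v : ℂ) :
    spinAct (spinLower n) (spinorPow n u v) = u • spinorPowSnd n u v := by
  ext ⟨k, hk⟩
  rcases Nat.lt_or_ge k n with h' | h'
  · rw [spinAct_spinLower_of_lt n k h']
    have h := congrArg (fun r : ℝ => (r : ℂ)) (sqrt_choose_succ_mul_sqrt h')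
    simp only [Complex.ofReal_mul, Complex.ofReal_sub, Complex.ofReal_natCast] at h
    simp only [spinorPow, spinorPowSnd, PiLp.smul_apply, smul_eq_mul]
    rw [Nat.cast_sub h'.le, show n - (k + 1) = n - k - 1 by omega, pow_succ u]
    linear_combination (u ^ k * u * v ^ (n - k - 1)) * h
  · obtain rfl : k = n := by omega
    rw [spinAct_spinLower_last]
    simp [spinorPowSnd]

lemma natCast_mul_pow_pred (k : ℕ) (u : ℂ) : u * ((k : ℂ) * u ^ (k - 1)) = k * u ^ k := by
  cases k with
  | zero => simp
  | succ k => rw [Nat.add_sub_cancel, pow_succ]; ring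

lemma spinAct_spinThree_spinorPow (n : ℕ) (u v : ℂ) :
    spinAct (spinThree n) (spinorPow n u v) =
      (1 / 2 : ℂ) • (u • spinorPowFst n u v - v • spinorPowSnd n u v) := by
  ext k
  rw [spinAct_spinThree]
  have hk : (k : ℕ) ≤ n := by omega
  have h1 := natCast_mul_pow_pred k u
  have h2 := natCast_mul_pow_pred (n - k) v
  rw [Nat.cast_sub hk] at h2
  simp only [spinorPow, spinorPowFst, spinorPowSnd, PiLp.smul_apply, PiLp.sub_apply, smul_eq_mul]
  rw [Nat.cast_sub hk]
  linear_combination -(1 / 2 * ((√(n.choose k) : ℝ) : ℂ) * v ^ (n - k : ℕ)) * h1 +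
    (1 / 2 * ((√(n.choose k) : ℝ) : ℂ) * u ^ (k : ℕ)) * h2

lemma euler_spinorPow (n : ℕ) (u v : ℂ) :
    u • spinorPowFst n u v + v • spinorPowSnd n u v = (n : ℂ) • spinorPow n u v := by
  ext k
  have hk : (k : ℕ) ≤ n := by omega
  have h1 := natCast_mul_pow_pred k u
  have h2 := natCast_mul_pow_pred (n - k) v
  rw [Nat.cast_sub hk] at h2
  simp only [spinorPow, spinorPowFst, spinorPowSnd, PiLp.smul_apply, PiLp.add_apply, smul_eq_mul]
  rw [Nat.cast_sub hk]
  linear_combination (((√(n.choose k) : ℝ) : ℂ) * v ^ (n - k : ℕ)) * h1 +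
    (((√(n.choose k) : ℝ) : ℂ) * u ^ (k : ℕ)) * h2

lemma inner_spinorPow_self (n : ℕ) (u v : ℂ) :
    ⟪spinorPow n u v, spinorPow n u v⟫_ℂ =
      (starRingEnd ℂ u * u + starRingEnd ℂ v * v) ^ n := by
  rw [add_pow, Finset.sum_range, PiLp.inner_apply]
  refine Finset.sum_congr rfl fun k _ => ?_
  have : ((√(n.choose k) : ℝ) : ℂ) * ((√(n.choose k) : ℝ) : ℂ) = n.choose k := by
    rw [← Complex.ofReal_mul, Real.mul_self_sqrt (by positivity), Complex.ofReal_natCast]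
  simp only [spinorPow, RCLike.inner_apply, map_mul, map_pow, Complex.conj_ofReal]
  rw [← this]
  ring

lemma hasDerivAt_spinorPow (n : ℕ) {u v : ℝ → ℂ} {u' v' : ℂ} {t : ℝ} (hu : HasDerivAt u u' t)
    (hv : HasDerivAt v v' t) : HasDerivAt (fun s => spinorPow n (u s) (v s))
      (u' • spinorPowFst n (u t) (v t) + v' • spinorPowSnd n (u t) (v t)) t := by
  rw [← hasDerivWithinAt_univ, hasDerivWithinAt_iff_hasFDerivWithinAt, hasFDerivWithinAt_piLp]
  intro k
  have h : HasDerivAt (fun s => ((√(n.choose k) : ℝ) : ℂ) * (u s ^ (k : ℕ) * v s ^ (n - k : ℕ)))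
      (((√(n.choose k) : ℝ) : ℂ) * (((k : ℕ) * u t ^ ((k : ℕ) - 1) * u') * v t ^ (n - k : ℕ) +
        u t ^ (k : ℕ) * (((n - k : ℕ) : ℂ) * v t ^ ((n - k : ℕ) - 1) * v'))) t :=
    ((hu.pow k).mul (hv.pow (n - k))).const_mul _
  refine h.hasFDerivAt.hasFDerivWithinAt.congr_fderiv ?_
  ext
  simp [spinorPowFst, spinorPowSnd]
  ring

/-- The derivative of `spinorPow n u v` in the direction `(-v̄, ū)` orthogonal to `(u, v)`. -/
noncomputable def spinorTangent (n : ℕ) (u v : ℂ) : SpinSpace n :=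
  starRingEnd ℂ u • spinorPowSnd n u v - starRingEnd ℂ v • spinorPowFst n u v

/-- The operator that raises the spin coherent state of `(u, v)`. -/
noncomputable def spinorRaise (n : ℕ) (u v : ℂ) : Matrix (Fin (n + 1)) (Fin (n + 1)) ℂ :=
  starRingEnd ℂ u ^ 2 • spinLower n - starRingEnd ℂ v ^ 2 • spinRaise n
    - (2 * starRingEnd ℂ u * starRingEnd ℂ v) • spinThree n

/-- The operator that annihilates the spin coherent state of `(u, v)`. -/
noncomputable def spinorLower (n : ℕ) (u v : ℂ) : Matrix (Fin (n + 1)) (Fin (n + 1)) ℂ :=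
  u ^ 2 • spinRaise n - v ^ 2 • spinLower n - (2 * u * v) • spinThree n

lemma conjTranspose_spinorRaise (n : ℕ) (u v : ℂ) : (spinorRaise n u v)ᴴ = spinorLower n u v := by
  simp [spinorRaise, spinorLower, Matrix.conjTranspose_sub, conjTranspose_spinThree,
    conjTranspose_spinLower]
  rw [← spinLower]

lemma spinAct_spinorLower_spinorPow (n : ℕ) (u v : ℂ) :
    spinAct (spinorLower n u v) (spinorPow n u v) = 0 := by
  simp only [spinorLower, spinAct_sub_left, spinAct_smul_left, spinAct_spinRaise_spinorPow,
    spinAct_spinLower_spinorPow, spinAct_spinThree_spinorPow]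
  module

/-! ### Ladder operators adapted to a unit spinor -/

section unitSpinor

variable {n : ℕ} {u v : ℂ}

/-- Splits a partial derivative into a radial part, which Euler's identity turns into a multiple of
the state, and a part along the tangent. -/
lemma spinorPowFst_eq (h : starRingEnd ℂ u * u + starRingEnd ℂ v * v = 1) : spinorPowFst n u v =
    (starRingEnd ℂ u * n) • spinorPow n u v - v • spinorTangent n u v := by
  rw [mul_smul, ← euler_spinorPow, spinorTangent]
  linear_combination (norm := module) -h • spinorPowFst n u v

lemma spinorPowSnd_eq (h : starRingEnd ℂ u * u + starRingEnd ℂ v * v = 1) : spinorPowSnd n u v =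
    (starRingEnd ℂ v * n) • spinorPow n u v + u • spinorTangent n u v := by
  rw [mul_smul, ← euler_spinorPow, spinorTangent]
  linear_combination (norm := module) -h • spinorPowSnd n u v

lemma spinAct_spinorRaise_spinorPow (h : starRingEnd ℂ u * u + starRingEnd ℂ v * v = 1) :
    spinAct (spinorRaise n u v) (spinorPow n u v) = spinorTangent n u v := by
  simp only [spinorRaise, spinAct_sub_left, spinAct_smul_left, spinAct_spinRaise_spinorPow,
    spinAct_spinLower_spinorPow, spinAct_spinThree_spinorPow, spinorTangent]
  linear_combination (norm := module) (starRingEnd ℂ u * h) • spinorPowSnd n u v -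
    (starRingEnd ℂ v * h) • spinorPowFst n u v

lemma spinAct_spinOne_spinorPow (h : starRingEnd ℂ u * u + starRingEnd ℂ v * v = 1) :
    spinAct (spinOne n) (spinorPow n u v) =
      ((n : ℂ) * ((starRingEnd ℂ u * v + starRingEnd ℂ v * u) / 2)) • spinorPow n u v +
        ((u ^ 2 - v ^ 2) / 2) • spinorTangent n u v := by
  simp only [spinOne, spinAct_add_left, spinAct_smul_left, spinAct_spinRaise_spinorPow,
    spinAct_spinLower_spinorPow]
  rw [spinorPowFst_eq h, spinorPowSnd_eq h]
  module

/-- `2 J₃` for the axis of the spinor `(u, v)`. -/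
noncomputable def spinorAxis (n : ℕ) (u v : ℂ) : Matrix (Fin (n + 1)) (Fin (n + 1)) ℂ :=
  (2 * (starRingEnd ℂ u * u - starRingEnd ℂ v * v)) • spinThree n +
    (2 * u * starRingEnd ℂ v) • spinRaise n + (2 * starRingEnd ℂ u * v) • spinLower n

/-- Together with the next commutator this is the `su(2)` algebra rotated to the axis of the spinor:
the coherent state is an extremal weight vector of weight `n`, and each excitation changes the
weight by `-2`. -/
lemma spinorLower_commutator_spinorRaise (h : starRingEnd ℂ u * u + starRingEnd ℂ v * v = 1) :
    spinorLower n u v * spinorRaise n u v - spinorRaise n u v * spinorLower n u v =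
      spinorAxis n u v := by
  have h1 := spinRaise_commutator_spinLower n
  have h2 := spinThree_commutator_spinRaise n
  have h3 := spinThree_commutator_spinLower n
  simp only [spinorLower, spinorRaise, spinorAxis]
  generalize starRingEnd ℂ u = u' at *
  generalize starRingEnd ℂ v = v' at *
  generalize spinRaise n = a at *
  generalize spinLower n = b at *
  generalize spinThree n = d at *
  simp only [mul_sub, sub_mul, smul_mul_smul_comm]
  linear_combination (norm := module) (u ^ 2 * u' ^ 2 - v ^ 2 * v' ^ 2) • h1 +
    (2 * u' * v' * u ^ 2 + 2 * u * v * v' ^ 2) • h2 -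
    (2 * u' * v' * v ^ 2 + 2 * u * v * u' ^ 2) • h3 +
    (2 * (u' * u - v' * v) * h) • d + (2 * u * v' * h) • a + (2 * u' * v * h) • b

lemma spinorAxis_commutator_spinorRaise (h : starRingEnd ℂ u * u + starRingEnd ℂ v * v = 1) :
    spinorAxis n u v * spinorRaise n u v - spinorRaise n u v * spinorAxis n u v =
      (-2 : ℂ) • spinorRaise n u v := by
  have h1 := spinRaise_commutator_spinLower n
  have h2 := spinThree_commutator_spinRaise n
  have h3 := spinThree_commutator_spinLower n
  simp only [spinorRaise, spinorAxis]
  generalize starRingEnd ℂ u = u' at *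
  generalize starRingEnd ℂ v = v' at *
  generalize spinRaise n = a at *
  generalize spinLower n = b at *
  generalize spinThree n = d at *
  simp only [mul_sub, sub_mul, mul_add, add_mul, smul_mul_smul_comm]
  linear_combination (norm := module) (2 * u * v' * u' ^ 2 + 2 * u' * v * v' ^ 2) • h1 -
    (2 * (u' * u - v' * v) * v' ^ 2 - 4 * u * v' * u' * v') • h2 +
    (2 * (u' * u - v' * v) * u' ^ 2 + 4 * u' * v * u' * v') • h3 +
    (4 * u' * v' * h) • d + (2 * v' ^ 2 * h) • a - (2 * u' ^ 2 * h) • b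

lemma spinAct_spinorAxis_spinorPow (h : starRingEnd ℂ u * u + starRingEnd ℂ v * v = 1) :
    spinAct (spinorAxis n u v) (spinorPow n u v) = (n : ℂ) • spinorPow n u v := by
  rw [← euler_spinorPow]
  simp only [spinorAxis, spinAct_add_left, spinAct_smul_left, spinAct_spinRaise_spinorPow,
    spinAct_spinLower_spinorPow, spinAct_spinThree_spinorPow]
  linear_combination (norm := module) (u * h) • spinorPowFst n u v + (v * h) • spinorPowSnd n u v

lemma spinAct_spinorLower_spinorTangent (h : starRingEnd ℂ u * u + starRingEnd ℂ v * v = 1) :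
    spinAct (spinorLower n u v) (spinorTangent n u v) = (n : ℂ) • spinorPow n u v := by
  have h1 := congrArg (fun M => spinAct M (spinorPow n u v))
    (spinorLower_commutator_spinorRaise (n := n) h)
  simp only [spinAct_sub_left, spinAct_mul, spinAct_spinorRaise_spinorPow h,
    spinAct_spinorLower_spinorPow, spinAct_spinorAxis_spinorPow h] at h1
  rw [← h1]
  simp [spinAct]

lemma inner_spinorTangent_self (h : starRingEnd ℂ u * u + starRingEnd ℂ v * v = 1) :
    ⟪spinorTangent n u v, spinorTangent n u v⟫_ℂ = n := by
  nth_rewrite 1 [← spinAct_spinorRaise_spinorPow h]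
  rw [inner_spinAct_left, conjTranspose_spinorRaise, spinAct_spinorLower_spinorTangent h,
    inner_smul_right, inner_spinorPow_self, h, one_pow, mul_one]

lemma inner_spinorPow_spinorTangent (h : starRingEnd ℂ u * u + starRingEnd ℂ v * v = 1) :
    ⟪spinorPow n u v, spinorTangent n u v⟫_ℂ = 0 := by
  rw [← spinAct_spinorRaise_spinorPow h, inner_spinAct_right, conjTranspose_spinorRaise,
    spinAct_spinorLower_spinorPow, inner_zero_left]

/-- The axis operator contributes the weight `n - 2` of the first excitation, and lowering first,
then raising, contributes `n`. -/
lemma spinAct_spinorLower_spinorRaise_spinorTangent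
    (h : starRingEnd ℂ u * u + starRingEnd ℂ v * v = 1) :
    spinAct (spinorLower n u v) (spinAct (spinorRaise n u v) (spinorTangent n u v)) =
      (2 * n - 2 : ℂ) • spinorTangent n u v := by
  have h1 := congrArg (fun M => spinAct M (spinorTangent n u v))
    (spinorLower_commutator_spinorRaise (n := n) h)
  have h2 := congrArg (fun M => spinAct M (spinorPow n u v))
    (spinorAxis_commutator_spinorRaise (n := n) h)
  simp only [spinAct_sub_left, spinAct_mul, spinAct_spinorRaise_spinorPow h, spinAct_smul_left,
    spinAct_spinorLower_spinorTangent h, spinAct_spinorAxis_spinorPow h, spinAct_smul] at h1 h2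
  linear_combination (norm := module) h1 + h2

lemma norm_spinorPow (h : starRingEnd ℂ u * u + starRingEnd ℂ v * v = 1) :
    ‖spinorPow n u v‖ = 1 := by
  rw [norm_eq_sqrt_re_inner (𝕜 := ℂ), inner_spinorPow_self, h]
  simp

lemma norm_spinorTangent (h : starRingEnd ℂ u * u + starRingEnd ℂ v * v = 1) :
    ‖spinorTangent n u v‖ = √n := by
  rw [norm_eq_sqrt_re_inner (𝕜 := ℂ), inner_spinorTangent_self h]
  simp

lemma norm_spinAct_spinorRaise_spinorTangent_le
    (h : starRingEnd ℂ u * u + starRingEnd ℂ v * v = 1) :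
    ‖spinAct (spinorRaise n u v) (spinorTangent n u v)‖ ≤ 2 * n := by
  rw [← abs_of_nonneg (norm_nonneg (spinAct _ _))]
  refine abs_le_of_sq_le_sq ?_ (by positivity)
  rw [← inner_self_eq_norm_sq (𝕜 := ℂ), inner_spinAct_left, conjTranspose_spinorRaise,
    spinAct_spinorLower_spinorRaise_spinorTangent h, inner_smul_right, inner_spinorTangent_self h]
  have : ((2 * n - 2) * n : ℂ) = ((2 * n - 2) * n : ℝ) := by push_cast; ring
  rw [this, RCLike.re_to_complex, Complex.ofReal_re]
  nlinarith [Nat.cast_nonneg (α := ℝ) n]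

end unitSpinor

/-! ### Size of the mean and of the fluctuation of `S₁` -/

lemma norm_sq_add_norm_sq_of_unit {u v : ℂ}
    (h : starRingEnd ℂ u * u + starRingEnd ℂ v * v = 1) : ‖u‖ ^ 2 + ‖v‖ ^ 2 = 1 := by
  rw [Complex.conj_mul', Complex.conj_mul'] at h
  exact_mod_cast h

lemma norm_sq_sub_sq_div_two_le {u v : ℂ}
    (h : starRingEnd ℂ u * u + starRingEnd ℂ v * v = 1) : ‖(u ^ 2 - v ^ 2) / 2‖ ≤ 1 / 2 := by
  have h1 := norm_sq_add_norm_sq_of_unit h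
  have h2 := norm_sub_le (u ^ 2) (v ^ 2)
  rw [norm_pow, norm_pow, h1] at h2
  rw [norm_div, Complex.norm_ofNat]
  linarith

lemma norm_sq_add_sq_div_two_le {u v : ℂ}
    (h : starRingEnd ℂ u * u + starRingEnd ℂ v * v = 1) : ‖(u ^ 2 + v ^ 2) / 2‖ ≤ 1 / 2 := by
  have h1 := norm_sq_add_norm_sq_of_unit h
  have h2 := norm_add_le (u ^ 2) (v ^ 2)
  rw [norm_pow, norm_pow, h1] at h2
  rw [norm_div, Complex.norm_ofNat]
  linarith

/-- The mean of `S₁ / n` in the spin coherent state of `(u, v)`. -/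
noncomputable def spinorMean (u v : ℂ) : ℝ := (starRingEnd ℂ u * v).re

lemma ofReal_spinorMean (u v : ℂ) :
    (spinorMean u v : ℂ) = (starRingEnd ℂ u * v + starRingEnd ℂ v * u) / 2 := by
  have := Complex.re_eq_add_conj (starRingEnd ℂ u * v)
  rw [spinorMean, this, map_mul, Complex.conj_conj, mul_comm u]

/-- Since `(S₁ - n m)ψ` is `(u² - v²)/2` times a tangent of norm `√n`, this is the variance of `S₁`
divided by `n`. It is the source of the factor `1/4 - m²` in the entanglement rate. -/
lemma conj_mul_norm_sq_sub_sq_div_two {u v : ℂ}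
    (h : starRingEnd ℂ u * u + starRingEnd ℂ v * v = 1) :
    ‖(u ^ 2 - v ^ 2) / 2‖ ^ 2 = 1 / 4 - spinorMean u v ^ 2 := by
  have : ((‖(u ^ 2 - v ^ 2) / 2‖ ^ 2 : ℝ) : ℂ) = ((1 / 4 - spinorMean u v ^ 2 : ℝ) : ℂ) := by
    push_cast
    rw [← Complex.conj_mul', ofReal_spinorMean]
    simp only [map_div₀, map_sub, map_pow, Complex.conj_ofNat]
    linear_combination
      ((starRingEnd ℂ u * u + starRingEnd ℂ v * v + 1) / 4) * h
  exact_mod_cast this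

lemma abs_spinorMean_le {u v : ℂ} (h : starRingEnd ℂ u * u + starRingEnd ℂ v * v = 1) :
    |spinorMean u v| ≤ 1 / 2 := by
  have h1 := conj_mul_norm_sq_sub_sq_div_two h
  refine abs_le_of_sq_le_sq ?_ (by norm_num)
  nlinarith [sq_nonneg ‖(u ^ 2 - v ^ 2) / 2‖]

lemma spinOne_commutator_spinThree (n : ℕ) :
    spinOne n * spinThree n - spinThree n * spinOne n =
      (1 / 2 : ℂ) • (spinLower n - spinRaise n) := by
  have h2 := spinThree_commutator_spinRaise n
  have h3 := spinThree_commutator_spinLower n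
  simp only [spinOne, mul_add, add_mul, smul_mul_assoc, mul_smul_comm]
  linear_combination (norm := module) (-1 / 2 : ℂ) • h2 - (1 / 2 : ℂ) • h3

lemma spinOne_commutator_spinorRaise (n : ℕ) (u v : ℂ) :
    spinOne n * spinorRaise n u v - spinorRaise n u v * spinOne n =
      (starRingEnd ℂ u ^ 2 + starRingEnd ℂ v ^ 2) • spinThree n -
        (starRingEnd ℂ u * starRingEnd ℂ v) • (spinLower n - spinRaise n) := by
  have h1 := spinRaise_commutator_spinLower n
  have h2 := spinThree_commutator_spinRaise n
  have h3 := spinThree_commutator_spinLower n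
  simp only [spinOne, spinorRaise, mul_add, add_mul, mul_sub, sub_mul, smul_mul_smul_comm]
  linear_combination (norm := module)
    ((starRingEnd ℂ u ^ 2 + starRingEnd ℂ v ^ 2) / 2) • h1 +
    (starRingEnd ℂ u * starRingEnd ℂ v) • h2 + (starRingEnd ℂ u * starRingEnd ℂ v) • h3

section unitSpinor

variable {n : ℕ} {u v : ℂ}

lemma spinAct_spinOne_sub_spinorPow (h : starRingEnd ℂ u * u + starRingEnd ℂ v * v = 1) :
    spinAct (spinOne n) (spinorPow n u v) - ((n : ℂ) * spinorMean u v) • spinorPow n u v =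
        ((u ^ 2 - v ^ 2) / 2) • spinorTangent n u v := by
  rw [spinAct_spinOne_spinorPow h, ofReal_spinorMean]
  abel

lemma spinAct_commutator_spinorPow (h : starRingEnd ℂ u * u + starRingEnd ℂ v * v = 1) :
    spinAct (spinOne n) (spinAct (spinThree n) (spinorPow n u v)) -
      spinAct (spinThree n) (spinAct (spinOne n) (spinorPow n u v)) =
      ((n : ℂ) * ((u * starRingEnd ℂ v - starRingEnd ℂ u * v) / 2)) • spinorPow n u v +
        ((u ^ 2 + v ^ 2) / 2) • spinorTangent n u v := by
  rw [← spinAct_mul, ← spinAct_mul, ← spinAct_sub_left, spinOne_commutator_spinThree,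
    spinAct_smul_left, spinAct_sub_left, spinAct_spinRaise_spinorPow, spinAct_spinLower_spinorPow,
    spinorPowFst_eq h, spinorPowSnd_eq h]
  module

/-- The tangent is the raised coherent state, so `S₁` can be moved past the raising operator at the
cost of their commutator. The three terms are the second excitation, the ground component and the
shift of the mean; each has norm at most `n`, and a factor `ħ` will make that bounded. -/
lemma spinAct_spinOne_sub_spinorTangent (h : starRingEnd ℂ u * u + starRingEnd ℂ v * v = 1) :
    spinAct (spinOne n) (spinorTangent n u v) - ((n : ℂ) * spinorMean u v) • spinorTangent n u v =
      ((u ^ 2 - v ^ 2) / 2) • spinAct (spinorRaise n u v) (spinorTangent n u v) +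
        (n * (starRingEnd ℂ u ^ 2 - starRingEnd ℂ v ^ 2) / 2) • spinorPow n u v -
        (2 * spinorMean u v : ℂ) • spinorTangent n u v := by
  have h1 := congrArg (fun M => spinAct M (spinorPow n u v)) (spinOne_commutator_spinorRaise n u v)
  simp only [spinAct_sub_left, spinAct_mul, spinAct_spinorRaise_spinorPow h, spinAct_smul_left,
    spinAct_spinOne_spinorPow h, spinAct_add, spinAct_smul, spinAct_spinRaise_spinorPow,
    spinAct_spinLower_spinorPow, spinAct_spinThree_spinorPow] at h1
  rw [spinorPowFst_eq h, spinorPowSnd_eq h] at h1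
  rw [ofReal_spinorMean]
  linear_combination (norm := module) h1 + (((n : ℂ) / 2 *
    (starRingEnd ℂ u ^ 2 - starRingEnd ℂ v ^ 2)) * h) • spinorPow n u v -
    ((starRingEnd ℂ u * v + starRingEnd ℂ v * u) * h) • spinorTangent n u v

lemma norm_spinAct_spinOne_sub_spinorTangent_le
    (h : starRingEnd ℂ u * u + starRingEnd ℂ v * v = 1) :
    ‖spinAct (spinOne n) (spinorTangent n u v) -
      ((n : ℂ) * spinorMean u v) • spinorTangent n u v‖ ≤ 3 * n := by
  rw [spinAct_spinOne_sub_spinorTangent h]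
  have h1 : ‖((u ^ 2 - v ^ 2) / 2) • spinAct (spinorRaise n u v) (spinorTangent n u v)‖ ≤ n := by
    rw [norm_smul]
    have := mul_le_mul (norm_sq_sub_sq_div_two_le h)
      (norm_spinAct_spinorRaise_spinorTangent_le (n := n) h) (norm_nonneg _) (by norm_num)
    linarith
  have h2 : ‖(n * (starRingEnd ℂ u ^ 2 - starRingEnd ℂ v ^ 2) / 2) • spinorPow n u v‖ ≤ n := by
    have e : (n * (starRingEnd ℂ u ^ 2 - starRingEnd ℂ v ^ 2) / 2 : ℂ) =
        n * starRingEnd ℂ ((u ^ 2 - v ^ 2) / 2) := by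
      simp only [map_div₀, map_sub, map_pow, Complex.conj_ofNat]
      ring
    rw [norm_smul, norm_spinorPow h, mul_one, e, norm_mul, Complex.norm_natCast, RCLike.norm_conj]
    have := norm_sq_sub_sq_div_two_le h
    nlinarith [Nat.cast_nonneg (α := ℝ) n]
  have h3 : ‖(2 * spinorMean u v : ℂ) • spinorTangent n u v‖ ≤ n := by
    rw [norm_smul, norm_spinorTangent h, norm_mul, Complex.norm_ofNat, Complex.norm_real,
      Real.norm_eq_abs]
    have h4 := abs_spinorMean_le h
    have h5 : √(n : ℝ) ≤ n := by
      rw [Real.sqrt_le_left (by positivity)]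
      rcases Nat.eq_zero_or_pos n with rfl | hn
      · simp
      · have : (1 : ℝ) ≤ n := by exact_mod_cast hn
        nlinarith
    calc 2 * |spinorMean u v| * √(n : ℝ) ≤ 1 * n := by
          gcongr
          linarith
      _ = n := one_mul _
  calc _ ≤ _ := norm_sub_le _ _
    _ ≤ _ := add_le_add_left (norm_add_le _ _) _
    _ ≤ 3 * n := by linarith

end unitSpinor

/-! ### The initial spin coherent state as a spinor power -/

section initialState

attribute [local instance] Matrix.linftyOpNormedAddCommGroup Matrix.linftyOpNormedSpace
  Matrix.linftyOpNormedRing Matrix.linftyOpNormedAlgebra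

/-- A solution of `y' = A y` is given by the exponential of `A`. -/
lemma spinAct_exp_of_hasDerivAt {n : ℕ} (A : Matrix (Fin (n + 1)) (Fin (n + 1)) ℂ)
    {y : ℝ → SpinSpace n} (hy : ∀ r, HasDerivAt y (spinAct A (y r)) r) :
    spinAct (NormedSpace.exp A) (y 0) = y 1 := by
  -- The curve `exp ((1 - r) A) (y r)` has derivative zero; its values at `r = 0` and `r = 1` are
  -- the two sides.
  have hE : ∀ r : ℝ, HasDerivAt (fun r : ℝ => NormedSpace.exp ((1 - r) • A))
      (-(NormedSpace.exp ((1 - r) • A) * A)) r := fun r => by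
    have h1 : HasDerivAt (fun r : ℝ => 1 - r) (-1) r := by
      simpa using (hasDerivAt_id r).const_sub 1
    have h2 := HasDerivAt.scomp r (hasDerivAt_exp_smul_const (𝕂 := ℝ) A (1 - r)) h1
    rw [neg_one_smul] at h2
    exact h2
  have hz : ∀ (i : Fin (n + 1)) (r : ℝ), HasDerivAt
      (fun r : ℝ => spinAct (NormedSpace.exp ((1 - r) • A)) (y r) i) 0 r := fun i r => by
    have h1 : ∀ j, HasDerivAt (fun r : ℝ => NormedSpace.exp ((1 - r) • A) i j)
        ((-(NormedSpace.exp ((1 - r) • A) * A)) i j) r := fun j => by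
      exact (((Matrix.entryLinearMap ℝ ℂ i j).toContinuousLinearMap).hasFDerivAt
        (x := NormedSpace.exp ((1 - r) • A))).comp_hasDerivAt r (hE r)
    have h2 : ∀ j, HasDerivAt (fun r : ℝ => y r j) (spinAct A (y r) j) r := fun j => by
      exact ((PiLp.proj 2 (𝕜 := ℝ) (fun _ : Fin (n + 1) => ℂ) j).hasFDerivAt
        (x := y r)).comp_hasDerivAt r (hy r)
    have h3 := HasDerivAt.fun_sum (u := Finset.univ) fun j _ => (h1 j).mul (h2 j)
    refine h3.congr_deriv ?_
    rw [Finset.sum_add_distrib]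
    have e1 : ∑ j, (-(NormedSpace.exp ((1 - r) • A) * A)) i j * y r j =
        -spinAct (NormedSpace.exp ((1 - r) • A)) (spinAct A (y r)) i := by
      rw [← spinAct_mul, spinAct_apply]
      simp
    rw [e1, ← spinAct_apply]
    simp
  have hconst : spinAct (NormedSpace.exp ((1 - (0 : ℝ)) • A)) (y 0) =
      spinAct (NormedSpace.exp ((1 - (1 : ℝ)) • A)) (y 1) := by
    ext i
    exact is_const_of_deriv_eq_zero (fun r => (hz i r).differentiableAt)
      (fun r => (hz i r).deriv) 0 1
  rw [sub_zero, one_smul, sub_self, zero_smul, NormedSpace.exp_zero] at hconst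
  rw [hconst]
  simp [spinAct]

end initialState

lemma spinorPow_zero_one (n : ℕ) : spinorPow n 0 1 = EuclideanSpace.single 0 1 := by
  ext k
  rcases Fin.eq_zero_or_eq_succ k with rfl | ⟨k, rfl⟩
  · simp [spinorPow]
  · simp [spinorPow]

/-- Replacing `θ` by `r θ` rotates the spinor, and the generator acts on spinor powers through the
derivatives in `u` and `v`. So the spinor power solves the linear equation of the exponential,
starting at the lowest state `(0, 1)`. -/
lemma spinCoherent_eq_spinorPow (n : ℕ) (θ φ : ℝ) : spinCoherent n θ φ =
    spinorPow n (-(Complex.exp (-(Complex.I * φ)) * Real.sin (θ / 2))) (Real.cos (θ / 2)) := by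
  set u : ℝ → ℂ := fun r => -(Complex.exp (-(Complex.I * φ)) * Real.sin (r * (θ / 2))) with hu
  set v : ℝ → ℂ := fun r => Real.cos (r * (θ / 2)) with hv
  have hlin : ∀ r : ℝ, HasDerivAt (fun r : ℝ => r * (θ / 2)) (θ / 2) r := fun r => by
    simpa using (hasDerivAt_id r).mul_const (θ / 2)
  have h1 : ∀ r, HasDerivAt u (-(Complex.exp (-(Complex.I * φ)) *
      ((Real.cos (r * (θ / 2)) * (θ / 2) : ℝ) : ℂ))) r := fun r =>
    (((hlin r).sin.ofReal_comp).const_mul _).neg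
  have h2 : ∀ r, HasDerivAt v ((-Real.sin (r * (θ / 2)) * (θ / 2) : ℝ) : ℂ) r := fun r =>
    (hlin r).cos.ofReal_comp
  have h3 := spinAct_exp_of_hasDerivAt (((θ / 2 : ℝ) : ℂ) •
      (Complex.exp (Complex.I * φ) • spinLower n - Complex.exp (-(Complex.I * φ)) • spinRaise n))
    (y := fun r => spinorPow n (u r) (v r)) (fun r => by
      refine (hasDerivAt_spinorPow n (h1 r) (h2 r)).congr_deriv ?_
      simp only [spinAct_smul_left, spinAct_sub_left, spinAct_spinRaise_spinorPow,
        spinAct_spinLower_spinorPow]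
      have e : Complex.exp (Complex.I * φ) * Complex.exp (-(Complex.I * φ)) = 1 := by
        rw [← Complex.exp_add, add_neg_cancel, Complex.exp_zero]
      generalize spinorPowSnd n (u r) (v r) = X
      generalize spinorPowFst n (u r) (v r) = Y
      simp only [hu, hv]
      push_cast
      linear_combination (norm := module)
        ((θ / 2) * Complex.sin (r * (θ / 2)) * e) • X)
  simp only [hu, hv, zero_mul, one_mul, Real.sin_zero, Real.cos_zero, Complex.ofReal_zero,
    mul_zero, neg_zero, Complex.ofReal_one, spinorPow_zero_one] at h3
  exact h3

/-! ### Elementary tensors -/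

/-- The elementary tensor `f ⊗ v`, as a continuous bilinear map of `v` and `f`. -/
noncomputable def tensorMap (n : ℕ) : SpinSpace n →L[ℂ] OrbitalSpace →L[ℂ] TotalSpace n :=
  (ContinuousLinearMap.lsmul ℂ ℂ).flip.compLpL₂ 2 volume

/-- The elementary tensor `f ⊗ v`. -/
noncomputable def tensor {n : ℕ} (f : OrbitalSpace) (v : SpinSpace n) : TotalSpace n :=
  tensorMap n v f

section tensor

variable {n : ℕ} (f g : OrbitalSpace) (v w : SpinSpace n) (c : ℂ)

lemma coeFn_tensor : tensor f v =ᵐ[volume] fun x => f x • v :=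
  ContinuousLinearMap.coeFn_compLp _ f

lemma tensor_add_left : tensor (f + g) v = tensor f v + tensor g v := map_add _ _ _

lemma tensor_sub_left : tensor (f - g) v = tensor f v - tensor g v := map_sub _ _ _

lemma tensor_smul_left : tensor (c • f) v = c • tensor f v := map_smul _ _ _

lemma tensor_add : tensor f (v + w) = tensor f v + tensor f w := by
  simp [tensor]

lemma tensor_sub : tensor f (v - w) = tensor f v - tensor f w := by
  simp [tensor]

lemma tensor_smul : tensor f (c • v) = c • tensor f v := by
  simp [tensor]

lemma inner_tensor : ⟪tensor f v, tensor g w⟫_ℂ = ⟪f, g⟫_ℂ * ⟪v, w⟫_ℂ := by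
  rw [L2.inner_def, L2.inner_def, ← integral_mul_const]
  refine integral_congr_ae ?_
  filter_upwards [coeFn_tensor f v, coeFn_tensor g w] with x h1 h2
  rw [h1, h2, inner_smul_left, inner_smul_right, RCLike.inner_apply]
  ring

lemma norm_tensor : ‖tensor f v‖ = ‖f‖ * ‖v‖ := by
  have h : ‖tensor f v‖ ^ 2 = (‖f‖ * ‖v‖) ^ 2 := by
    have := inner_tensor f f v v
    rw [inner_self_eq_norm_sq_to_K, inner_self_eq_norm_sq_to_K, inner_self_eq_norm_sq_to_K] at this
    rw [mul_pow]
    exact_mod_cast this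
  exact (pow_left_inj₀ (norm_nonneg _) (by positivity) two_ne_zero).1 h

lemma hasDerivAt_tensor {f : ℝ → OrbitalSpace} {v : ℝ → SpinSpace n} {f' : OrbitalSpace}
    {v' : SpinSpace n} {t : ℝ} (hf : HasDerivAt f f' t) (hv : HasDerivAt v v' t) :
    HasDerivAt (fun s => tensor (f s) (v s)) (tensor (f t) v' + tensor f' (v t)) t := by
  have := ((tensorMap n).bilinearRestrictScalars ℝ).hasDerivAt_of_bilinear
    (fun _ => hv) (fun _ => hf)
  simpa [tensor, add_comm] using this

lemma tensorBasis_apply (k : Fin (n + 1)) : tensorBasis n k f = tensor f (EuclideanSpace.single k 1) := by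
  refine Lp.ext ?_
  have h1 : tensorBasis n k f =ᵐ[volume] fun x => f x • EuclideanSpace.single k (1 : ℂ) :=
    ContinuousLinearMap.coeFn_compLp _ f
  exact h1.trans (coeFn_tensor _ _).symm

end tensor

lemma coeFn_add_of_ae {n : ℕ} {F G : TotalSpace n} {f g : ℝ → SpinSpace n}
    (hF : F =ᵐ[volume] f) (hG : G =ᵐ[volume] g) :
    (F + G : TotalSpace n) =ᵐ[volume] fun x => f x + g x := by
  filter_upwards [Lp.coeFn_add F G, hF, hG] with x h1 h2 h3
  rw [h1, Pi.add_apply, h2, h3]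

lemma coeFn_smul_of_ae {n : ℕ} (c : ℂ) {F : TotalSpace n} {f : ℝ → SpinSpace n}
    (hF : F =ᵐ[volume] f) : (c • F : TotalSpace n) =ᵐ[volume] fun x => c • f x := by
  filter_upwards [Lp.coeFn_smul c F, hF] with x h1 h2
  rw [h1, Pi.smul_apply, h2]

lemma coeFn_tensor_gaussLp {n : ℕ} {ħ : ℝ} (hħ : 0 < ħ) (ζ : ℂ) (k : ℕ) (v : SpinSpace n) :
    tensor (gaussLp hħ ζ k) v =ᵐ[volume] fun x => gaussFun ħ ζ k x • v := by
  filter_upwards [coeFn_tensor (gaussLp hħ ζ k) v, coeFn_gaussLp hħ ζ k] with x h1 h2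
  rw [h1, h2]

lemma memLp_smul_vec {n : ℕ} {f : ℝ → ℂ} (hf : MemLp f 2 volume) (v : SpinSpace n) :
    MemLp (fun x => f x • v) 2 volume :=
  (ContinuousLinearMap.toSpanSingleton ℂ v).comp_memLp' hf

/-! ### Symmetry of the Dicke Hamiltonian -/

lemma memLp_inner_integrable {n : ℕ} {f g : ℝ → SpinSpace n} (hf : MemLp f 2 volume)
    (hg : MemLp g 2 volume) : Integrable (fun x => ⟪f x, g x⟫_ℂ) := by
  refine (L2.integrable_inner (𝕜 := ℂ) (hf.toLp f) (hg.toLp g)).congr ?_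
  filter_upwards [hf.coeFn_toLp, hg.coeFn_toLp] with x h1 h2
  rw [h1, h2]

/-- Integration by parts over the line. There are no boundary terms, because all the products
involved are integrable. -/
lemma integral_inner_deriv {n : ℕ} {f f' g g' : ℝ → SpinSpace n}
    (hf : ∀ x, HasDerivAt f (f' x) x) (hg : ∀ x, HasDerivAt g (g' x) x)
    (mf : MemLp f 2 volume) (mf' : MemLp f' 2 volume) (mg : MemLp g 2 volume)
    (mg' : MemLp g' 2 volume) : ∫ x, ⟪f x, g' x⟫_ℂ = -∫ x, ⟪f' x, g x⟫_ℂ := by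
  let L : SpinSpace n →L[ℝ] SpinSpace n →L[ℝ] ℂ :=
    LinearMap.mkContinuous₂ (LinearMap.mk₂ ℝ (fun x y => ⟪x, y⟫_ℂ)
      (fun _ _ _ => inner_add_left _ _ _) (fun c x y => by
        rw [← Complex.coe_smul, inner_smul_left, Complex.conj_ofReal, Complex.real_smul])
      (fun _ _ _ => inner_add_right _ _ _) (fun c x y => by
        rw [← Complex.coe_smul, inner_smul_right, Complex.real_smul])) 1 (fun x y => by
          rw [one_mul]; exact norm_inner_le_norm x y)
  exact integral_bilinear_hasDerivAt_right_eq_neg_left_of_integrable (L := L)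
    (fun x _ => hf x) (fun x _ => hg x) (memLp_inner_integrable mf mg')
    (memLp_inner_integrable mf' mg) (memLp_inner_integrable mf mg)

/-- The value of the Dicke Hamiltonian on a function with value `a` and second derivative `a''`
at `x`. -/
noncomputable def dickeSymbol (n : ℕ) (ħ ωc ω₃ lam x : ℝ) (a'' a : SpinSpace n) : SpinSpace n :=
  ((ωc / 2 : ℝ) : ℂ) • (((-ħ ^ 2 : ℝ) : ℂ) • a'' + ((x ^ 2 : ℝ) : ℂ) • a)
    + ((ω₃ * ħ : ℝ) : ℂ) • spinAct (spinThree n) a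
    + ((2 * lam / Real.sqrt (((n : ℝ) + 1) * ħ) * x * ħ : ℝ) : ℂ) • spinAct (spinOne n) a

/-- All terms except the kinetic one are pointwise symmetric and cancel. -/
lemma inner_dickeSymbol_sub (n : ℕ) (ħ ωc ω₃ lam x : ℝ) (a'' a b'' b : SpinSpace n) :
    ⟪a, dickeSymbol n ħ ωc ω₃ lam x b'' b⟫_ℂ - ⟪dickeSymbol n ħ ωc ω₃ lam x a'' a, b⟫_ℂ =
      ((-(ωc / 2) * ħ ^ 2 : ℝ) : ℂ) * (⟪a, b''⟫_ℂ - ⟪a'', b⟫_ℂ) := by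
  simp only [dickeSymbol, inner_add_left, inner_add_right, inner_smul_left, inner_smul_right,
    Complex.conj_ofReal, inner_spinAct_left, conjTranspose_spinOne, conjTranspose_spinThree]
  push_cast
  ring

/-- Two integrations by parts move the second derivative off the Schwartz function. The other
function only needs two square integrable derivatives, so Gaussian vectors can be used without
showing them to be Schwartz. -/
lemma inner_eq_inner_of_core {n : ℕ} {ħ ωc ω₃ lam : ℝ} {g g' g'' : ℝ → SpinSpace n}
    (hg : ∀ x, HasDerivAt g (g' x) x) (hg' : ∀ x, HasDerivAt g' (g'' x) x)
    (mg : MemLp g 2 volume) (mg' : MemLp g' 2 volume) (mg'' : MemLp g'' 2 volume)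
    {G Θ : TotalSpace n} (hG : G =ᵐ[volume] g)
    (hΘ : Θ =ᵐ[volume] fun x => dickeSymbol n ħ ωc ω₃ lam x (g'' x) (g x))
    {W : TotalSpace n × TotalSpace n} (hW : W ∈ dickeCoreGraph n ħ ωc ω₃ lam) :
    ⟪G, W.2⟫_ℂ = ⟪Θ, W.1⟫_ℂ := by
  obtain ⟨u, hu1, hu2⟩ := hW
  set u1 := SchwartzMap.derivCLM ℂ (SpinSpace n) u with hu1'
  set u2 := SchwartzMap.derivCLM ℂ (SpinSpace n) u1 with hu2'
  have e1 : ∀ x, HasDerivAt u (u1 x) x := fun x => by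
    rw [hu1', SchwartzMap.derivCLM_apply]
    exact u.differentiable.differentiableAt.hasDerivAt
  have e2 : ∀ x, HasDerivAt u1 (u2 x) x := fun x => by
    rw [hu2', SchwartzMap.derivCLM_apply]
    exact u1.differentiable.differentiableAt.hasDerivAt
  have e3 : ∀ x, dickeExpr n ħ ωc ω₃ lam (fun x => u x) x =
      dickeSymbol n ħ ωc ω₃ lam x (u2 x) (u x) := fun x => by
    have h1 : deriv (fun x => u x) = fun x => u1 x := funext fun x => (e1 x).deriv
    have h2 : deriv (fun x => u1 x) x = u2 x := (e2 x).deriv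
    rw [dickeExpr, h1, h2]
    rfl
  have m0 : MemLp (fun x => u x) 2 volume := u.memLp 2
  have m1 : MemLp (fun x => u1 x) 2 volume := u1.memLp 2
  have m2 : MemLp (fun x => u2 x) 2 volume := u2.memLp 2
  rw [← sub_eq_zero, L2.inner_def, L2.inner_def,
    ← integral_sub (L2.integrable_inner _ _) (L2.integrable_inner _ _)]
  have h1 : ∀ᵐ x : ℝ, ⟪G x, W.2 x⟫_ℂ - ⟪Θ x, W.1 x⟫_ℂ =
      ((-(ωc / 2) * ħ ^ 2 : ℝ) : ℂ) * (⟪g x, u2 x⟫_ℂ - ⟪g'' x, u x⟫_ℂ) := by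
    filter_upwards [hG, hΘ, hu1, hu2] with x h1 h2 h3 h4
    rw [h1, h2, h3, h4, e3, inner_dickeSymbol_sub]
  rw [integral_congr_ae h1, integral_const_mul, integral_sub (memLp_inner_integrable mg m2)
    (memLp_inner_integrable mg'' m0), integral_inner_deriv hg e2 mg mg' m1 m2,
    integral_inner_deriv hg' e1 mg' mg'' m0 m1]
  simp

/-- `G` is in the domain of the adjoint of the Dicke Hamiltonian, and is mapped to `Θ`. -/
def IsAdjointPair (n : ℕ) (ħ ωc ω₃ lam : ℝ) (G Θ : TotalSpace n) : Prop :=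
  ∀ W ∈ dickeGraph n ħ ωc ω₃ lam, ⟪G, W.2⟫_ℂ = ⟪Θ, W.1⟫_ℂ

section IsAdjointPair

variable {n : ℕ} {ħ ωc ω₃ lam : ℝ}

lemma isAdjointPair_of_core {G Θ : TotalSpace n}
    (h : ∀ W ∈ dickeCoreGraph n ħ ωc ω₃ lam, ⟪G, W.2⟫_ℂ = ⟪Θ, W.1⟫_ℂ) :
    IsAdjointPair n ħ ωc ω₃ lam G Θ := by
  intro W hW
  refine closure_minimal (t := {W : TotalSpace n × TotalSpace n | ⟪G, W.2⟫_ℂ = ⟪Θ, W.1⟫_ℂ}) h ?_ hW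
  exact isClosed_eq (by fun_prop) (by fun_prop)

lemma IsAdjointPair.add {G Θ G' Θ' : TotalSpace n} (h : IsAdjointPair n ħ ωc ω₃ lam G Θ)
    (h' : IsAdjointPair n ħ ωc ω₃ lam G' Θ') :
    IsAdjointPair n ħ ωc ω₃ lam (G + G') (Θ + Θ') := by
  intro W hW
  rw [inner_add_left, inner_add_left, h W hW, h' W hW]

lemma IsAdjointPair.sub {G Θ G' Θ' : TotalSpace n} (h : IsAdjointPair n ħ ωc ω₃ lam G Θ)
    (h' : IsAdjointPair n ħ ωc ω₃ lam G' Θ') :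
    IsAdjointPair n ħ ωc ω₃ lam (G - G') (Θ - Θ') := by
  intro W hW
  rw [inner_sub_left, inner_sub_left, h W hW, h' W hW]

lemma IsAdjointPair.smul {G Θ : TotalSpace n} (h : IsAdjointPair n ħ ωc ω₃ lam G Θ) (c : ℂ) :
    IsAdjointPair n ħ ωc ω₃ lam (c • G) (c • Θ) := by
  intro W hW
  rw [inner_smul_left, inner_smul_left, h W hW]

/-- Symmetry on the core survives the closure by continuity of the inner product; it is used for
conservation of the norm. -/
lemma inner_comm_of_mem_dickeGraph {W : TotalSpace n × TotalSpace n}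
    (hW : W ∈ dickeGraph n ħ ωc ω₃ lam) : ⟪W.1, W.2⟫_ℂ = ⟪W.2, W.1⟫_ℂ := by
  refine closure_minimal
    (t := {W : TotalSpace n × TotalSpace n | ⟪W.1, W.2⟫_ℂ = ⟪W.2, W.1⟫_ℂ}) ?_ ?_ hW
  · intro W hW
    obtain ⟨u, hu1, hu2⟩ := id hW
    set u1 := SchwartzMap.derivCLM ℂ (SpinSpace n) u with hu1'
    set u2 := SchwartzMap.derivCLM ℂ (SpinSpace n) u1 with hu2'
    have e1 : ∀ x, HasDerivAt u (u1 x) x := fun x => by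
      rw [hu1', SchwartzMap.derivCLM_apply]
      exact u.differentiable.differentiableAt.hasDerivAt
    have e2 : ∀ x, HasDerivAt u1 (u2 x) x := fun x => by
      rw [hu2', SchwartzMap.derivCLM_apply]
      exact u1.differentiable.differentiableAt.hasDerivAt
    refine inner_eq_inner_of_core e1 e2 (u.memLp 2) (u1.memLp 2) (u2.memLp 2) hu1 ?_ hW
    refine hu2.trans (Filter.Eventually.of_forall fun x => ?_)
    have h1 : deriv (fun x => u x) = fun x => u1 x := funext fun x => (e1 x).deriv
    have h2 : deriv (fun x => u1 x) x = u2 x := (e2 x).deriv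
    change dickeExpr n ħ ωc ω₃ lam (fun x => u x) x = _
    rw [dickeExpr, h1, h2]
    rfl
  · exact isClosed_eq (by fun_prop) (by fun_prop)

/-- The width of the packet is that of the oscillator ground state, so the `x²` of the potential
cancels against that of the kinetic term and only terms affine in `x` remain. This is why packets of
fixed width suffice. -/
lemma isAdjointPair_gaussLp_zero (hħ : 0 < ħ) (ζ : ℂ) (v : SpinSpace n) :
    IsAdjointPair n ħ ωc ω₃ lam (tensor (gaussLp hħ ζ 0) v)
      ((ωc / 2 * (ħ - ζ ^ 2) : ℂ) • tensor (gaussLp hħ ζ 0) v +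
        (ωc * ζ : ℂ) • tensor (gaussLp hħ ζ 1) v +
        (ω₃ * ħ : ℂ) • tensor (gaussLp hħ ζ 0) (spinAct (spinThree n) v) +
        ((2 * lam / √(((n : ℝ) + 1) * ħ) : ℝ) * ħ : ℂ) •
          tensor (gaussLp hħ ζ 1) (spinAct (spinOne n) v)) := by
  have hne : (ħ : ℂ) ≠ 0 := Complex.ofReal_ne_zero.2 hħ.ne'
  have m := fun k => memLp_gaussFun hħ ζ k
  have d := fun k x => hasDerivAt_gaussFun (ħ := ħ) ζ k x
  have d1 : ∀ x, HasDerivAt (gaussFun ħ ζ 0)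
      (ζ / ħ * gaussFun ħ ζ 0 x - 1 / ħ * gaussFun ħ ζ 1 x) x := hasDerivAt_gaussFun_zero ζ
  have d2 : ∀ x, HasDerivAt (fun x => ζ / ħ * gaussFun ħ ζ 0 x - 1 / ħ * gaussFun ħ ζ 1 x)
      ((ζ ^ 2 / ħ ^ 2 - 1 / ħ) * gaussFun ħ ζ 0 x - 2 * ζ / ħ ^ 2 * gaussFun ħ ζ 1 x +
        1 / ħ ^ 2 * gaussFun ħ ζ 2 x) x := fun x => by
    refine (((d 0 x).const_mul (ζ / ħ)).sub ((d 1 x).const_mul (1 / (ħ : ℂ)))).congr_deriv ?_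
    simp only [Nat.cast_zero, Nat.cast_one, Nat.sub_self, Nat.reduceAdd]
    field_simp
    ring
  refine isAdjointPair_of_core fun W hW => inner_eq_inner_of_core
    (fun x => (d1 x).smul_const v) (fun x => (d2 x).smul_const v)
    (memLp_smul_vec (m 0) v)
    (memLp_smul_vec (((m 0).const_mul _).sub ((m 1).const_mul _)) v)
    (memLp_smul_vec ((((m 0).const_mul _).sub ((m 1).const_mul _)).add ((m 2).const_mul _)) v)
    (coeFn_tensor_gaussLp hħ ζ 0 v) ?_ hW
  refine (coeFn_add_of_ae (coeFn_add_of_ae (coeFn_add_of_ae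
    (coeFn_smul_of_ae _ (coeFn_tensor_gaussLp hħ ζ 0 v))
    (coeFn_smul_of_ae _ (coeFn_tensor_gaussLp hħ ζ 1 v)))
    (coeFn_smul_of_ae _ (coeFn_tensor_gaussLp hħ ζ 0 _)))
    (coeFn_smul_of_ae _ (coeFn_tensor_gaussLp hħ ζ 1 _))).trans
    (Filter.Eventually.of_forall fun x => ?_)
  have g1 := gaussFun_add ħ ζ 1 0 x
  have g2 := gaussFun_add ħ ζ 2 0 x
  simp only [Nat.reduceAdd] at g1 g2
  simp only [dickeSymbol, spinAct_smul, g1, g2]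
  generalize 2 * lam / √(((n : ℝ) + 1) * ħ) = r
  match_scalars
  · field_simp
    ring
  · ring
  · ring

lemma isAdjointPair_gaussLp_one (hħ : 0 < ħ) (ζ : ℂ) (v : SpinSpace n) :
    IsAdjointPair n ħ ωc ω₃ lam (tensor (gaussLp hħ ζ 1) v)
      ((-(ωc * ζ * ħ) : ℂ) • tensor (gaussLp hħ ζ 0) v +
        (ωc / 2 * (3 * ħ - ζ ^ 2) : ℂ) • tensor (gaussLp hħ ζ 1) v +
        (ωc * ζ : ℂ) • tensor (gaussLp hħ ζ 2) v +
        (ω₃ * ħ : ℂ) • tensor (gaussLp hħ ζ 1) (spinAct (spinThree n) v) +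
        ((2 * lam / √(((n : ℝ) + 1) * ħ) : ℝ) * ħ : ℂ) •
          tensor (gaussLp hħ ζ 2) (spinAct (spinOne n) v)) := by
  have hne : (ħ : ℂ) ≠ 0 := Complex.ofReal_ne_zero.2 hħ.ne'
  have m := fun k => memLp_gaussFun hħ ζ k
  have d := fun k x => hasDerivAt_gaussFun (ħ := ħ) ζ k x
  have d1 : ∀ x, HasDerivAt (gaussFun ħ ζ 1)
      (gaussFun ħ ζ 0 x + ζ / ħ * gaussFun ħ ζ 1 x - 1 / ħ * gaussFun ħ ζ 2 x) x := fun x => by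
    simpa using d 1 x
  have d2 : ∀ x, HasDerivAt
      (fun x => gaussFun ħ ζ 0 x + ζ / ħ * gaussFun ħ ζ 1 x - 1 / ħ * gaussFun ħ ζ 2 x)
      (2 * ζ / ħ * gaussFun ħ ζ 0 x + (ζ ^ 2 / ħ ^ 2 - 3 / ħ) * gaussFun ħ ζ 1 x
        - 2 * ζ / ħ ^ 2 * gaussFun ħ ζ 2 x + 1 / ħ ^ 2 * gaussFun ħ ζ 3 x) x := fun x => by
    refine (((d 0 x).add ((d 1 x).const_mul (ζ / ħ))).sub
      ((d 2 x).const_mul (1 / (ħ : ℂ)))).congr_deriv ?_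
    simp only [Nat.cast_zero, Nat.cast_one, Nat.sub_self, Nat.reduceAdd, Nat.cast_ofNat,
      Nat.reduceSub]
    field_simp
    ring
  refine isAdjointPair_of_core fun W hW => inner_eq_inner_of_core
    (fun x => (d1 x).smul_const v) (fun x => (d2 x).smul_const v)
    (memLp_smul_vec (m 1) v)
    (memLp_smul_vec (((m 0).add ((m 1).const_mul _)).sub ((m 2).const_mul _)) v)
    (memLp_smul_vec (((((m 0).const_mul _).add ((m 1).const_mul _)).sub
      ((m 2).const_mul _)).add ((m 3).const_mul _)) v)
    (coeFn_tensor_gaussLp hħ ζ 1 v) ?_ hW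
  refine (coeFn_add_of_ae (coeFn_add_of_ae (coeFn_add_of_ae (coeFn_add_of_ae
    (coeFn_smul_of_ae _ (coeFn_tensor_gaussLp hħ ζ 0 v))
    (coeFn_smul_of_ae _ (coeFn_tensor_gaussLp hħ ζ 1 v)))
    (coeFn_smul_of_ae _ (coeFn_tensor_gaussLp hħ ζ 2 v)))
    (coeFn_smul_of_ae _ (coeFn_tensor_gaussLp hħ ζ 1 _)))
    (coeFn_smul_of_ae _ (coeFn_tensor_gaussLp hħ ζ 2 _))).trans
    (Filter.Eventually.of_forall fun x => ?_)
  have g1 := gaussFun_add ħ ζ 1 0 x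
  have g2 := gaussFun_add ħ ζ 2 0 x
  have g3 := gaussFun_add ħ ζ 3 0 x
  simp only [Nat.reduceAdd] at g1 g2 g3
  simp only [dickeSymbol, spinAct_smul, g1, g2, g3]
  generalize 2 * lam / √(((n : ℝ) + 1) * ħ) = r
  match_scalars
  · field_simp
    ring
  · ring
  · ring

end IsAdjointPair

/-! ### Purity of the orbital state -/

/-- Bessel's inequality in the exterior square: the Gram determinant of `a, b` is the squared norm
of `a ∧ b`, and the minor is its coefficient along `f₀ ∧ f₁`. The argument below stays in `H` and
uses Cauchy–Schwarz. -/
lemma norm_inner_minor_sq_le {H : Type*} [NormedAddCommGroup H] [InnerProductSpace ℂ H]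
    {f₀ f₁ : H} (h₀ : ⟪f₀, f₀⟫_ℂ = 1) (h₁ : ⟪f₁, f₁⟫_ℂ = 1) (h₀₁ : ⟪f₀, f₁⟫_ℂ = 0) (a b : H) :
    ‖⟪f₀, a⟫_ℂ * ⟪f₁, b⟫_ℂ - ⟪f₁, a⟫_ℂ * ⟪f₀, b⟫_ℂ‖ ^ 2 ≤ ‖a‖ ^ 2 * ‖b‖ ^ 2 - ‖⟪a, b⟫_ℂ‖ ^ 2 := by
  have h₁₀ : ⟪f₁, f₀⟫_ℂ = 0 := inner_eq_zero_symm.1 h₀₁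
  rcases eq_or_ne b 0 with rfl | hb
  · simp
  have hb' : 0 < ‖b‖ := norm_pos_iff.2 hb
  -- Contraction of `f₀ ∧ f₁` with `b`: orthogonal to `b`, its inner product with `a` is the minor,
  -- and it is as long as the projection `p` of `b` onto the plane of `f₀, f₁`.
  set h := starRingEnd ℂ ⟪f₁, b⟫_ℂ • f₀ - starRingEnd ℂ ⟪f₀, b⟫_ℂ • f₁ with hh
  set p := ⟪f₀, b⟫_ℂ • f₀ + ⟪f₁, b⟫_ℂ • f₁ with hp
  -- The component of `a` orthogonal to `b`, scaled by `‖b‖²` to avoid division.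
  set c := ((‖b‖ ^ 2 : ℝ) : ℂ) • a - ⟪b, a⟫_ℂ • b with hc
  have e1 : ⟪h, a⟫_ℂ = ⟪f₀, a⟫_ℂ * ⟪f₁, b⟫_ℂ - ⟪f₁, a⟫_ℂ * ⟪f₀, b⟫_ℂ := by
    rw [hh, inner_sub_left, inner_smul_left, inner_smul_left, Complex.conj_conj, Complex.conj_conj]
    ring
  have e2 : ⟪h, b⟫_ℂ = 0 := by
    rw [hh, inner_sub_left, inner_smul_left, inner_smul_left, Complex.conj_conj, Complex.conj_conj]
    ring
  have e3 : ‖h‖ ^ 2 = ‖⟪f₀, b⟫_ℂ‖ ^ 2 + ‖⟪f₁, b⟫_ℂ‖ ^ 2 := by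
    have : ((‖h‖ ^ 2 : ℝ) : ℂ) = ((‖⟪f₀, b⟫_ℂ‖ ^ 2 + ‖⟪f₁, b⟫_ℂ‖ ^ 2 : ℝ) : ℂ) := by
      push_cast
      rw [← Complex.mul_conj', ← Complex.mul_conj']
      have := inner_self_eq_norm_sq_to_K (𝕜 := ℂ) h
      refine Eq.trans this.symm ?_
      simp only [hh, inner_sub_left, inner_sub_right, inner_smul_left, inner_smul_right, h₀, h₁,
        h₀₁, h₁₀, Complex.conj_conj]
      ring
    exact_mod_cast this
  have e4 : ‖p‖ ^ 2 = ‖⟪f₀, b⟫_ℂ‖ ^ 2 + ‖⟪f₁, b⟫_ℂ‖ ^ 2 := by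
    have : ((‖p‖ ^ 2 : ℝ) : ℂ) = ((‖⟪f₀, b⟫_ℂ‖ ^ 2 + ‖⟪f₁, b⟫_ℂ‖ ^ 2 : ℝ) : ℂ) := by
      push_cast
      rw [← Complex.mul_conj', ← Complex.mul_conj']
      have := inner_self_eq_norm_sq_to_K (𝕜 := ℂ) p
      refine Eq.trans this.symm ?_
      simp only [hp, inner_add_left, inner_add_right, inner_smul_left, inner_smul_right, h₀, h₁,
        h₀₁, h₁₀]
      ring
    exact_mod_cast this
  have e5 : ⟪p, b⟫_ℂ = ((‖p‖ ^ 2 : ℝ) : ℂ) := by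
    rw [e4]
    push_cast
    rw [← Complex.mul_conj', ← Complex.mul_conj', hp, inner_add_left, inner_smul_left,
      inner_smul_left]
    ring
  have e6 : ‖h‖ ^ 2 ≤ ‖b‖ ^ 2 := by
    rw [e3, ← e4]
    have := norm_inner_le_norm (𝕜 := ℂ) p b
    rw [e5, Complex.norm_real, Real.norm_of_nonneg (by positivity)] at this
    nlinarith [norm_nonneg p, norm_nonneg b]
  have e7 : ⟪h, c⟫_ℂ = ((‖b‖ ^ 2 : ℝ) : ℂ) * ⟪h, a⟫_ℂ := by
    rw [hc, inner_sub_right, inner_smul_right, inner_smul_right, e2]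
    ring
  have e8 : ‖c‖ ^ 2 = ‖b‖ ^ 2 * (‖a‖ ^ 2 * ‖b‖ ^ 2 - ‖⟪a, b⟫_ℂ‖ ^ 2) := by
    have : ((‖c‖ ^ 2 : ℝ) : ℂ) =
        ((‖b‖ ^ 2 * (‖a‖ ^ 2 * ‖b‖ ^ 2 - ‖⟪a, b⟫_ℂ‖ ^ 2) : ℝ) : ℂ) := by
      push_cast
      rw [← Complex.conj_mul', inner_conj_symm]
      have := inner_self_eq_norm_sq_to_K (𝕜 := ℂ) c
      refine Eq.trans this.symm ?_
      have ha := inner_self_eq_norm_sq_to_K (𝕜 := ℂ) a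
      have hb := inner_self_eq_norm_sq_to_K (𝕜 := ℂ) b
      simp only [hc, inner_sub_left, inner_sub_right, inner_smul_left, inner_smul_right, ha, hb,
        inner_conj_symm, Complex.conj_ofReal]
      push_cast
      simp only [Complex.coe_algebraMap]
      ring
    exact_mod_cast this
  have e9 := norm_inner_le_norm (𝕜 := ℂ) h c
  rw [e7, norm_mul, Complex.norm_real, Real.norm_of_nonneg (by positivity), e1] at e9
  have e10 : (‖b‖ ^ 2 * ‖⟪f₀, a⟫_ℂ * ⟪f₁, b⟫_ℂ - ⟪f₁, a⟫_ℂ * ⟪f₀, b⟫_ℂ‖) ^ 2 ≤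
      ‖b‖ ^ 2 * (‖b‖ ^ 2 * (‖a‖ ^ 2 * ‖b‖ ^ 2 - ‖⟪a, b⟫_ℂ‖ ^ 2)) := by
    calc _ ≤ (‖h‖ * ‖c‖) ^ 2 := pow_le_pow_left₀ (by positivity) e9 2
      _ = ‖h‖ ^ 2 * ‖c‖ ^ 2 := mul_pow _ _ _
      _ ≤ ‖b‖ ^ 2 * ‖c‖ ^ 2 := by gcongr
      _ = _ := by rw [e8]
  have e11 : 0 < ‖b‖ ^ 2 * ‖b‖ ^ 2 := by positivity
  refine le_of_mul_le_mul_left (a := ‖b‖ ^ 2 * ‖b‖ ^ 2) ?_ e11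
  linarith

/-- Parseval in the chosen Hilbert basis, applied to each pair of the finitely many rank one terms.
-/
lemma hilbertTrace_comp_self_of_sum {H : Type*} [NormedAddCommGroup H] [InnerProductSpace ℂ H]
    [CompleteSpace H] {ι : Type*} [Fintype ι] (ψ : ι → H) (T : H →L[ℂ] H)
    (hT : ∀ f, T f = ∑ k, ⟪ψ k, f⟫_ℂ • ψ k) :
    (hilbertTrace (T.comp T)).re = ∑ k, ∑ l, ‖⟪ψ k, ψ l⟫_ℂ‖ ^ 2 := by
  set b := (exists_hilbertBasis ℂ H).choose_spec.choose
  have h1 : ∀ k l, HasSum (fun i => ⟪ψ l, ψ k⟫_ℂ * (⟪ψ k, b i⟫_ℂ * ⟪b i, ψ l⟫_ℂ))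
      (⟪ψ l, ψ k⟫_ℂ * ⟪ψ k, ψ l⟫_ℂ) := fun k l => (b.hasSum_inner_mul_inner _ _).mul_left _
  have h2 := hasSum_sum fun k (_ : k ∈ Finset.univ) =>
    hasSum_sum fun l (_ : l ∈ Finset.univ) => h1 k l
  have h3 : hilbertTrace (T.comp T) = ∑ k, ∑ l, ⟪ψ l, ψ k⟫_ℂ * ⟪ψ k, ψ l⟫_ℂ := by
    rw [← h2.tsum_eq]
    refine tsum_congr fun i => ?_
    change ⟪b i, T (T (b i))⟫_ℂ = _
    rw [hT (b i), map_sum, inner_sum]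
    refine Finset.sum_congr rfl fun k _ => ?_
    rw [map_smul, hT, inner_smul_right, inner_sum, Finset.mul_sum]
    refine Finset.sum_congr rfl fun l _ => ?_
    rw [inner_smul_right]
    ring
  rw [h3, Complex.re_sum]
  refine Finset.sum_congr rfl fun k _ => ?_
  rw [Complex.re_sum]
  refine Finset.sum_congr rfl fun l _ => ?_
  rw [← inner_conj_symm (ψ l), Complex.conj_mul', ← Complex.ofReal_pow, Complex.ofReal_re]

lemma pureProj_apply {H : Type*} [NormedAddCommGroup H] [InnerProductSpace ℂ H] {Ψ : H}
    (h : ‖Ψ‖ = 1) (x : H) : pureProj Ψ x = ⟪Ψ, x⟫_ℂ • Ψ :=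
  Submodule.starProjection_unit_singleton ℂ h x

lemma hilbertTrace_pureProj_comp_self {H : Type*} [NormedAddCommGroup H] [InnerProductSpace ℂ H]
    [CompleteSpace H] {f : H} (hf : f ≠ 0) :
    (hilbertTrace ((pureProj f).comp (pureProj f))).re = 1 := by
  have hf' : ‖f‖ ≠ 0 := norm_ne_zero_iff.2 hf
  have h1 : ‖((‖f‖⁻¹ : ℝ) : ℂ) • f‖ = 1 := by
    rw [norm_smul, Complex.norm_real, norm_inv, norm_norm, inv_mul_cancel₀ hf']
  have h2 : pureProj f = pureProj (((‖f‖⁻¹ : ℝ) : ℂ) • f) := by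
    rw [pureProj, pureProj]
    congr 1
    rw [Submodule.span_singleton_smul_eq]
    exact (Complex.ofReal_ne_zero.2 (inv_ne_zero hf')).isUnit
  rw [h2, hilbertTrace_comp_self_of_sum (fun _ : Unit => ((‖f‖⁻¹ : ℝ) : ℂ) • f) _
    (fun g => by
      rw [pureProj_apply h1, Finset.univ_unique, Finset.sum_singleton])]
  simp only [Finset.univ_unique, Finset.sum_const, Finset.card_singleton, one_smul]
  rw [inner_self_eq_norm_sq_to_K, h1]
  simp

/-- The partial inner product `⟨v, Ψ⟩` of a vector of the spin space with a state. -/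
noncomputable def slice {n : ℕ} (v : SpinSpace n) (Ψ : TotalSpace n) : OrbitalSpace :=
  (innerSL ℂ v).compLp Ψ

/-! ### Partial inner products and the purity in an arbitrary spin basis -/

section slice

variable {n : ℕ}

lemma coeFn_slice (v : SpinSpace n) (Ψ : TotalSpace n) :
    slice v Ψ =ᵐ[volume] fun x => ⟪v, Ψ x⟫_ℂ :=
  ContinuousLinearMap.coeFn_compLp _ Ψ

lemma inner_slice (f : OrbitalSpace) (v : SpinSpace n) (Ψ : TotalSpace n) :
    ⟪f, slice v Ψ⟫_ℂ = ⟪tensor f v, Ψ⟫_ℂ := by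
  rw [L2.inner_def, L2.inner_def]
  refine integral_congr_ae ?_
  filter_upwards [coeFn_slice v Ψ, coeFn_tensor f v] with x h1 h2
  rw [h1, h2, inner_smul_left, RCLike.inner_apply]
  ring

lemma slice_tensor (f : OrbitalSpace) (v w : SpinSpace n) :
    slice w (tensor f v) = ⟪w, v⟫_ℂ • f := by
  refine ext_inner_left ℂ fun g => ?_
  rw [inner_slice, inner_tensor, inner_smul_right, mul_comm]

lemma adjoint_tensorBasis (k : Fin (n + 1)) (Ψ : TotalSpace n) :
    ContinuousLinearMap.adjoint (tensorBasis n k) Ψ = slice (EuclideanSpace.single k 1) Ψ := by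
  refine ext_inner_left ℂ fun f => ?_
  rw [ContinuousLinearMap.adjoint_inner_right, inner_slice, tensorBasis_apply]

lemma sum_tensor_slice (b : OrthonormalBasis (Fin (n + 1)) ℂ (SpinSpace n)) (Ψ : TotalSpace n) :
    ∑ k, tensor (slice (b k) Ψ) (b k) = Ψ := by
  refine Lp.ext ?_
  have h1 : ∀ᵐ x : ℝ, ∀ k, tensor (slice (b k) Ψ) (b k) x = slice (b k) Ψ x • b k :=
    ae_all_iff.2 fun k => coeFn_tensor _ _
  have h2 : ∀ᵐ x : ℝ, ∀ k, slice (b k) Ψ x = ⟪b k, Ψ x⟫_ℂ := ae_all_iff.2 fun k => coeFn_slice _ _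
  filter_upwards [h1, h2, Lp.coeFn_fun_finsetSum Finset.univ
    fun k => tensor (slice (b k) Ψ) (b k)] with x h1 h2 h3
  rw [h3]
  simp only [h1, h2]
  exact b.sum_repr' (Ψ x)

lemma sum_norm_slice_sq (b : OrthonormalBasis (Fin (n + 1)) ℂ (SpinSpace n)) (Ψ : TotalSpace n) :
    ∑ k, ‖slice (b k) Ψ‖ ^ 2 = ‖Ψ‖ ^ 2 := by
  have h1 : ⟪Ψ, Ψ⟫_ℂ = ∑ k, ⟪slice (b k) Ψ, slice (b k) Ψ⟫_ℂ := by
    conv_lhs => lhs; rw [← sum_tensor_slice b Ψ]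
    rw [sum_inner]
    simp only [inner_slice]
  simp only [inner_self_eq_norm_sq_to_K] at h1
  exact_mod_cast h1.symm

lemma orbitalDensity_apply {Ψ : TotalSpace n} (h : ‖Ψ‖ = 1) (f : OrbitalSpace) :
    orbitalDensity n Ψ f = ∑ k, ⟪slice (EuclideanSpace.single k 1) Ψ, f⟫_ℂ •
      slice (EuclideanSpace.single k 1) Ψ := by
  rw [orbitalDensity, spinPartialTrace, _root_.sum_apply]
  refine Finset.sum_congr rfl fun k _ => ?_
  rw [ContinuousLinearMap.comp_apply, ContinuousLinearMap.comp_apply, pureProj_apply h, map_smul,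
    adjoint_tensorBasis, ← adjoint_tensorBasis, ContinuousLinearMap.adjoint_inner_left]

lemma orbitalPurity_eq {Ψ : TotalSpace n} (h : ‖Ψ‖ = 1) :
    orbitalPurity n Ψ = ∑ k, ∑ l, ‖⟪slice (EuclideanSpace.single k (1 : ℂ)) Ψ,
      slice (EuclideanSpace.single l (1 : ℂ)) Ψ⟫_ℂ‖ ^ 2 :=
  hilbertTrace_comp_self_of_sum _ _ (orbitalDensity_apply h)

/-- Both sides are the squared norm of one spin vector, the partial inner product of `Ψ` with `x`.
Applied to one index at a time, this frees the purity from the standard basis. -/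
lemma sum_norm_inner_slice_sq (b b' : OrthonormalBasis (Fin (n + 1)) ℂ (SpinSpace n))
    (Ψ : TotalSpace n) (x : OrbitalSpace) :
    ∑ l, ‖⟪x, slice (b l) Ψ⟫_ℂ‖ ^ 2 = ∑ l, ‖⟪x, slice (b' l) Ψ⟫_ℂ‖ ^ 2 := by
  let T : SpinSpace n →L[ℂ] TotalSpace n := (tensorMap n).flip x
  have h1 : ∀ v, ‖⟪x, slice v Ψ⟫_ℂ‖ = ‖⟪v, ContinuousLinearMap.adjoint T Ψ⟫_ℂ‖ := fun v => by
    rw [inner_slice, ContinuousLinearMap.adjoint_inner_right]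
    rfl
  simp only [h1, OrthonormalBasis.sum_sq_norm_inner_right]

lemma orbitalPurity_eq_of_basis (b : OrthonormalBasis (Fin (n + 1)) ℂ (SpinSpace n))
    {Ψ : TotalSpace n} (h : ‖Ψ‖ = 1) :
    orbitalPurity n Ψ = ∑ k, ∑ l, ‖⟪slice (b k) Ψ, slice (b l) Ψ⟫_ℂ‖ ^ 2 := by
  rw [orbitalPurity_eq h]
  have e : ∀ k, EuclideanSpace.single k (1 : ℂ) = EuclideanSpace.basisFun (Fin (n + 1)) ℂ k :=
    fun k => (EuclideanSpace.basisFun_apply _ _ k).symm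
  simp only [e]
  calc _ = ∑ k, ∑ l, ‖⟪slice (EuclideanSpace.basisFun (Fin (n + 1)) ℂ k) Ψ,
        slice (b l) Ψ⟫_ℂ‖ ^ 2 :=
        Finset.sum_congr rfl fun k _ => sum_norm_inner_slice_sq _ _ _ _
    _ = ∑ l, ∑ k, ‖⟪slice (b l) Ψ,
        slice (EuclideanSpace.basisFun (Fin (n + 1)) ℂ k) Ψ⟫_ℂ‖ ^ 2 := by
        rw [Finset.sum_comm]
        simp only [norm_inner_symm]
    _ = _ := Finset.sum_congr rfl fun k _ => sum_norm_inner_slice_sq _ _ _ _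

/-- A `2 × 2` minor of the amplitudes of a state in orthonormal families bounds its purity. -/
lemma orbitalPurity_le (hn : 0 < n) {Ψ : TotalSpace n} (h : ‖Ψ‖ = 1) {f₀ f₁ : OrbitalSpace}
    (hf₀ : ⟪f₀, f₀⟫_ℂ = 1) (hf₁ : ⟪f₁, f₁⟫_ℂ = 1) (hf : ⟪f₀, f₁⟫_ℂ = 0) {v₀ v₁ : SpinSpace n}
    (hv₀ : ⟪v₀, v₀⟫_ℂ = 1) (hv₁ : ⟪v₁, v₁⟫_ℂ = 1) (hv : ⟪v₀, v₁⟫_ℂ = 0) :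
    orbitalPurity n Ψ ≤ 1 - 2 * ‖⟪tensor f₀ v₀, Ψ⟫_ℂ * ⟪tensor f₁ v₁, Ψ⟫_ℂ -
      ⟪tensor f₁ v₀, Ψ⟫_ℂ * ⟪tensor f₀ v₁, Ψ⟫_ℂ‖ ^ 2 := by
  -- Only the values at `0` and `Fin.last n` matter; these indices differ because `0 < n`, and the
  -- pair extends to an orthonormal basis.
  set v : Fin (n + 1) → SpinSpace n := fun i => if i = 0 then v₀ else v₁ with hvdef
  have h01 : (0 : Fin (n + 1)) ≠ Fin.last n := by
    intro h
    have := congrArg Fin.val h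
    simp at this
    omega
  have e0 : v 0 = v₀ := if_pos rfl
  have e1 : v (Fin.last n) = v₁ := if_neg h01.symm
  have horth : Orthonormal ℂ (Set.domRestrict {0, Fin.last n} v) := by
    rw [orthonormal_iff_ite]
    rintro ⟨i, rfl | rfl⟩ ⟨j, rfl | rfl⟩
    · rw [if_pos rfl, Set.domRestrict_apply, e0, hv₀]
    · rw [if_neg (fun h => h01 (congrArg Subtype.val h)), Set.domRestrict_apply, Set.domRestrict_apply, e0, e1, hv]
    · rw [if_neg (fun h => h01.symm (congrArg Subtype.val h)), Set.domRestrict_apply, Set.domRestrict_apply, e0, e1,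
        inner_eq_zero_symm.1 hv]
    · rw [if_pos rfl, Set.domRestrict_apply, e1, hv₁]
  obtain ⟨b, hb⟩ := horth.exists_orthonormalBasis_extension_of_card_eq (by simp)
  have b0 : b 0 = v₀ := (hb 0 (by simp)).trans e0
  have b1 : b (Fin.last n) = v₁ := (hb _ (by simp)).trans e1
  rw [orbitalPurity_eq_of_basis b h]
  have hsum := sum_norm_slice_sq b Ψ
  rw [h, one_pow] at hsum
  have hminor := norm_inner_minor_sq_le hf₀ hf₁ hf (slice v₀ Ψ) (slice v₁ Ψ)
  simp only [inner_slice f₀, inner_slice f₁] at hminor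
  set D : Fin (n + 1) → Fin (n + 1) → ℝ := fun k l =>
    ‖slice (b k) Ψ‖ ^ 2 * ‖slice (b l) Ψ‖ ^ 2 - ‖⟪slice (b k) Ψ, slice (b l) Ψ⟫_ℂ‖ ^ 2 with hD
  have hD0 : ∀ k l, 0 ≤ D k l := fun k l => by
    have := norm_inner_le_norm (𝕜 := ℂ) (slice (b k) Ψ) (slice (b l) Ψ)
    have := pow_le_pow_left₀ (norm_nonneg _) this 2
    rw [mul_pow] at this
    exact sub_nonneg.2 this
  have hDsymm : D (Fin.last n) 0 = D 0 (Fin.last n) := by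
    simp only [hD]
    rw [norm_inner_symm, mul_comm]
  have hDsum : ∑ k, ∑ l, D k l = 1 - ∑ k, ∑ l, ‖⟪slice (b k) Ψ, slice (b l) Ψ⟫_ℂ‖ ^ 2 := by
    simp only [hD, Finset.sum_sub_distrib]
    rw [← Finset.sum_mul_sum, hsum, one_mul]
  -- All Gram determinants are nonnegative, and the pair of indices occurs in both orders; hence the
  -- factor `2` in the bound.
  have hle : D 0 (Fin.last n) + D (Fin.last n) 0 ≤ ∑ k, ∑ l, D k l := by
    calc D 0 (Fin.last n) + D (Fin.last n) 0
        ≤ (∑ l, D 0 l) + ∑ l, D (Fin.last n) l := add_le_add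
          (Finset.single_le_sum (fun l _ => hD0 0 l) (Finset.mem_univ _))
          (Finset.single_le_sum (fun l _ => hD0 _ l) (Finset.mem_univ _))
      _ = ∑ k ∈ {0, Fin.last n}, ∑ l, D k l :=
          (Finset.sum_pair (f := fun k => ∑ l, D k l) h01).symm
      _ ≤ _ := Finset.sum_le_sum_of_subset_of_nonneg (Finset.subset_univ _)
          fun k _ _ => Finset.sum_nonneg fun l _ => hD0 k l
  have hD01 : D 0 (Fin.last n) =
      ‖slice v₀ Ψ‖ ^ 2 * ‖slice v₁ Ψ‖ ^ 2 - ‖⟪slice v₀ Ψ, slice v₁ Ψ⟫_ℂ‖ ^ 2 := by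
    simp only [hD, b0, b1]
  rw [hDsymm, hD01, hDsum] at hle
  linarith

lemma orbitalPurity_of_pure {Ψ : TotalSpace n} (h : ‖Ψ‖ = 1) {f : OrbitalSpace}
    (hf : orbitalDensity n Ψ = pureProj f) : orbitalPurity n Ψ = 1 := by
  rcases eq_or_ne f 0 with rfl | hf0
  -- The span of `0` gives the zero operator. A vanishing density would make every slice zero,
  -- against `‖Ψ‖ = 1`.
  · exfalso
    have hz : ∀ g : OrbitalSpace, orbitalDensity n Ψ g = 0 := fun g => by
      rw [hf, pureProj, Submodule.starProjection_apply_eq_zero_iff,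
        Submodule.mem_orthogonal_singleton_iff_inner_right, inner_zero_left]
    have hs : ∀ j : Fin (n + 1), slice (EuclideanSpace.single j (1 : ℂ)) Ψ = 0 := fun j => by
      set g := slice (EuclideanSpace.single j (1 : ℂ)) Ψ with hg
      have h1 : ⟪g, orbitalDensity n Ψ g⟫_ℂ = 0 := by rw [hz, inner_zero_right]
      rw [orbitalDensity_apply h, inner_sum] at h1
      have h2 : ∑ k, ‖⟪slice (EuclideanSpace.single k (1 : ℂ)) Ψ, g⟫_ℂ‖ ^ 2 = 0 := by
        have : ((∑ k, ‖⟪slice (EuclideanSpace.single k (1 : ℂ)) Ψ, g⟫_ℂ‖ ^ 2 : ℝ) : ℂ) = 0 := by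
          rw [← h1]
          push_cast
          refine Finset.sum_congr rfl fun k _ => ?_
          rw [inner_smul_right, ← inner_conj_symm g, Complex.mul_conj']
        exact_mod_cast this
      have h3 := (Finset.sum_eq_zero_iff_of_nonneg fun k _ => sq_nonneg _).1 h2 j
        (Finset.mem_univ j)
      rw [← hg] at h3
      exact inner_self_eq_zero.1 (norm_eq_zero.1 (pow_eq_zero_iff two_ne_zero |>.1 h3))
    have h1 := sum_norm_slice_sq (EuclideanSpace.basisFun (Fin (n + 1)) ℂ) Ψ
    simp only [EuclideanSpace.basisFun_apply, hs, h] at h1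
    simp at h1
  · rw [orbitalPurity, hf]
    exact hilbertTrace_pureProj_comp_self hf0

lemma orbitalPurity_of_product {Ψ : TotalSpace n} (h : ‖Ψ‖ = 1) {f : OrbitalSpace}
    {v : SpinSpace n} (hΨ : Ψ =ᵐ[volume] fun x => f x • v) : orbitalPurity n Ψ = 1 := by
  obtain rfl : Ψ = tensor f v := Lp.ext (hΨ.trans (coeFn_tensor f v).symm)
  rw [orbitalPurity_eq h]
  have h2 : ∀ k l : Fin (n + 1), ‖⟪slice (EuclideanSpace.single k (1 : ℂ)) (tensor f v),
      slice (EuclideanSpace.single l (1 : ℂ)) (tensor f v)⟫_ℂ‖ ^ 2 =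
      (‖v k‖ ^ 2 * ‖f‖ ^ 2) * (‖v l‖ ^ 2 * ‖f‖ ^ 2) := fun k l => by
    rw [slice_tensor, slice_tensor, inner_smul_left, inner_smul_right,
      inner_self_eq_norm_sq_to_K, norm_mul, norm_mul, RCLike.norm_conj,
      EuclideanSpace.inner_single_left, EuclideanSpace.inner_single_left]
    simp
    ring
  simp only [h2]
  rw [← Finset.sum_mul_sum, ← Finset.sum_mul, ← EuclideanSpace.norm_sq_eq, ← mul_pow,
    mul_comm ‖v‖, ← norm_tensor, h]
  norm_num

end slice

/-! ### The mean field trajectory -/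

/-- The mean field equations for the centre `ζ = q + ip` of the orbital state, the spinor `(u, v)`
of the spin state and the phase `a`, with coupling `ε`. -/
structure IsMeanField (ωc ω₃ κ ε δ : ℝ) (ζ u v : ℝ → ℂ) (a : ℝ → ℝ) : Prop where
  unit : ∀ t ∈ Set.Ioo (-δ) δ, starRingEnd ℂ (u t) * u t + starRingEnd ℂ (v t) * v t = 1
  centre : ∀ t ∈ Set.Ioo (-δ) δ, HasDerivAt ζ
    (-Complex.I * (ωc * ζ t + (2 * κ * ε * spinorMean (u t) (v t) : ℝ))) t
  fst : ∀ t ∈ Set.Ioo (-δ) δ, HasDerivAt u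
    (-Complex.I / 2 * (ω₃ * u t + (ε * (ζ t).re : ℝ) * v t)) t
  snd : ∀ t ∈ Set.Ioo (-δ) δ, HasDerivAt v
    (-Complex.I / 2 * (-ω₃ * v t + (ε * (ζ t).re : ℝ) * u t)) t
  phase : ∀ t ∈ Set.Ioo (-δ) δ, HasDerivAt a (κ * ε * spinorMean (u t) (v t) * (ζ t).re) t

lemma eq_of_hasDerivAt_zero {E : Type*} [NormedAddCommGroup E] [NormedSpace ℝ E] {δ : ℝ}
    {f : ℝ → E} (hf : ∀ t ∈ Set.Ioo (-δ) δ, HasDerivAt f 0 t) {t : ℝ}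
    (ht : t ∈ Set.Ioo (-δ) δ) : f t = f 0 := by
  have h0 : (0 : ℝ) ∈ Set.Ioo (-δ) δ := ⟨by linarith [ht.1, ht.2], by linarith [ht.1, ht.2]⟩
  exact isOpen_Ioo.is_const_of_deriv_eq_zero isPreconnected_Ioo
    (fun s hs => (hf s hs).differentiableAt.differentiableWithinAt)
    (fun s hs => (hf s hs).deriv) ht h0

lemma hasDerivAt_conj_mul {u v : ℝ → ℂ} {u' v' : ℂ} {t : ℝ} (hu : HasDerivAt u u' t)
    (hv : HasDerivAt v v' t) : HasDerivAt (fun s => starRingEnd ℂ (u s) * v s)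
      (starRingEnd ℂ u' * v t + starRingEnd ℂ (u t) * v') t :=
  HasDerivAt.mul (c := fun s => star (u s)) hu.star hv

lemma IsMeanField.hasDerivAt_mean {ωc ω₃ κ ε δ : ℝ} {ζ u v : ℝ → ℂ} {a : ℝ → ℝ}
    (h : IsMeanField ωc ω₃ κ ε δ ζ u v a) {t : ℝ} (ht : t ∈ Set.Ioo (-δ) δ) :
    HasDerivAt (fun s => spinorMean (u s) (v s)) (-ω₃ * (starRingEnd ℂ (u t) * v t).im) t := by
  have h1 := hasDerivAt_conj_mul (h.fst t ht) (h.snd t ht)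
  have h2 : HasDerivAt (fun s => spinorMean (u s) (v s)) _ t :=
    Complex.reCLM.hasFDerivAt.comp_hasDerivAt t h1
  refine h2.congr_deriv ?_
  simp only [Complex.reCLM_apply, map_mul, map_div₀, map_neg, Complex.conj_I, map_add,
    Complex.conj_ofReal, Complex.conj_ofNat]
  simp
  ring

/-- The coupling depends on `ħ`, but the time interval must not. So `ε` is carried as a component of
the unknown with zero derivative, and local existence uniform in the initial value gives one `δ` for
all `ε` near `ε₀`. -/
lemma exists_isMeanField (ωc ω₃ κ ε₀ : ℝ) (ζ₀ u₀ v₀ : ℂ)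
    (h₀ : starRingEnd ℂ u₀ * u₀ + starRingEnd ℂ v₀ * v₀ = 1) :
    ∃ r > 0, ∃ δ > 0, ∀ ε : ℝ, |ε - ε₀| ≤ r → ∃ (ζ u v : ℝ → ℂ) (a : ℝ → ℝ),
      ζ 0 = ζ₀ ∧ u 0 = u₀ ∧ v 0 = v₀ ∧ a 0 = 0 ∧ IsMeanField ωc ω₃ κ ε δ ζ u v a := by
  let f : ℂ × ℂ × ℂ × ℝ × ℝ → ℂ × ℂ × ℂ × ℝ × ℝ := fun x =>
    (-Complex.I * (ωc * x.1 + (2 * κ * x.2.2.2.1 * (starRingEnd ℂ x.2.1 * x.2.2.1).re : ℝ)),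
      -Complex.I / 2 * (ω₃ * x.2.1 + (x.2.2.2.1 * x.1.re : ℝ) * x.2.2.1),
      -Complex.I / 2 * (-ω₃ * x.2.2.1 + (x.2.2.2.1 * x.1.re : ℝ) * x.2.1),
      0, κ * x.2.2.2.1 * (starRingEnd ℂ x.2.1 * x.2.2.1).re * x.1.re)
  have hf : ContDiff ℝ 1 f := by
    have hre : ContDiff ℝ 1 fun z : ℂ => z.re := Complex.reCLM.contDiff
    have hof : ContDiff ℝ 1 fun s : ℝ => (s : ℂ) := Complex.ofRealCLM.contDiff
    have hcj : ContDiff ℝ 1 fun z : ℂ => starRingEnd ℂ z := Complex.conjCLE.contDiff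
    have e : ContDiff ℝ 1 fun x : ℂ × ℂ × ℂ × ℝ × ℝ => (x.1.re : ℝ) := hre.comp (by fun_prop)
    have em : ContDiff ℝ 1 fun x : ℂ × ℂ × ℂ × ℝ × ℝ => (starRingEnd ℂ x.2.1 * x.2.2.1).re :=
      hre.comp (ContDiff.mul (hcj.comp (by fun_prop)) (by fun_prop))
    have eq : ContDiff ℝ 1 fun x : ℂ × ℂ × ℂ × ℝ × ℝ => ((x.2.2.2.1 * x.1.re : ℝ) : ℂ) :=
      hof.comp (ContDiff.mul (by fun_prop) e)
    have ek : ContDiff ℝ 1 fun x : ℂ × ℂ × ℂ × ℝ × ℝ =>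
        ((2 * κ * x.2.2.2.1 * (starRingEnd ℂ x.2.1 * x.2.2.1).re : ℝ) : ℂ) :=
      hof.comp (ContDiff.mul (by fun_prop) em)
    refine ContDiff.prodMk (by fun_prop) (ContDiff.prodMk (by fun_prop)
      (ContDiff.prodMk (by fun_prop) (ContDiff.prodMk (by fun_prop) ?_)))
    exact ContDiff.mul (ContDiff.mul (by fun_prop) em) e
  obtain ⟨r, hr, δ, hδ, H⟩ := (hf.contDiffAt (x := (ζ₀, u₀, v₀, ε₀, (0 : ℝ)))
    ).exists_forall_mem_closedBall_exists_eq_forall_mem_Ioo_hasDerivAt 0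
  refine ⟨r, hr, δ, hδ, fun ε hε => ?_⟩
  obtain ⟨α, hα0, hα⟩ := H (ζ₀, u₀, v₀, ε, (0 : ℝ)) (by
    rw [mem_closedBall_iff_norm]
    simpa [Prod.norm_def, hr.le] using hε)
  rw [zero_sub, zero_add] at hα
  have d1 : ∀ t ∈ Set.Ioo (-δ) δ, HasDerivAt (fun s => (α s).1) (f (α t)).1 t := fun t ht =>
    (ContinuousLinearMap.fst ℝ ℂ (ℂ × ℂ × ℝ × ℝ)).hasFDerivAt.comp_hasDerivAt t (hα t ht)
  have d2 : ∀ t ∈ Set.Ioo (-δ) δ, HasDerivAt (fun s => (α s).2) (f (α t)).2 t := fun t ht =>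
    (ContinuousLinearMap.snd ℝ ℂ (ℂ × ℂ × ℝ × ℝ)).hasFDerivAt.comp_hasDerivAt t (hα t ht)
  have d21 : ∀ t ∈ Set.Ioo (-δ) δ, HasDerivAt (fun s => (α s).2.1) (f (α t)).2.1 t := fun t ht =>
    (ContinuousLinearMap.fst ℝ ℂ (ℂ × ℝ × ℝ)).hasFDerivAt.comp_hasDerivAt t (d2 t ht)
  have d22 : ∀ t ∈ Set.Ioo (-δ) δ, HasDerivAt (fun s => (α s).2.2) (f (α t)).2.2 t := fun t ht =>
    (ContinuousLinearMap.snd ℝ ℂ (ℂ × ℝ × ℝ)).hasFDerivAt.comp_hasDerivAt t (d2 t ht)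
  have d221 : ∀ t ∈ Set.Ioo (-δ) δ, HasDerivAt (fun s => (α s).2.2.1) (f (α t)).2.2.1 t :=
    fun t ht => (ContinuousLinearMap.fst ℝ ℂ (ℝ × ℝ)).hasFDerivAt.comp_hasDerivAt t (d22 t ht)
  have d222 : ∀ t ∈ Set.Ioo (-δ) δ, HasDerivAt (fun s => (α s).2.2.2) (f (α t)).2.2.2 t :=
    fun t ht => (ContinuousLinearMap.snd ℝ ℂ (ℝ × ℝ)).hasFDerivAt.comp_hasDerivAt t (d22 t ht)
  have d3 : ∀ t ∈ Set.Ioo (-δ) δ, HasDerivAt (fun s => (α s).2.2.2.1) (f (α t)).2.2.2.1 t :=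
    fun t ht => (ContinuousLinearMap.fst ℝ ℝ ℝ).hasFDerivAt.comp_hasDerivAt t (d222 t ht)
  have d4 : ∀ t ∈ Set.Ioo (-δ) δ, HasDerivAt (fun s => (α s).2.2.2.2) (f (α t)).2.2.2.2 t :=
    fun t ht => (ContinuousLinearMap.snd ℝ ℝ ℝ).hasFDerivAt.comp_hasDerivAt t (d222 t ht)
  have hε' : ∀ t ∈ Set.Ioo (-δ) δ, (α t).2.2.2.1 = ε := fun t ht => by
    rw [eq_of_hasDerivAt_zero (f := fun s => (α s).2.2.2.1) d3 ht, hα0]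
  have e21 : ∀ t ∈ Set.Ioo (-δ) δ, HasDerivAt (fun s => (α s).2.1)
    (-Complex.I / 2 * (ω₃ * (α t).2.1 + (ε * (α t).1.re : ℝ) * (α t).2.2.1)) t := fun t ht => by
    rw [← hε' t ht]; exact d21 t ht
  have e221 : ∀ t ∈ Set.Ioo (-δ) δ, HasDerivAt (fun s => (α s).2.2.1)
    (-Complex.I / 2 * (-ω₃ * (α t).2.2.1 + (ε * (α t).1.re : ℝ) * (α t).2.1)) t := fun t ht => by
    rw [← hε' t ht]; exact d221 t ht
  refine ⟨fun s => (α s).1, fun s => (α s).2.1, fun s => (α s).2.2.1, fun s => (α s).2.2.2.2,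
    congrArg (fun x => x.1) hα0, congrArg (fun x => x.2.1) hα0, congrArg (fun x => x.2.2.1) hα0,
    congrArg (fun x => x.2.2.2.2) hα0, fun t ht => ?_, fun t ht => ?_, e21, e221,
    fun t ht => ?_⟩
  -- The spinor moves under a Hermitian matrix, so its norm is conserved.
  · have hd : ∀ t ∈ Set.Ioo (-δ) δ, HasDerivAt (fun s => starRingEnd ℂ (α s).2.1 * (α s).2.1 +
        starRingEnd ℂ (α s).2.2.1 * (α s).2.2.1) 0 t := fun t ht => by
      refine ((hasDerivAt_conj_mul (e21 t ht) (e21 t ht)).add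
        (hasDerivAt_conj_mul (e221 t ht) (e221 t ht))).congr_deriv ?_
      simp only [map_mul, map_div₀, map_neg, Complex.conj_I, map_add, Complex.conj_ofReal,
        Complex.conj_ofNat]
      ring
    rw [eq_of_hasDerivAt_zero hd ht, hα0]
    exact h₀
  · have := d1 t ht
    simp only [f] at this
    rw [hε' t ht] at this
    exact this
  · have := d4 t ht
    simp only [f] at this
    rw [hε' t ht] at this
    exact this

/-! ### The mean field state and its first excitation -/

section derivatives

variable {ħ : ℝ} (hħ : 0 < ħ) {A ζ : ℝ → ℂ} {A' ζ' : ℂ} {t : ℝ}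

lemma hasDerivAt_gaussLp_comp (hζ : HasDerivAt ζ ζ' t) (k : ℕ) :
    HasDerivAt (fun s => gaussLp hħ (ζ s) k) ((ζ' / ħ) • gaussLp hħ (ζ t) (k + 1)) t := by
  refine ((hasDerivAt_gaussLp hħ (ζ t) k).scomp t hζ).congr_deriv ?_
  rw [smul_smul, mul_one_div]

lemma hasDerivAt_packet (hA : HasDerivAt A A' t) (hζ : HasDerivAt ζ ζ' t) :
    HasDerivAt (fun s => packet hħ (A s) (ζ s))
      (A t • ((ζ' / ħ) • gaussLp hħ (ζ t) 1) + A' • gaussLp hħ (ζ t) 0) t :=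
  hA.smul (hasDerivAt_gaussLp_comp hħ hζ 0)

lemma hasDerivAt_re (hζ : HasDerivAt ζ ζ' t) :
    HasDerivAt (fun s => ((ζ s).re : ℂ)) (ζ'.re : ℂ) t :=
  (Complex.ofRealCLM.comp Complex.reCLM).hasFDerivAt.comp_hasDerivAt t hζ

lemma hasDerivAt_packetOne (hA : HasDerivAt A A' t) (hζ : HasDerivAt ζ ζ' t) :
    HasDerivAt (fun s => packetOne hħ (A s) (ζ s))
      (A t • ((ζ' / ħ) • gaussLp hħ (ζ t) 2 -
          (((ζ t).re : ℂ) • ((ζ' / ħ) • gaussLp hħ (ζ t) 1) + (ζ'.re : ℂ) • gaussLp hħ (ζ t) 0)) +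
        A' • (gaussLp hħ (ζ t) 1 - ((ζ t).re : ℂ) • gaussLp hħ (ζ t) 0)) t :=
  hA.smul ((hasDerivAt_gaussLp_comp hħ hζ 1).sub
    ((hasDerivAt_re hζ).smul (hasDerivAt_gaussLp_comp hħ hζ 0)))

end derivatives

section residual

variable {n : ℕ} {ħ ωc ω₃ lam ε : ℝ} (hħ : 0 < ħ)

/-- The mean field state solves the Schrödinger equation up to the fluctuation of the coupling. -/
lemma exists_isAdjointPair_packet (hε : 2 * lam / √(((n : ℝ) + 1) * ħ) = ε) {A A' ζ ζ' m : ℂ}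
    {F F' : SpinSpace n}
    (hA : Complex.I * ħ * A' = (ωc / 2 * (ħ - ζ ^ 2) - ħ * ε * n * m * ζ.re) * A)
    (hζ : Complex.I * ζ' = ωc * ζ + ħ * ε * n * m)
    (hF : Complex.I • F' = (ω₃ : ℂ) • spinAct (spinThree n) F +
      (ε * ζ.re : ℂ) • spinAct (spinOne n) F) :
    ∃ Θ, IsAdjointPair n ħ ωc ω₃ lam (tensor (packet hħ A ζ) F) Θ ∧
      (Complex.I * ħ) • (tensor (packet hħ A ζ) F' +
        tensor (A • ((ζ' / ħ) • gaussLp hħ ζ 1) + A' • gaussLp hħ ζ 0) F) =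
      Θ - (ħ * ε : ℂ) • tensor (packetOne hħ A ζ) (spinAct (spinOne n) F - (n * m) • F) := by
  have hne : (ħ : ℂ) ≠ 0 := Complex.ofReal_ne_zero.2 hħ.ne'
  have h0 := isAdjointPair_gaussLp_zero (ωc := ωc) (ω₃ := ω₃) (lam := lam) hħ ζ F
  rw [hε] at h0
  have hF0 := congrArg (fun w => tensor (gaussLp hħ ζ 0) w) hF
  simp only [tensor_add, tensor_smul] at hF0
  have hz : ζ' / ħ * ħ = ζ' := by field_simp
  refine ⟨_, by rw [packet, tensor_smul_left]; exact h0.smul A, ?_⟩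
  simp only [packet, packetOne, tensor_add_left, tensor_sub_left, tensor_smul_left, tensor_sub,
    tensor_smul]
  generalize ζ' / (ħ : ℂ) = z at hz
  -- The spin motion `hF0` accounts for `q S₁`, the drift `hζ` for `n m x` and the amplitude `hA`
  -- for the scalars; the product of the two fluctuations is left over.
  linear_combination (norm := module) (ħ * A) • hF0 + (A * hζ) • tensor (gaussLp hħ ζ 1) F +
    (Complex.I * A * hz) • tensor (gaussLp hħ ζ 1) F + hA • tensor (gaussLp hħ ζ 0) F

/-- The first excitation of the mean field state solves the Schrödinger equation up to `ħ` times
a term that is bounded uniformly in `ħ`. -/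
lemma exists_isAdjointPair_packetOne (hε : 2 * lam / √(((n : ℝ) + 1) * ħ) = ε)
    {A A' ζ ζ' q' m : ℂ} {y y' z : SpinSpace n}
    (hA : Complex.I * ħ * A' = (ωc / 2 * (ħ - ζ ^ 2) - ħ * ε * n * m * ζ.re) * A)
    (hζ : Complex.I * ζ' = ωc * ζ + ħ * ε * n * m)
    (hq : Complex.I * q' = ωc * (ζ - ζ.re))
    (hy : Complex.I • y' = (ω₃ : ℂ) • spinAct (spinThree n) y +
      (ε * ζ.re : ℂ) • spinAct (spinOne n) y + z) :
    ∃ Θ, IsAdjointPair n ħ ωc ω₃ lam (tensor (packetOne hħ A ζ) y) Θ ∧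
      (Complex.I * ħ) • (tensor (packetOne hħ A ζ) y' +
        tensor (A • ((ζ' / ħ) • gaussLp hħ ζ 2 -
          ((ζ.re : ℂ) • ((ζ' / ħ) • gaussLp hħ ζ 1) + q' • gaussLp hħ ζ 0)) +
          A' • (gaussLp hħ ζ 1 - (ζ.re : ℂ) • gaussLp hħ ζ 0)) y) =
      Θ + (ħ : ℂ) • (tensor (packetOne hħ A ζ) z - (ωc : ℂ) • tensor (packetOne hħ A ζ) y -
        (ε : ℂ) • tensor (packetTwo hħ A ζ) (spinAct (spinOne n) y - (n * m) • y)) := by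
  have hne : (ħ : ℂ) ≠ 0 := Complex.ofReal_ne_zero.2 hħ.ne'
  have h0 := isAdjointPair_gaussLp_zero (ωc := ωc) (ω₃ := ω₃) (lam := lam) hħ ζ y
  have h1 := isAdjointPair_gaussLp_one (ωc := ωc) (ω₃ := ω₃) (lam := lam) hħ ζ y
  rw [hε] at h0 h1
  have hy0 := congrArg (fun w => tensor (gaussLp hħ ζ 0) w) hy
  have hy1 := congrArg (fun w => tensor (gaussLp hħ ζ 1) w) hy
  simp only [tensor_add, tensor_smul] at hy0 hy1
  have hz : ζ' / ħ * ħ = ζ' := by field_simp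
  refine ⟨_, by
    rw [packetOne, tensor_smul_left, tensor_sub_left, tensor_smul_left]
    exact (h1.sub (h0.smul _)).smul A, ?_⟩
  simp only [packetTwo, packetOne, tensor_add_left, tensor_sub_left, tensor_smul_left, tensor_sub,
    tensor_smul]
  generalize ζ' / (ħ : ℂ) = w at hz
  linear_combination (norm := module) (ħ * A) • hy1 - (ħ * A * ζ.re) • hy0 +
    (A * hζ) • tensor (gaussLp hħ ζ 2) y - (A * ζ.re * hζ) • tensor (gaussLp hħ ζ 1) y +
    (Complex.I * A * hz) • tensor (gaussLp hħ ζ 2) y -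
    (Complex.I * A * ζ.re * hz) • tensor (gaussLp hħ ζ 1) y +
    hA • tensor (gaussLp hħ ζ 1) y - (ζ.re * hA) • tensor (gaussLp hħ ζ 0) y -
    (ħ * A * hq) • tensor (gaussLp hħ ζ 0) y

/-- The Hamiltonian cancels between the two factors. What remains is the residual, and its factor
`ħ` cancels the `ħ` of the Schrödinger equation; all later estimates are uniform in `ħ` for this
reason. -/
lemma hasDerivAt_inner_of_residual (hħ : 0 < ħ) {Ξ Ψ : ℝ → TotalSpace n}
    {Ξ' Ψ' Θ G : TotalSpace n} {t : ℝ}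
    (hΞ : HasDerivAt Ξ Ξ' t) (hpair : IsAdjointPair n ħ ωc ω₃ lam (Ξ t) Θ)
    (hres : (Complex.I * ħ) • Ξ' = Θ + (ħ : ℂ) • G) (hΨ : HasDerivAt Ψ Ψ' t)
    (hgraph : (Ψ t, (Complex.I * (ħ : ℂ)) • Ψ') ∈ dickeGraph n ħ ωc ω₃ lam) :
    HasDerivAt (fun s => ⟪Ξ s, Ψ s⟫_ℂ) (Complex.I * ⟪G, Ψ t⟫_ℂ) t := by
  have hne : (ħ : ℂ) ≠ 0 := Complex.ofReal_ne_zero.2 hħ.ne'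
  refine (hΞ.inner ℂ hΨ).congr_deriv ?_
  have h1 := hpair _ hgraph
  have h2 := congrArg (fun w => ⟪w, Ψ t⟫_ℂ) hres
  simp only [inner_smul_left, inner_smul_right, inner_add_left, map_mul, Complex.conj_I,
    Complex.conj_ofReal] at h1 h2
  have hI := Complex.I_mul_I
  have h3 : Complex.I * ħ * (⟪Ξ t, Ψ'⟫_ℂ + ⟪Ξ', Ψ t⟫_ℂ) =
      Complex.I * ħ * (Complex.I * ⟪G, Ψ t⟫_ℂ) := by
    linear_combination h1 - h2 - ħ * ⟪G, Ψ t⟫_ℂ * hI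
  exact mul_left_cancel₀ (mul_ne_zero Complex.I_ne_zero hne) h3

lemma norm_eq_of_evolution (hħ : 0 < ħ) {Ψ : ℝ → TotalSpace n}
    (h : ∀ t : ℝ, ∃ Ψ' : TotalSpace n, HasDerivAt Ψ Ψ' t ∧
      (Ψ t, (Complex.I * (ħ : ℂ)) • Ψ') ∈ dickeGraph n ħ ωc ω₃ lam) (t : ℝ) :
    ‖Ψ t‖ = ‖Ψ 0‖ := by
  have hne : (ħ : ℂ) ≠ 0 := Complex.ofReal_ne_zero.2 hħ.ne'
  have hd : ∀ t, HasDerivAt (fun s => ⟪Ψ s, Ψ s⟫_ℂ) 0 t := fun t => by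
    obtain ⟨Ψ', h1, h2⟩ := h t
    refine (h1.inner ℂ h1).congr_deriv ?_
    have h3 := inner_comm_of_mem_dickeGraph h2
    simp only [inner_smul_left, inner_smul_right, map_mul, Complex.conj_I,
      Complex.conj_ofReal] at h3
    have h4 : Complex.I * ħ * (⟪Ψ t, Ψ'⟫_ℂ + ⟪Ψ', Ψ t⟫_ℂ) = 0 := by
      linear_combination h3
    exact (mul_eq_zero.1 h4).resolve_left (mul_ne_zero Complex.I_ne_zero hne)
  have h1 : ⟪Ψ t, Ψ t⟫_ℂ = ⟪Ψ 0, Ψ 0⟫_ℂ :=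
    is_const_of_deriv_eq_zero (fun r => (hd r).differentiableAt) (fun r => (hd r).deriv) t 0
  rw [inner_self_eq_norm_sq_to_K, inner_self_eq_norm_sq_to_K] at h1
  have h2 : ‖Ψ t‖ ^ 2 = ‖Ψ 0‖ ^ 2 := by exact_mod_cast h1
  exact (pow_left_inj₀ (norm_nonneg _) (norm_nonneg _) two_ne_zero).1 h2

end residual

/-! ### Comparison of the evolution with the mean field state -/

/-- The amplitude of the mean field wave packet. -/
noncomputable def meanAmp (ħ ωc : ℝ) (ζ : ℝ → ℂ) (a : ℝ → ℝ) (t : ℝ) : ℂ :=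
  (((Real.pi * ħ) ^ (-(1 / 4 : ℝ)) : ℝ) : ℂ) *
    Complex.exp ((-((ζ t).re * ζ t / 2) + Complex.I * a t) / ħ - Complex.I * ωc * t / 2)

lemma norm_meanAmp {ħ : ℝ} (hħ : 0 < ħ) (ωc : ℝ) (ζ : ℝ → ℂ) (a : ℝ → ℝ) (t : ℝ) :
    ‖meanAmp ħ ωc ζ a t‖ ^ 2 * Real.exp ((ζ t).re ^ 2 / ħ) * √(Real.pi * ħ) = 1 := by
  have hp : 0 < Real.pi * ħ := by positivity
  have h1 : ((-((ζ t).re * ζ t / 2) + Complex.I * a t) / ħ - Complex.I * ωc * t / 2).re =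
      -((ζ t).re ^ 2 / ħ) / 2 := by
    have : ((-((ζ t).re * ζ t / 2) + Complex.I * a t) / ħ - Complex.I * ωc * t / 2) =
      ((-((ζ t).re ^ 2 / ħ) / 2 : ℝ) : ℂ) +
        (((-(ζ t).re * (ζ t).im / 2 + a t) / ħ - ωc * t / 2 : ℝ) : ℂ) * Complex.I := by
      conv_lhs => enter [1, 1, 1, 1, 1, 2]; rw [← Complex.re_add_im (ζ t)]
      push_cast
      ring
    rw [this]
    simp only [Complex.add_re, Complex.ofReal_re, Complex.re_ofReal_mul, Complex.I_re, mul_zero,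
      add_zero]
  rw [meanAmp, norm_mul, Complex.norm_real, Complex.norm_exp, h1,
    Real.norm_of_nonneg (by positivity), mul_pow, ← Real.exp_nat_mul]
  have h2 : ((2 : ℕ) : ℝ) * (-((ζ t).re ^ 2 / ħ) / 2) = -((ζ t).re ^ 2 / ħ) := by
    push_cast; ring
  rw [h2, Real.exp_neg, ← Real.rpow_natCast, ← Real.rpow_mul hp.le, Real.sqrt_eq_rpow]
  have h3 : (-(1 / 4 : ℝ)) * ((2 : ℕ) : ℝ) = -(1 / 2) := by norm_num
  rw [h3, Real.rpow_neg hp.le, mul_assoc _ _ (Real.exp _), inv_mul_cancel₀ (Real.exp_pos _).ne',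
    mul_one, inv_mul_cancel₀ (Real.rpow_pos_of_pos hp _).ne']

/-- The parameters of the mean field approximation for the Dicke Hamiltonian. -/
structure IsDickeFrame (n : ℕ) (ħ ωc ω₃ lam κ ε δ : ℝ) (ζ u v : ℝ → ℂ) (a : ℝ → ℝ) : Prop where
  n_pos : 0 < n
  kappa_pos : 0 < κ
  spin : ħ * n = 2 * κ
  coupling : 2 * lam / √(((n : ℝ) + 1) * ħ) = ε
  coupling_pos : 0 < ε
  meanField : IsMeanField ωc ω₃ κ ε δ ζ u v a

/-- The mean field state. -/
noncomputable def meanState (n : ℕ) {ħ : ℝ} (hħ : 0 < ħ) (ωc : ℝ) (ζ u v : ℝ → ℂ) (a : ℝ → ℝ)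
    (t : ℝ) : TotalSpace n :=
  tensor (packet hħ (meanAmp ħ ωc ζ a t) (ζ t)) (spinorPow n (u t) (v t))

/-- The excitation of the mean field state by the fluctuation of the coupling. -/
noncomputable def excitedState (n : ℕ) {ħ : ℝ} (hħ : 0 < ħ) (ωc : ℝ) (ζ u v : ℝ → ℂ) (a : ℝ → ℝ)
    (t : ℝ) : TotalSpace n :=
  tensor (packetOne hħ (meanAmp ħ ωc ζ a t) (ζ t))
    (((u t ^ 2 - v t ^ 2) / 2) • spinorTangent n (u t) (v t))

/-- The residual of the excited state in the Schrödinger equation, divided by `ħ`. -/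
noncomputable def excitedResidual (n : ℕ) {ħ : ℝ} (hħ : 0 < ħ) (ωc ω₃ ε : ℝ) (ζ u v : ℝ → ℂ)
    (a : ℝ → ℝ) (t : ℝ) : TotalSpace n :=
  tensor (packetOne hħ (meanAmp ħ ωc ζ a t) (ζ t))
      ((ω₃ * ((u t ^ 2 + v t ^ 2) / 2) : ℂ) • spinorTangent n (u t) (v t)) -
    (ωc : ℂ) • excitedState n hħ ωc ζ u v a t -
    (ε : ℂ) • tensor (packetTwo hħ (meanAmp ħ ωc ζ a t) (ζ t))
      (((u t ^ 2 - v t ^ 2) / 2) • (spinAct (spinOne n) (spinorTangent n (u t) (v t)) -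
        ((n : ℂ) * spinorMean (u t) (v t)) • spinorTangent n (u t) (v t)))

namespace IsDickeFrame

variable {n : ℕ} {ħ ωc ω₃ lam κ ε δ : ℝ} {ζ u v : ℝ → ℂ} {a : ℝ → ℝ} {t : ℝ}

/-- The term `-i ωc t / 2` is the zero-point phase. Of the scalar `2κ ε m q`, one half comes from
the moving centre in the exponent and the other half from the phase `a`. -/
lemma hasDerivAt_amp (h : IsDickeFrame n ħ ωc ω₃ lam κ ε δ ζ u v a) (hħ : 0 < ħ)
    (ht : t ∈ Set.Ioo (-δ) δ) : ∃ A', HasDerivAt (meanAmp ħ ωc ζ a) A' t ∧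
      Complex.I * ħ * A' = (ωc / 2 * (ħ - ζ t ^ 2) -
        ħ * ε * n * spinorMean (u t) (v t) * (ζ t).re) * meanAmp ħ ωc ζ a t := by
  have hne : (ħ : ℂ) ≠ 0 := Complex.ofReal_ne_zero.2 hħ.ne'
  have hζ := h.meanField.centre t ht
  have hq := hasDerivAt_re hζ
  have ha := (h.meanField.phase t ht).ofReal_comp
  have hid : HasDerivAt (fun s : ℝ => Complex.I * ωc * s / 2) (Complex.I * ωc * 1 / 2) t :=
    ((hasDerivAt_id t).ofReal_comp.const_mul (Complex.I * ωc)).div_const 2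
  have hd := (((((hq.mul hζ).div_const 2).neg.add (ha.const_mul Complex.I)).div_const
    (ħ : ℂ)).sub hid).cexp.const_mul (((Real.pi * ħ) ^ (-(1 / 4 : ℝ)) : ℝ) : ℂ)
  refine ⟨_, hd, ?_⟩
  have hs : (ħ : ℂ) * n = 2 * κ := by exact_mod_cast h.spin
  have hre : ((-Complex.I * (ωc * ζ t + (2 * κ * ε * spinorMean (u t) (v t) : ℝ))).re : ℂ) =
      ωc * (ζ t).im := by
    simp
  rw [hre]
  simp only [Pi.add_apply, Pi.neg_apply, Pi.mul_apply, Pi.sub_apply, meanAmp]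
  generalize Complex.exp _ = X
  generalize (((Real.pi * ħ) ^ (-(1 / 4 : ℝ)) : ℝ) : ℂ) = Y
  have hz := Complex.re_add_im (ζ t)
  have hI := Complex.I_mul_I
  push_cast
  field_simp
  generalize ((ζ t).re : ℂ) = q at *
  generalize ((ζ t).im : ℂ) = p at *
  generalize (spinorMean (u t) (v t) : ℂ) = m at *
  linear_combination Y * X * ((q * (ωc * ζ t + 2 * κ * ε * m) + 2 * q * κ * ε * m - ħ * ωc) * hI -
    ωc * ζ t * hz + 2 * q * ε * m * hs)

lemma I_mul_centre (h : IsDickeFrame n ħ ωc ω₃ lam κ ε δ ζ u v a) :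
    Complex.I * (-Complex.I * (ωc * ζ t + (2 * κ * ε * spinorMean (u t) (v t) : ℝ))) =
      ωc * ζ t + ħ * ε * n * spinorMean (u t) (v t) := by
  have hs : (ħ : ℂ) * n = 2 * κ := by exact_mod_cast h.spin
  have hI := Complex.I_mul_I
  push_cast
  linear_combination -(ωc * ζ t + 2 * κ * ε * spinorMean (u t) (v t)) * hI -
    ε * spinorMean (u t) (v t) * hs

lemma hasDerivAt_spin (h : IsDickeFrame n ħ ωc ω₃ lam κ ε δ ζ u v a)
    (ht : t ∈ Set.Ioo (-δ) δ) : ∃ F', HasDerivAt (fun s => spinorPow n (u s) (v s)) F' t ∧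
      Complex.I • F' = (ω₃ : ℂ) • spinAct (spinThree n) (spinorPow n (u t) (v t)) +
        (ε * (ζ t).re : ℂ) • spinAct (spinOne n) (spinorPow n (u t) (v t)) := by
  refine ⟨_, hasDerivAt_spinorPow n (h.meanField.fst t ht) (h.meanField.snd t ht), ?_⟩
  have hI := Complex.I_mul_I
  simp only [spinOne, spinAct_add_left, spinAct_smul_left, spinAct_spinRaise_spinorPow,
    spinAct_spinLower_spinorPow, spinAct_spinThree_spinorPow]
  push_cast
  linear_combination (norm := module)
    (-(1 / 2) * (ω₃ * u t + ε * (ζ t).re * v t) * hI) • spinorPowFst n (u t) (v t) +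
    (-(1 / 2) * (-ω₃ * v t + ε * (ζ t).re * u t) * hI) • spinorPowSnd n (u t) (v t)

lemma hasDerivAt_inner_meanState (h : IsDickeFrame n ħ ωc ω₃ lam κ ε δ ζ u v a) (hħ : 0 < ħ)
    (ht : t ∈ Set.Ioo (-δ) δ) {Ψ : ℝ → TotalSpace n} {Ψ' : TotalSpace n}
    (hΨ : HasDerivAt Ψ Ψ' t)
    (hgraph : (Ψ t, (Complex.I * (ħ : ℂ)) • Ψ') ∈ dickeGraph n ħ ωc ω₃ lam) :
    HasDerivAt (fun s => ⟪meanState n hħ ωc ζ u v a s, Ψ s⟫_ℂ)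
      (Complex.I * ⟪(-ε : ℂ) • excitedState n hħ ωc ζ u v a t, Ψ t⟫_ℂ) t := by
  obtain ⟨A', hA, hA'⟩ := h.hasDerivAt_amp hħ ht
  obtain ⟨F', hF, hF'⟩ := h.hasDerivAt_spin ht
  obtain ⟨Θ, hpair, hres⟩ := exists_isAdjointPair_packet hħ h.coupling hA' h.I_mul_centre hF'
  refine hasDerivAt_inner_of_residual hħ (hasDerivAt_tensor
    (hasDerivAt_packet hħ hA (h.meanField.centre t ht)) hF) hpair ?_ hΨ hgraph
  rw [hres, spinAct_spinOne_sub_spinorPow (h.meanField.unit t ht), excitedState]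
  module

/-- The excited spin vector obeys the mean field equation up to the commutator of `S₁` with `ω₃ S₃`.
The derivative of the mean cancels the component of that commutator along the coherent state, which
would be of size `n`; only a tangent term survives. -/
lemma hasDerivAt_spinExcited (h : IsDickeFrame n ħ ωc ω₃ lam κ ε δ ζ u v a)
    (ht : t ∈ Set.Ioo (-δ) δ) : ∃ y', HasDerivAt
      (fun s => ((u s ^ 2 - v s ^ 2) / 2) • spinorTangent n (u s) (v s)) y' t ∧
      Complex.I • y' = (ω₃ : ℂ) • spinAct (spinThree n)
          (((u t ^ 2 - v t ^ 2) / 2) • spinorTangent n (u t) (v t)) +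
        (ε * (ζ t).re : ℂ) • spinAct (spinOne n)
          (((u t ^ 2 - v t ^ 2) / 2) • spinorTangent n (u t) (v t)) +
        (ω₃ * ((u t ^ 2 + v t ^ 2) / 2) : ℂ) • spinorTangent n (u t) (v t) := by
  obtain ⟨F', hF, hF'⟩ := h.hasDerivAt_spin ht
  have hm := h.meanField.hasDerivAt_mean ht
  have hS : HasDerivAt (fun s => spinAct (spinOne n) (spinorPow n (u s) (v s)))
      (spinAct (spinOne n) F') t :=
    ((Matrix.toEuclideanLin (spinOne n)).toContinuousLinearMap.restrictScalars
      ℝ).hasFDerivAt.comp_hasDerivAt t hF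
  have hy := hS.sub ((hm.ofReal_comp.const_mul (n : ℂ)).smul hF)
  -- The form `(S₁ - n m)ψ` is easier to differentiate. It agrees with the tangent form only for
  -- unit spinors, hence only for times in the interval.
  have heq : (fun s => ((u s ^ 2 - v s ^ 2) / 2) • spinorTangent n (u s) (v s)) =ᶠ[nhds t]
      ((fun s => spinAct (spinOne n) (spinorPow n (u s) (v s))) -
        fun s => ((n : ℂ) * spinorMean (u s) (v s)) • spinorPow n (u s) (v s)) := by
    filter_upwards [isOpen_Ioo.mem_nhds ht] with s hs
    exact (spinAct_spinOne_sub_spinorPow (h.meanField.unit s hs)).symm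
  refine ⟨_, hy.congr_of_eventuallyEq heq, ?_⟩
  have hunit := h.meanField.unit t ht
  have hcomm := spinAct_commutator_spinorPow (n := n) hunit
  have hSF := congrArg (fun w => spinAct (spinOne n) w) hF'
  simp only [spinAct_add, spinAct_smul] at hSF
  have him : Complex.I * (((starRingEnd ℂ (u t) * v t).im : ℝ) : ℂ) =
      (starRingEnd ℂ (u t) * v t - starRingEnd ℂ (v t) * u t) / 2 := by
    have h1 := Complex.im_eq_sub_conj (starRingEnd ℂ (u t) * v t)
    rw [h1, map_mul, Complex.conj_conj]
    field_simp
  rw [← spinAct_spinOne_sub_spinorPow hunit]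
  simp only [spinAct_sub, spinAct_smul]
  push_cast
  linear_combination (norm := module) hSF - ((n : ℂ) * spinorMean (u t) (v t)) • hF' +
    (ω₃ : ℂ) • hcomm + (n * ω₃ * him) • spinorPow n (u t) (v t)

lemma hasDerivAt_inner_excitedState (h : IsDickeFrame n ħ ωc ω₃ lam κ ε δ ζ u v a) (hħ : 0 < ħ)
    (ht : t ∈ Set.Ioo (-δ) δ) {Ψ : ℝ → TotalSpace n} {Ψ' : TotalSpace n}
    (hΨ : HasDerivAt Ψ Ψ' t)
    (hgraph : (Ψ t, (Complex.I * (ħ : ℂ)) • Ψ') ∈ dickeGraph n ħ ωc ω₃ lam) :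
    HasDerivAt (fun s => ⟪excitedState n hħ ωc ζ u v a s, Ψ s⟫_ℂ)
      (Complex.I * ⟪excitedResidual n hħ ωc ω₃ ε ζ u v a t, Ψ t⟫_ℂ) t := by
  obtain ⟨A', hA, hA'⟩ := h.hasDerivAt_amp hħ ht
  obtain ⟨y', hy, hy'⟩ := h.hasDerivAt_spinExcited ht
  have hq : Complex.I * ((-Complex.I * (ωc * ζ t +
      (2 * κ * ε * spinorMean (u t) (v t) : ℝ))).re : ℂ) = ωc * (ζ t - (ζ t).re) := by
    have hre : ((-Complex.I * (ωc * ζ t + (2 * κ * ε * spinorMean (u t) (v t) : ℝ))).re : ℂ) =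
        ωc * (ζ t).im := by
      simp
    rw [hre]
    linear_combination (ωc : ℂ) * Complex.re_add_im (ζ t)
  obtain ⟨Θ, hpair, hres⟩ := exists_isAdjointPair_packetOne hħ h.coupling hA' h.I_mul_centre hq hy'
  refine hasDerivAt_inner_of_residual hħ (hasDerivAt_tensor
    (hasDerivAt_packetOne hħ hA (h.meanField.centre t ht)) hy) hpair ?_ hΨ hgraph
  have e : spinAct (spinOne n) (((u t ^ 2 - v t ^ 2) / 2) • spinorTangent n (u t) (v t)) -
      ((n : ℂ) * spinorMean (u t) (v t)) • ((u t ^ 2 - v t ^ 2) / 2) •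
        spinorTangent n (u t) (v t) =
      ((u t ^ 2 - v t ^ 2) / 2) • (spinAct (spinOne n) (spinorTangent n (u t) (v t)) -
        ((n : ℂ) * spinorMean (u t) (v t)) • spinorTangent n (u t) (v t)) := by
    rw [spinAct_smul, smul_sub, smul_comm ((n : ℂ) * _)]
  rw [hres, e, excitedResidual, excitedState]

end IsDickeFrame

/-! ### Estimates uniform in `ħ` -/

lemma norm_eq_sqrt_of_inner_self {H : Type*} [NormedAddCommGroup H] [InnerProductSpace ℂ H] {x : H}
    {r : ℝ} (h : ⟪x, x⟫_ℂ = (r : ℂ)) : ‖x‖ = √r := by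
  rw [norm_eq_sqrt_re_inner (𝕜 := ℂ), h]
  simp

lemma norm_sub_le_of_hasDerivAt {E : Type*} [NormedAddCommGroup E] [NormedSpace ℝ E]
    {f f' : ℝ → E} {C t : ℝ} (ht : 0 ≤ t) (hf : ∀ s ∈ Set.Icc 0 t, HasDerivAt f (f' s) s)
    (hb : ∀ s ∈ Set.Icc 0 t, ‖f' s‖ ≤ C) : ‖f t - f 0‖ ≤ C * t := by
  have h := norm_image_sub_le_of_norm_deriv_le_segment' (a := 0) (b := t) (C := C)
    (fun s hs => (hf s hs).hasDerivWithinAt) (fun s hs => hb s (Set.Ico_subset_Icc_self hs)) t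
    ⟨ht, le_rfl⟩
  rwa [sub_zero] at h

/-- A bound for the residual of the excited state. -/
noncomputable def residualBound (ωc ω₃ κ ε : ℝ) : ℝ := (|ω₃| + |ωc|) * √κ / 2 + 3 * ε * κ

/-- A bound for the second order term in the overlap with the excited state. -/
noncomputable def overlapBound (ωc ω₃ κ ε : ℝ) : ℝ :=
  ε * κ * |ω₃| / 2 + residualBound ωc ω₃ κ ε * √(2 * ε * residualBound ωc ω₃ κ ε)

namespace IsDickeFrame

variable {n : ℕ} {ħ ωc ω₃ lam κ ε δ : ℝ} {ζ u v : ℝ → ℂ} {a : ℝ → ℝ} {t : ℝ}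

/-- Position fluctuation times spin fluctuation, independent of `ħ` because `ħ n = 2κ`. -/
lemma sqrt_half_mul_sqrt (h : IsDickeFrame n ħ ωc ω₃ lam κ ε δ ζ u v a) (hħ : 0 < ħ) :
    √(ħ / 2) * √n = √κ := by
  rw [← Real.sqrt_mul (by positivity)]
  congr 1
  linarith [h.spin]

lemma norm_meanState (h : IsDickeFrame n ħ ωc ω₃ lam κ ε δ ζ u v a) (hħ : 0 < ħ)
    (ht : t ∈ Set.Ioo (-δ) δ) : ‖meanState n hħ ωc ζ u v a t‖ = 1 := by
  rw [meanState, norm_tensor, norm_spinorPow (h.meanField.unit t ht),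
    norm_eq_sqrt_of_inner_self (r := 1) (by
      rw [inner_packet_packet hħ (norm_meanAmp hħ ωc ζ a t), Complex.ofReal_one]),
    Real.sqrt_one, one_mul]

lemma norm_excitedState (h : IsDickeFrame n ħ ωc ω₃ lam κ ε δ ζ u v a) (hħ : 0 < ħ)
    (ht : t ∈ Set.Ioo (-δ) δ) :
    ‖excitedState n hħ ωc ζ u v a t‖ = √κ * ‖(u t ^ 2 - v t ^ 2) / 2‖ := by
  rw [excitedState, norm_tensor, norm_smul, norm_spinorTangent (h.meanField.unit t ht),
    norm_eq_sqrt_of_inner_self (inner_packetOne_packetOne hħ (norm_meanAmp hħ ωc ζ a t)),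
    ← h.sqrt_half_mul_sqrt hħ]
  ring

lemma norm_excitedState_le (h : IsDickeFrame n ħ ωc ω₃ lam κ ε δ ζ u v a) (hħ : 0 < ħ)
    (ht : t ∈ Set.Ioo (-δ) δ) : ‖excitedState n hħ ωc ζ u v a t‖ ≤ √κ / 2 := by
  rw [h.norm_excitedState hħ ht]
  have := mul_le_mul_of_nonneg_left (norm_sq_sub_sq_div_two_le (h.meanField.unit t ht))
    (Real.sqrt_nonneg κ)
  linarith

lemma norm_excitedResidual_le (h : IsDickeFrame n ħ ωc ω₃ lam κ ε δ ζ u v a) (hħ : 0 < ħ)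
    (ht : t ∈ Set.Ioo (-δ) δ) :
    ‖excitedResidual n hħ ωc ω₃ ε ζ u v a t‖ ≤ residualBound ωc ω₃ κ ε := by
  have hU := h.meanField.unit t ht
  have hA := norm_meanAmp hħ ωc ζ a t
  have hκ := Real.sqrt_nonneg κ
  refine (norm_sub_le _ _).trans (add_le_add ((norm_sub_le _ _).trans ?_) ?_)
  · have h1 : ‖tensor (packetOne hħ (meanAmp ħ ωc ζ a t) (ζ t))
        ((ω₃ * ((u t ^ 2 + v t ^ 2) / 2) : ℂ) • spinorTangent n (u t) (v t))‖ ≤ |ω₃| * √κ / 2 := by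
      rw [norm_tensor, norm_smul, norm_spinorTangent hU, norm_mul, Complex.norm_real,
        Real.norm_eq_abs, norm_eq_sqrt_of_inner_self (inner_packetOne_packetOne hħ hA)]
      calc _ = |ω₃| * (√(ħ / 2) * √n) * ‖(u t ^ 2 + v t ^ 2) / 2‖ := by ring
        _ ≤ |ω₃| * (√(ħ / 2) * √n) * (1 / 2) :=
          mul_le_mul_of_nonneg_left (norm_sq_add_sq_div_two_le hU) (by positivity)
        _ = _ := by rw [h.sqrt_half_mul_sqrt hħ]; ring
    have h2 : ‖(ωc : ℂ) • excitedState n hħ ωc ζ u v a t‖ ≤ |ωc| * (√κ / 2) := by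
      rw [norm_smul, Complex.norm_real, Real.norm_eq_abs]
      exact mul_le_mul_of_nonneg_left (h.norm_excitedState_le hħ ht) (abs_nonneg _)
    linarith
  · have h3 : √(3 * ħ ^ 2 / 4) ≤ ħ := Real.sqrt_le_iff.2 ⟨hħ.le, by nlinarith [sq_nonneg ħ]⟩
    have hε := h.coupling_pos
    rw [norm_smul, norm_tensor, norm_smul, Complex.norm_real, Real.norm_of_nonneg hε.le,
      norm_eq_sqrt_of_inner_self (inner_packetTwo_packetTwo hħ hA)]
    have h4 := mul_le_mul (norm_sq_sub_sq_div_two_le hU)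
      (norm_spinAct_spinOne_sub_spinorTangent_le (n := n) hU) (norm_nonneg _) (by norm_num)
    have h5 := mul_le_mul_of_nonneg_left (mul_le_mul h3 h4 (by positivity) hħ.le) hε.le
    refine h5.trans (le_of_eq ?_)
    linear_combination (3 / 2 * ε) * h.spin

lemma inner_excitedState_meanState (hħ : 0 < ħ) :
    ⟪excitedState n hħ ωc ζ u v a t, meanState n hħ ωc ζ u v a t⟫_ℂ = 0 := by
  rw [excitedState, meanState, inner_tensor, inner_packetOne_packet, zero_mul]

/-- Only the term with `(x - q)²` is not orthogonal to the packet. It gives `ħ/2`, and `S₁ - n m`,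
moved to the other side, gives `n` times the normalized variance. -/
lemma inner_excitedResidual_meanState (h : IsDickeFrame n ħ ωc ω₃ lam κ ε δ ζ u v a) (hħ : 0 < ħ)
    (ht : t ∈ Set.Ioo (-δ) δ) :
    ⟪excitedResidual n hħ ωc ω₃ ε ζ u v a t, meanState n hħ ωc ζ u v a t⟫_ℂ =
      ((-(ε * κ * (1 / 4 - spinorMean (u t) (v t) ^ 2)) : ℝ) : ℂ) := by
  have hU := h.meanField.unit t ht
  have hA := norm_meanAmp hħ ωc ζ a t
  have h1 : ⟪spinAct (spinOne n) (spinorTangent n (u t) (v t)) -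
      ((n : ℂ) * spinorMean (u t) (v t)) • spinorTangent n (u t) (v t),
      spinorPow n (u t) (v t)⟫_ℂ = ((u t ^ 2 - v t ^ 2) / 2) * n := by
    rw [inner_sub_left, inner_spinAct_left, conjTranspose_spinOne, inner_smul_left, map_mul,
      Complex.conj_ofReal, Complex.conj_natCast, ← inner_smul_right, ← inner_sub_right,
      spinAct_spinOne_sub_spinorPow hU, inner_smul_right, inner_spinorTangent_self hU]
  rw [excitedResidual, inner_sub_left, inner_sub_left, inner_smul_left, inner_smul_left,
    inner_excitedState_meanState, meanState, inner_tensor, inner_tensor, inner_packetOne_packet,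
    inner_packetTwo_packet hħ hA, inner_smul_left, inner_smul_left, h1,
    ← mul_assoc (starRingEnd ℂ (_ / 2)),
    Complex.conj_mul', Complex.conj_ofReal ε, ← conj_mul_norm_sq_sub_sq_div_two hU]
  have hs : (ħ : ℂ) * n = 2 * κ := by exact_mod_cast h.spin
  push_cast
  linear_combination (-ε * (‖(u t ^ 2 - v t ^ 2) / 2‖ : ℂ) ^ 2 / 2) * hs

/-- Only the precession about the third axis changes the mean of `S₁`, at a rate of at most `|ω₃| /
2`. -/
lemma abs_mean_sq_sub_le (h : IsDickeFrame n ħ ωc ω₃ lam κ ε δ ζ u v a) (ht : 0 ≤ t)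
    (htδ : t < δ) :
    |spinorMean (u t) (v t) ^ 2 - spinorMean (u 0) (v 0) ^ 2| ≤ |ω₃| / 2 * t := by
  have hI : ∀ s ∈ Set.Icc 0 t, s ∈ Set.Ioo (-δ) δ := fun s hs =>
    ⟨by linarith [hs.1], by linarith [hs.2]⟩
  have h1 := norm_sub_le_of_hasDerivAt (C := |ω₃| / 2) ht
    (fun s hs => h.meanField.hasDerivAt_mean (hI s hs)) (fun s hs => by
      have hn := norm_sq_add_norm_sq_of_unit (h.meanField.unit s (hI s hs))
      have h2 := Complex.abs_im_le_norm (starRingEnd ℂ (u s) * v s)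
      rw [norm_mul, RCLike.norm_conj] at h2
      rw [Real.norm_eq_abs, abs_mul, abs_neg, div_eq_mul_inv]
      refine mul_le_mul_of_nonneg_left ?_ (abs_nonneg _)
      nlinarith [sq_nonneg (‖u s‖ - ‖v s‖)])
  have h2 := abs_spinorMean_le (h.meanField.unit t (hI t ⟨ht, le_rfl⟩))
  have h3 := abs_spinorMean_le (h.meanField.unit 0 (hI 0 ⟨le_rfl, ht⟩))
  rw [Real.norm_eq_abs] at h1
  have h4 : |spinorMean (u t) (v t) + spinorMean (u 0) (v 0)| ≤ 1 :=
    (abs_add_le _ _).trans (by linarith)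
  rw [sq_sub_sq, abs_mul]
  calc _ ≤ 1 * |spinorMean (u t) (v t) - spinorMean (u 0) (v 0)| :=
        mul_le_mul_of_nonneg_right h4 (abs_nonneg _)
    _ ≤ _ := by linarith

/-! ### Overlaps of the solution with the mean field and excited states -/

section evolution

variable {Ψ : ℝ → TotalSpace n}

/-- The overlap vanishes at time `0`, because the first excitation is orthogonal to the packet, and
its derivative is bounded by the residual. -/
lemma norm_inner_excitedState_le (h : IsDickeFrame n ħ ωc ω₃ lam κ ε δ ζ u v a) (hħ : 0 < ħ)
    (hΨ : ∀ t, ∃ Ψ' : TotalSpace n, HasDerivAt Ψ Ψ' t ∧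
      (Ψ t, (Complex.I * (ħ : ℂ)) • Ψ') ∈ dickeGraph n ħ ωc ω₃ lam)
    (h0 : Ψ 0 = meanState n hħ ωc ζ u v a 0) (h1 : ∀ t, ‖Ψ t‖ = 1) (ht : 0 ≤ t) (htδ : t < δ) :
    ‖⟪excitedState n hħ ωc ζ u v a t, Ψ t⟫_ℂ‖ ≤ residualBound ωc ω₃ κ ε * t := by
  have hI : ∀ s ∈ Set.Icc 0 t, s ∈ Set.Ioo (-δ) δ := fun s hs =>
    ⟨by linarith [hs.1], by linarith [hs.2]⟩
  have h2 := norm_sub_le_of_hasDerivAt (C := residualBound ωc ω₃ κ ε) ht (fun s hs => by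
    obtain ⟨Ψ', hd, hg⟩ := hΨ s
    exact h.hasDerivAt_inner_excitedState hħ (hI s hs) hd hg) (fun s hs => by
      rw [norm_mul, Complex.norm_I, one_mul]
      refine (norm_inner_le_norm _ _).trans ?_
      rw [h1, mul_one]
      exact h.norm_excitedResidual_le hħ (hI s hs))
  rwa [h0, inner_excitedState_meanState, sub_zero] at h2

/-- The derivative is `ε` times the overlap with the excited state, already `O(t)`; integrating
gains a second power of `t`. -/
lemma norm_inner_meanState_sub_one_le (h : IsDickeFrame n ħ ωc ω₃ lam κ ε δ ζ u v a) (hħ : 0 < ħ)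
    (hΨ : ∀ t, ∃ Ψ' : TotalSpace n, HasDerivAt Ψ Ψ' t ∧
      (Ψ t, (Complex.I * (ħ : ℂ)) • Ψ') ∈ dickeGraph n ħ ωc ω₃ lam)
    (h0 : Ψ 0 = meanState n hħ ωc ζ u v a 0) (h1 : ∀ t, ‖Ψ t‖ = 1) (ht : 0 ≤ t) (htδ : t < δ) :
    ‖⟪meanState n hħ ωc ζ u v a t, Ψ t⟫_ℂ - 1‖ ≤ ε * residualBound ωc ω₃ κ ε * t ^ 2 := by
  have hI : ∀ s ∈ Set.Icc 0 t, s ∈ Set.Ioo (-δ) δ := fun s hs =>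
    ⟨by linarith [hs.1], by linarith [hs.2]⟩
  have hR : 0 ≤ residualBound ωc ω₃ κ ε :=
    (norm_nonneg _).trans (h.norm_excitedResidual_le hħ (hI 0 ⟨le_rfl, ht⟩))
  have hε := h.coupling_pos
  have h2 := norm_sub_le_of_hasDerivAt (C := ε * (residualBound ωc ω₃ κ ε * t)) ht (fun s hs => by
    obtain ⟨Ψ', hd, hg⟩ := hΨ s
    exact h.hasDerivAt_inner_meanState hħ (hI s hs) hd hg) (fun s hs => by
      rw [norm_mul, Complex.norm_I, one_mul, inner_smul_left, norm_mul, RCLike.norm_conj, norm_neg,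
        Complex.norm_real, Real.norm_of_nonneg hε.le]
      refine mul_le_mul_of_nonneg_left ?_ hε.le
      exact (h.norm_inner_excitedState_le hħ hΨ h0 h1 hs.1 (by linarith [hs.2])).trans
        (mul_le_mul_of_nonneg_left hs.2 hR))
  rw [h0, inner_self_eq_norm_sq_to_K, h.norm_meanState hħ (hI 0 ⟨le_rfl, ht⟩)] at h2
  refine le_of_eq_of_le (by simp) (h2.trans (le_of_eq (by ring)))

lemma norm_sub_meanState_sq_le (h : IsDickeFrame n ħ ωc ω₃ lam κ ε δ ζ u v a) (hħ : 0 < ħ)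
    (hΨ : ∀ t, ∃ Ψ' : TotalSpace n, HasDerivAt Ψ Ψ' t ∧
      (Ψ t, (Complex.I * (ħ : ℂ)) • Ψ') ∈ dickeGraph n ħ ωc ω₃ lam)
    (h0 : Ψ 0 = meanState n hħ ωc ζ u v a 0) (h1 : ∀ t, ‖Ψ t‖ = 1) (ht : 0 ≤ t) (htδ : t < δ) :
    ‖Ψ t - meanState n hħ ωc ζ u v a t‖ ^ 2 ≤ 2 * ε * residualBound ωc ω₃ κ ε * t ^ 2 := by
  have h2 := h.norm_inner_meanState_sub_one_le hħ hΨ h0 h1 ht htδ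
  have h3 := (abs_le.1 ((Complex.abs_re_le_norm _).trans h2)).1
  rw [Complex.sub_re, Complex.one_re] at h3
  rw [norm_sub_sq (𝕜 := ℂ), h1, h.norm_meanState hħ ⟨by linarith, htδ⟩, ← inner_conj_symm,
    RCLike.conj_re, RCLike.re_eq_complex_re]
  linarith

/-- The derivative of the overlap is compared with its value `-i d` at time `0`. The deviation is
`O(t)`: one part is the drift of the mean, the other the distance of `Ψ` from the mean field state.
-/
lemma le_norm_inner_excitedState (h : IsDickeFrame n ħ ωc ω₃ lam κ ε δ ζ u v a) (hħ : 0 < ħ)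
    (hΨ : ∀ t, ∃ Ψ' : TotalSpace n, HasDerivAt Ψ Ψ' t ∧
      (Ψ t, (Complex.I * (ħ : ℂ)) • Ψ') ∈ dickeGraph n ħ ωc ω₃ lam)
    (h0 : Ψ 0 = meanState n hħ ωc ζ u v a 0) (h1 : ∀ t, ‖Ψ t‖ = 1) (ht : 0 ≤ t) (htδ : t < δ) :
    ε * κ * (1 / 4 - spinorMean (u 0) (v 0) ^ 2) * t - overlapBound ωc ω₃ κ ε * t ^ 2 ≤
      ‖⟪excitedState n hħ ωc ζ u v a t, Ψ t⟫_ℂ‖ := by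
  have hI : ∀ s ∈ Set.Icc 0 t, s ∈ Set.Ioo (-δ) δ := fun s hs =>
    ⟨by linarith [hs.1], by linarith [hs.2]⟩
  have hR : 0 ≤ residualBound ωc ω₃ κ ε :=
    (norm_nonneg _).trans (h.norm_excitedResidual_le hħ (hI 0 ⟨le_rfl, ht⟩))
  have hε := h.coupling_pos
  have hκ := h.kappa_pos
  set R := residualBound ωc ω₃ κ ε with hRdef
  set d : ℝ := ε * κ * (1 / 4 - spinorMean (u 0) (v 0) ^ 2) with hd
  have hlin : ∀ s : ℝ, HasDerivAt (fun s : ℝ => Complex.I * ((-d : ℝ) : ℂ) * (s : ℂ))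
      (Complex.I * ((-d : ℝ) : ℂ)) s := fun s =>
    ((hasDerivAt_id s).ofReal_comp.const_mul (Complex.I * ((-d : ℝ) : ℂ))).congr_deriv (by simp)
  have h2 := norm_sub_le_of_hasDerivAt (C := overlapBound ωc ω₃ κ ε * t) ht (fun s hs => by
    obtain ⟨Ψ', hd, hg⟩ := hΨ s
    exact (h.hasDerivAt_inner_excitedState hħ (hI s hs) hd hg).sub (hlin s)) (fun s hs => by
      have hst : s < δ := by linarith [hs.2]
      have e : Complex.I * ⟪excitedResidual n hħ ωc ω₃ ε ζ u v a s, Ψ s⟫_ℂ -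
          Complex.I * ((-d : ℝ) : ℂ) = Complex.I * (((ε * κ * (spinorMean (u s) (v s) ^ 2 -
            spinorMean (u 0) (v 0) ^ 2) : ℝ) : ℂ) + ⟪excitedResidual n hħ ωc ω₃ ε ζ u v a s,
              Ψ s - meanState n hħ ωc ζ u v a s⟫_ℂ) := by
        rw [inner_sub_right, h.inner_excitedResidual_meanState hħ (hI s hs), hd]
        push_cast
        ring
      rw [e, norm_mul, Complex.norm_I, one_mul]
      have h3 := h.abs_mean_sq_sub_le hs.1 hst
      have h4 := h.norm_sub_meanState_sq_le hħ hΨ h0 h1 hs.1 hst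
      have h5 : ‖Ψ s - meanState n hħ ωc ζ u v a s‖ ≤ √(2 * ε * R) * s := by
        refine (abs_le_of_sq_le_sq' ?_ (mul_nonneg (Real.sqrt_nonneg _) hs.1)).2
        rwa [mul_pow, Real.sq_sqrt (by positivity)]
      have h6 := (norm_inner_le_norm (𝕜 := ℂ) (excitedResidual n hħ ωc ω₃ ε ζ u v a s)
        (Ψ s - meanState n hħ ωc ζ u v a s)).trans
        (mul_le_mul (h.norm_excitedResidual_le hħ (hI s hs)) h5 (norm_nonneg _) hR)
      refine (norm_add_le _ _).trans ((add_le_add ?_ h6).trans (b := ε * κ * (|ω₃| / 2 * s) +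
        R * (√(2 * ε * R) * s)) ?_)
      · rw [Complex.norm_real, Real.norm_eq_abs, abs_mul, abs_of_pos (mul_pos hε hκ)]
        exact mul_le_mul_of_nonneg_left h3 (by positivity)
      · calc _ = overlapBound ωc ω₃ κ ε * s := by rw [overlapBound, ← hRdef]; ring
          _ ≤ _ := mul_le_mul_of_nonneg_left hs.2 (by rw [overlapBound, ← hRdef]; positivity))
  simp only [Pi.sub_apply] at h2
  rw [h0, inner_excitedState_meanState, Complex.ofReal_zero, mul_zero, sub_zero, sub_zero] at h2
  have h3 : d * t ≤ ‖Complex.I * ((-d : ℝ) : ℂ) * (t : ℂ)‖ := by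
    rw [norm_mul, norm_mul, Complex.norm_I, Complex.norm_real, Complex.norm_real, one_mul,
      Real.norm_of_nonneg ht, norm_neg]
    exact mul_le_mul_of_nonneg_right (le_abs_self d) ht
  have h4 := norm_sub_norm_le (Complex.I * ((-d : ℝ) : ℂ) * (t : ℂ))
    ⟪excitedState n hħ ωc ζ u v a t, Ψ t⟫_ℂ
  rw [norm_sub_rev] at h4
  linarith

/-- The diagonal product is at least `1/2` times the amplitude of the double excitation. The two
off-diagonal vectors are orthogonal to the mean field state, so each of their amplitudes is at most
`‖Ψ - Φ‖` and their product is `O(t²)`. -/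
lemma le_norm_minor (h : IsDickeFrame n ħ ωc ω₃ lam κ ε δ ζ u v a) (hħ : 0 < ħ)
    (hΨ : ∀ t, ∃ Ψ' : TotalSpace n, HasDerivAt Ψ Ψ' t ∧
      (Ψ t, (Complex.I * (ħ : ℂ)) • Ψ') ∈ dickeGraph n ħ ωc ω₃ lam)
    (h0 : Ψ 0 = meanState n hħ ωc ζ u v a 0) (h1 : ∀ t, ‖Ψ t‖ = 1) (ht : 0 ≤ t) (htδ : t < δ)
    (hsmall : ε * residualBound ωc ω₃ κ ε * t ^ 2 ≤ 1 / 2) {f₀ f₁ : OrbitalSpace}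
    {v₀ v₁ : SpinSpace n} (hf₀ : f₀ = packet hħ (meanAmp ħ ωc ζ a t) (ζ t))
    (hf₁ : f₁ = ((√(ħ / 2))⁻¹ : ℂ) • packetOne hħ (meanAmp ħ ωc ζ a t) (ζ t))
    (hv₀ : v₀ = spinorPow n (u t) (v t)) (hv₁ : v₁ = ((√n)⁻¹ : ℂ) • spinorTangent n (u t) (v t))
    (hnf : ‖f₁‖ = 1) (hnv : ‖v₁‖ = 1) :
    ε * √κ * (1 / 4 - spinorMean (u 0) (v 0) ^ 2) * t -
        (overlapBound ωc ω₃ κ ε / √κ + 2 * ε * residualBound ωc ω₃ κ ε) * t ^ 2 ≤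
      ‖⟪tensor f₀ v₀, Ψ t⟫_ℂ * ⟪tensor f₁ v₁, Ψ t⟫_ℂ -
        ⟪tensor f₁ v₀, Ψ t⟫_ℂ * ⟪tensor f₀ v₁, Ψ t⟫_ℂ‖ := by
  have htI : t ∈ Set.Ioo (-δ) δ := ⟨by linarith, htδ⟩
  have hU := h.meanField.unit t htI
  have hκ : 0 < √κ := Real.sqrt_pos.2 h.kappa_pos
  have hn : (0 : ℝ) < n := Nat.cast_pos.2 h.n_pos
  have hn0 : ((√n : ℝ) : ℂ) ≠ 0 := Complex.ofReal_ne_zero.2 (Real.sqrt_pos.2 hn).ne'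
  have hħ0 : ((√(ħ / 2) : ℝ) : ℂ) ≠ 0 :=
    Complex.ofReal_ne_zero.2 (Real.sqrt_pos.2 (by positivity)).ne'
  set R := residualBound ωc ω₃ κ ε
  have hmean : tensor f₀ v₀ = meanState n hħ ωc ζ u v a t := by rw [hf₀, hv₀, meanState]
  have hsub := h.norm_sub_meanState_sq_le hħ hΨ h0 h1 ht htδ
  have hp : ‖packet hħ (meanAmp ħ ωc ζ a t) (ζ t)‖ = 1 := by
    rw [norm_eq_sqrt_of_inner_self (r := 1) (by
      rw [inner_packet_packet hħ (norm_meanAmp hħ ωc ζ a t), Complex.ofReal_one]), Real.sqrt_one]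
  have h00 : 1 / 2 ≤ ‖⟪tensor f₀ v₀, Ψ t⟫_ℂ‖ := by
    rw [hmean]
    have h2 := h.norm_inner_meanState_sub_one_le hħ hΨ h0 h1 ht htδ
    have h3 := norm_sub_norm_le (1 : ℂ) ⟪meanState n hħ ωc ζ u v a t, Ψ t⟫_ℂ
    rw [norm_sub_rev, norm_one] at h3
    linarith
  have h10 : ‖⟪tensor f₁ v₀, Ψ t⟫_ℂ‖ ≤ ‖Ψ t - meanState n hħ ωc ζ u v a t‖ := by
    have e : ⟪tensor f₁ v₀, Ψ t⟫_ℂ = ⟪tensor f₁ v₀, Ψ t - meanState n hħ ωc ζ u v a t⟫_ℂ := by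
      rw [inner_sub_right, meanState, inner_tensor, hf₁, inner_smul_left, inner_packetOne_packet]
      ring
    rw [e]
    refine (norm_inner_le_norm _ _).trans (le_of_eq ?_)
    rw [norm_tensor, hnf, hv₀, norm_spinorPow hU, one_mul, one_mul]
  have h01 : ‖⟪tensor f₀ v₁, Ψ t⟫_ℂ‖ ≤ ‖Ψ t - meanState n hħ ωc ζ u v a t‖ := by
    have e : ⟪tensor f₀ v₁, Ψ t⟫_ℂ = ⟪tensor f₀ v₁, Ψ t - meanState n hħ ωc ζ u v a t⟫_ℂ := by
      rw [inner_sub_right, meanState, inner_tensor, hv₁, inner_smul_left,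
        ← inner_conj_symm (spinorTangent n (u t) (v t)), inner_spinorPow_spinorTangent hU, map_zero]
      ring
    rw [e]
    refine (norm_inner_le_norm _ _).trans (le_of_eq ?_)
    rw [norm_tensor, hnv, hf₀, hp, one_mul, one_mul]
  have h11 : ‖⟪excitedState n hħ ωc ζ u v a t, Ψ t⟫_ℂ‖ ≤
      √κ / 2 * ‖⟪tensor f₁ v₁, Ψ t⟫_ℂ‖ := by
    have e : excitedState n hħ ωc ζ u v a t =
        (((u t ^ 2 - v t ^ 2) / 2) * (√κ : ℝ)) • tensor f₁ v₁ := by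
      rw [excitedState, hf₁, hv₁, tensor_smul_left, tensor_smul, tensor_smul, smul_smul, smul_smul,
        ← h.sqrt_half_mul_sqrt hħ]
      congr 1
      push_cast
      field_simp
    rw [e, inner_smul_left, norm_mul, RCLike.norm_conj, norm_mul, Complex.norm_real,
      Real.norm_of_nonneg hκ.le]
    refine mul_le_mul_of_nonneg_right ?_ (norm_nonneg _)
    linarith [mul_le_mul_of_nonneg_right (norm_sq_sub_sq_div_two_le hU) hκ.le]
  have hlow := (h.le_norm_inner_excitedState hħ hΨ h0 h1 ht htδ).trans h11
  have h2 : ε * √κ * (1 / 4 - spinorMean (u 0) (v 0) ^ 2) * t -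
      overlapBound ωc ω₃ κ ε / √κ * t ^ 2 ≤ 1 / 2 * ‖⟪tensor f₁ v₁, Ψ t⟫_ℂ‖ := by
    refine le_of_mul_le_mul_left (le_of_eq_of_le ?_ (hlow.trans (le_of_eq (by ring)))) hκ
    have hs := Real.mul_self_sqrt h.kappa_pos.le
    field_simp
    linear_combination (t * ε * (1 / 4 - spinorMean (u 0) (v 0) ^ 2) * 4) * hs
  have h3 := mul_le_mul_of_nonneg_right h00 (norm_nonneg ⟪tensor f₁ v₁, Ψ t⟫_ℂ)
  have h4 := mul_le_mul h10 h01 (norm_nonneg _) (norm_nonneg _)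
  have h5 := norm_sub_norm_le (⟪tensor f₀ v₀, Ψ t⟫_ℂ * ⟪tensor f₁ v₁, Ψ t⟫_ℂ)
    (⟪tensor f₁ v₀, Ψ t⟫_ℂ * ⟪tensor f₀ v₁, Ψ t⟫_ℂ)
  rw [norm_mul, norm_mul] at h5
  linarith [sq ‖Ψ t - meanState n hħ ωc ζ u v a t‖]

/-- The purity of the orbital state decays quadratically at short times. -/
lemma orbitalPurity_le (h : IsDickeFrame n ħ ωc ω₃ lam κ ε δ ζ u v a) (hħ : 0 < ħ)
    (hΨ : ∀ t, ∃ Ψ' : TotalSpace n, HasDerivAt Ψ Ψ' t ∧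
      (Ψ t, (Complex.I * (ħ : ℂ)) • Ψ') ∈ dickeGraph n ħ ωc ω₃ lam)
    (h0 : Ψ 0 = meanState n hħ ωc ζ u v a 0) (h1 : ∀ t, ‖Ψ t‖ = 1) (ht : 0 ≤ t) (htδ : t < δ)
    (hsmall : ε * residualBound ωc ω₃ κ ε * t ^ 2 ≤ 1 / 2) {b : ℝ} (hb : 0 ≤ b)
    (hbound : b + (overlapBound ωc ω₃ κ ε / √κ + 2 * ε * residualBound ωc ω₃ κ ε) * t ≤
      ε * √κ * (1 / 4 - spinorMean (u 0) (v 0) ^ 2)) :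
    orbitalPurity n (Ψ t) ≤ 1 - 2 * (b * t) ^ 2 := by
  have hU := h.meanField.unit t ⟨by linarith, htδ⟩
  have hA := norm_meanAmp hħ ωc ζ a t
  have hn : (0 : ℝ) < n := Nat.cast_pos.2 h.n_pos
  have hn0 : ((√n : ℝ) : ℂ) ≠ 0 := Complex.ofReal_ne_zero.2 (Real.sqrt_pos.2 hn).ne'
  have hħ0 : ((√(ħ / 2) : ℝ) : ℂ) ≠ 0 :=
    Complex.ofReal_ne_zero.2 (Real.sqrt_pos.2 (by positivity)).ne'
  have hf₁ : ⟪((√(ħ / 2))⁻¹ : ℂ) • packetOne hħ (meanAmp ħ ωc ζ a t) (ζ t),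
      ((√(ħ / 2))⁻¹ : ℂ) • packetOne hħ (meanAmp ħ ωc ζ a t) (ζ t)⟫_ℂ = 1 := by
    have hs : ((√(ħ / 2) : ℝ) : ℂ) * (√(ħ / 2) : ℝ) = (ħ / 2 : ℝ) := by
      exact_mod_cast Real.mul_self_sqrt (by positivity : 0 ≤ ħ / 2)
    rw [inner_smul_left, inner_smul_right, inner_packetOne_packetOne hħ hA, map_inv₀,
      Complex.conj_ofReal, ← hs]
    field_simp
  have hv₁ : ⟪((√n)⁻¹ : ℂ) • spinorTangent n (u t) (v t),
      ((√n)⁻¹ : ℂ) • spinorTangent n (u t) (v t)⟫_ℂ = 1 := by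
    have hs : ((√n : ℝ) : ℂ) * (√n : ℝ) = n := by
      exact_mod_cast Real.mul_self_sqrt hn.le
    rw [inner_smul_left, inner_smul_right, inner_spinorTangent_self hU, map_inv₀,
      Complex.conj_ofReal, ← hs]
    field_simp
  have hm := h.le_norm_minor hħ hΨ h0 h1 ht htδ hsmall rfl rfl rfl rfl
    (by rw [norm_eq_sqrt_of_inner_self (r := 1) (by rw [hf₁, Complex.ofReal_one]), Real.sqrt_one])
    (by rw [norm_eq_sqrt_of_inner_self (r := 1) (by rw [hv₁, Complex.ofReal_one]), Real.sqrt_one])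
  have hp := _root_.orbitalPurity_le h.n_pos (h1 t) (inner_packet_packet hħ hA) hf₁ (by
      rw [inner_smul_right, ← inner_conj_symm, inner_packetOne_packet, map_zero, mul_zero])
    (v₀ := spinorPow n (u t) (v t)) (by rw [inner_spinorPow_self, hU, one_pow]) hv₁ (by
      rw [inner_smul_right, inner_spinorPow_spinorTangent hU, mul_zero])
  have h2 : b * t ≤ ε * √κ * (1 / 4 - spinorMean (u 0) (v 0) ^ 2) * t -
        (overlapBound ωc ω₃ κ ε / √κ + 2 * ε * residualBound ωc ω₃ κ ε) * t ^ 2 := by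
    linarith [mul_le_mul_of_nonneg_right hbound ht]
  have h3 := pow_le_pow_left₀ (mul_nonneg hb ht) (h2.trans hm) 2
  linarith

end evolution

end IsDickeFrame

/-! ### Initial data and choice of the constants -/

lemma residualBound_mono {ωc ω₃ κ ε ε' : ℝ} (hκ : 0 < κ) (h : ε ≤ ε') :
    residualBound ωc ω₃ κ ε ≤ residualBound ωc ω₃ κ ε' := by
  unfold residualBound
  gcongr

lemma residualBound_nonneg {ωc ω₃ κ ε : ℝ} (hκ : 0 < κ) (h : 0 ≤ ε) :
    0 ≤ residualBound ωc ω₃ κ ε := by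
  unfold residualBound
  positivity

lemma overlapBound_mono {ωc ω₃ κ ε ε' : ℝ} (hκ : 0 < κ) (h0 : 0 ≤ ε) (h : ε ≤ ε') :
    overlapBound ωc ω₃ κ ε ≤ overlapBound ωc ω₃ κ ε' := by
  have h1 := residualBound_mono (ωc := ωc) (ω₃ := ω₃) hκ h
  have h2 := residualBound_nonneg (ωc := ωc) (ω₃ := ω₃) hκ h0
  have h3 := h2.trans h1
  have h4 := h0.trans h
  unfold overlapBound
  gcongr

lemma meanState_zero_of_coherent {n : ℕ} {ħ : ℝ} (hħ : 0 < ħ) (ωc q p θ φ : ℝ) {ζ u v : ℝ → ℂ}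
    {a : ℝ → ℝ} (hζ : ζ 0 = q + p * Complex.I)
    (hu : u 0 = -(Complex.exp (-(Complex.I * φ)) * Real.sin (θ / 2)))
    (hv : v 0 = Real.cos (θ / 2)) (ha : a 0 = 0) {Ψ : TotalSpace n}
    (hΨ : Ψ =ᵐ[volume] (fun x => orbitalCoherent ħ q p x • spinCoherent n θ φ)) :
    Ψ = meanState n hħ ωc ζ u v a 0 := by
  have hne : (ħ : ℂ) ≠ 0 := Complex.ofReal_ne_zero.2 hħ.ne'
  refine Lp.ext ?_
  filter_upwards [hΨ, coeFn_tensor (packet hħ (meanAmp ħ ωc ζ a 0) (ζ 0)) (spinorPow n (u 0) (v 0)),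
    coeFn_packet hħ (meanAmp ħ ωc ζ a 0) (ζ 0)] with x h1 h2 h3
  rw [h1, meanState, h2, h3, hu, hv, spinCoherent_eq_spinorPow]
  congr 1
  rw [orbitalCoherent, meanAmp, ha, hζ, gaussFun, pow_zero, pow_zero, mul_one, one_mul, mul_assoc,
    mul_assoc, Complex.ofReal_exp, ← Complex.exp_add, ← Complex.exp_add]
  congr 2
  simp only [Complex.add_re, Complex.ofReal_re, Complex.re_ofReal_mul, Complex.I_re, mul_zero,
    add_zero]
  have hI := Complex.I_mul_I
  push_cast
  field_simp
  ring

lemma one_sub_half_le_rpow {x : ℝ} (hx : 0 ≤ x) : 1 - x / 2 ≤ (1 + x) ^ (-(1 / 2 : ℝ)) := by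
  rw [Real.rpow_neg (by linarith), ← Real.sqrt_eq_rpow]
  have h1 : √(1 + x) ≤ 1 + x / 2 := Real.sqrt_le_iff.2 ⟨by linarith, by nlinarith [sq_nonneg x]⟩
  have h2 : 0 < √(1 + x) := Real.sqrt_pos.2 (by linarith)
  refine le_trans ?_ (inv_anti₀ h2 h1)
  rw [← one_div, le_div_iff₀ (by linarith)]
  nlinarith [sq_nonneg x]

/-- The sign is negative because `θ = 0` is the lowest state. The quantity `1/4 - m²` becomes `(1 -
(sin θ cos φ)²) / 4`. -/
lemma spinorMean_coherent (θ φ : ℝ) :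
    spinorMean (-(Complex.exp (-(Complex.I * φ)) * Real.sin (θ / 2))) (Real.cos (θ / 2)) =
      -(Real.sin θ * Real.cos φ) / 2 := by
  have h1 : Real.sin θ = 2 * Real.sin (θ / 2) * Real.cos (θ / 2) := by
    rw [← Real.sin_two_mul]; ring_nf
  have h2 : starRingEnd ℂ (Complex.exp (-(Complex.I * φ))) =
      Real.cos φ + Real.sin φ * Complex.I := by
    rw [← Complex.exp_conj, map_neg, map_mul, Complex.conj_I, Complex.conj_ofReal, neg_mul, neg_neg,
      mul_comm, Complex.exp_mul_I, Complex.ofReal_cos, Complex.ofReal_sin]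
  rw [spinorMean, map_neg, map_mul, h2, Complex.conj_ofReal, h1]
  simp only [Complex.neg_re, neg_mul, mul_assoc, Complex.add_re,
    Complex.ofReal_re, Complex.mul_re, Complex.mul_im, Complex.I_re, Complex.I_im,
    Complex.ofReal_im, Complex.add_im]
  ring

lemma unit_coherent (θ φ : ℝ) :
    starRingEnd ℂ (-(Complex.exp (-(Complex.I * φ)) * Real.sin (θ / 2))) *
        -(Complex.exp (-(Complex.I * φ)) * Real.sin (θ / 2)) +
      starRingEnd ℂ (Real.cos (θ / 2) : ℂ) * (Real.cos (θ / 2) : ℂ) = 1 := by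
  have h1 : ‖Complex.exp (-(Complex.I * φ))‖ = 1 := by
    rw [show -(Complex.I * φ) = ((-φ : ℝ) : ℂ) * Complex.I by push_cast; ring,
      Complex.norm_exp_ofReal_mul_I]
  rw [Complex.conj_mul', Complex.conj_mul', norm_neg, norm_mul, h1, one_mul, Complex.norm_real,
    Complex.norm_real, Real.norm_eq_abs, Real.norm_eq_abs]
  have h2 : |Real.sin (θ / 2)| ^ 2 + |Real.cos (θ / 2)| ^ 2 = 1 := by
    rw [sq_abs, sq_abs, Real.sin_sq_add_cos_sq]
  exact_mod_cast h2

/-- At short times the purity is bounded by `1 - 2 b² t²`, uniformly in `ħ`. -/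
lemma exists_orbitalPurity_le (ωc ω₃ lam κ q p θ φ : ℝ) (hlam : 0 < lam) (hκ : 0 < κ)
    (hn₁ : |Real.sin θ * Real.cos φ| ≠ 1) :
    ∃ b > 0, ∃ t₀ > 0, ∃ ħ₀ > 0, ∀ (n : ℕ) (ħ : ℝ), 0 < ħ → ħ ≤ ħ₀ → ħ * ((n : ℝ) / 2) = κ →
      ∀ Ψ : ℝ → TotalSpace n, IsDickeEvolution n ħ ωc ω₃ lam q p θ φ Ψ →
        ∀ t : ℝ, 0 ≤ t → t ≤ t₀ → ‖Ψ t‖ = 1 ∧ orbitalPurity n (Ψ t) ≤ 1 - 2 * (b * t) ^ 2 := by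
  set ε₀ : ℝ := 2 * lam / √(2 * κ) with hε₀
  have hε₀pos : 0 < ε₀ := by positivity
  obtain ⟨r, hr, δ, hδ, H⟩ := exists_isMeanField ωc ω₃ κ ε₀ (q + p * Complex.I) _ _
    (unit_coherent θ φ)
  -- The coupling as a function of `ħ`, by `(n + 1) ħ = 2κ + ħ`; `ε₀` is its limit.
  have hcont : ContinuousAt (fun ħ : ℝ => 2 * lam / √(2 * κ + ħ)) 0 := by
    refine ContinuousAt.div continuousAt_const (by fun_prop) ?_
    rw [add_zero]
    positivity
  obtain ⟨η, hη, hηb⟩ := Metric.continuousAt_iff.1 hcont (min r (ε₀ / 2)) (by positivity)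
  simp only [add_zero, Real.dist_eq, sub_zero, ← hε₀] at hηb
  set s : ℝ := 1 / 4 - (Real.sin θ * Real.cos φ) ^ 2 / 4 with hs
  have hspos : 0 < s := by
    have h1 : |Real.sin θ * Real.cos φ| ≤ 1 := by
      rw [abs_mul]
      exact mul_le_one₀ (Real.abs_sin_le_one _) (abs_nonneg _) (Real.abs_cos_le_one _)
    have h2 := (sq_lt_one_iff_abs_lt_one _).2 (lt_of_le_of_ne h1 hn₁)
    linarith
  -- For small `ħ` the coupling lies within `ε₀ / 2` of `ε₀`. The error bounds increase with it and
  -- are evaluated at `e`; the linear rate uses the lower end.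
  set e : ℝ := 3 / 2 * ε₀ with he
  have hepos : 0 < e := by positivity
  have hsκ : 0 < √κ := Real.sqrt_pos.2 hκ
  have hR := residualBound_nonneg (ωc := ωc) (ω₃ := ω₃) hκ hepos.le
  set R := residualBound ωc ω₃ κ e with hRdef
  set E := overlapBound ωc ω₃ κ e / √κ + 2 * e * R with hE
  have hEnn : 0 ≤ E := by
    rw [hE, overlapBound, ← hRdef]
    positivity
  -- At most half of the linear rate `ε √κ s`, as `ε ≥ ε₀ / 2`. The other half absorbs the quadratic
  -- error once `E t ≤ b`.
  set b : ℝ := ε₀ * √κ * s / 4 with hb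
  have hbpos : 0 < b := by positivity
  -- The four bounds on `t` keep it inside the mean field interval, give `t² ≤ t`, make the
  -- quadratic error at most `b`, and keep the overlap with the mean field state at least `1/2`.
  refine ⟨b, hbpos, min (min (δ / 2) 1) (min (b / (E + 1)) (1 / (2 * (e * R + 1)))),
    by positivity, η / 2, by positivity, fun n ħ hħ hħle hn Ψ hΨ t ht htle => ?_⟩
  have ht1 : t ≤ δ / 2 := htle.trans ((min_le_left _ _).trans (min_le_left _ _))
  have ht2 : t ≤ 1 := htle.trans ((min_le_left _ _).trans (min_le_right _ _))
  have ht3 : t ≤ b / (E + 1) := htle.trans ((min_le_right _ _).trans (min_le_left _ _))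
  have ht4 : t ≤ 1 / (2 * (e * R + 1)) := htle.trans ((min_le_right _ _).trans (min_le_right _ _))
  rw [le_div_iff₀ (by positivity)] at ht3 ht4
  have hsum : ((n : ℝ) + 1) * ħ = 2 * κ + ħ := by linarith
  have hclose := hηb (x := ħ) (by rw [abs_of_pos hħ]; linarith)
  set ε : ℝ := 2 * lam / √(2 * κ + ħ) with hε
  have habs := abs_lt.1 (hclose.trans_le (min_le_right _ _))
  have hεlow : ε₀ / 2 ≤ ε := by linarith
  have hεup : ε ≤ e := by linarith
  have hεpos : 0 < ε := by positivity
  obtain ⟨ζ, u, v, a, hζ0, hu0, hv0, ha0, hmf⟩ := H ε (hclose.le.trans (min_le_left _ _))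
  have hfr : IsDickeFrame n ħ ωc ω₃ lam κ ε δ ζ u v a :=
    { n_pos := Nat.pos_of_ne_zero fun h => by
        rw [h] at hn
        simp at hn
        linarith
      kappa_pos := hκ
      spin := by linarith
      coupling := by rw [hsum]
      coupling_pos := hεpos
      meanField := hmf }
  have h0 := meanState_zero_of_coherent hħ ωc q p θ φ hζ0 hu0 hv0 ha0 hΨ.1
  have h1 : ∀ t, ‖Ψ t‖ = 1 := fun t => by
    rw [norm_eq_of_evolution hħ hΨ.2, h0, hfr.norm_meanState hħ ⟨by linarith, hδ⟩]
  have hRε := residualBound_mono (ωc := ωc) (ω₃ := ω₃) hκ hεup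
  have hRε0 := residualBound_nonneg (ωc := ωc) (ω₃ := ω₃) hκ hεpos.le
  have hOε := overlapBound_mono (ωc := ωc) (ω₃ := ω₃) hκ hεpos.le hεup
  refine ⟨h1 t, hfr.orbitalPurity_le hħ hΨ.2 h0 h1 ht (by linarith) ?_ hbpos.le ?_⟩
  · calc ε * residualBound ωc ω₃ κ ε * t ^ 2 ≤ e * R * t := by
          have : t ^ 2 ≤ t := by nlinarith
          gcongr
      _ ≤ 1 / 2 := by linarith
  · have h2 : (overlapBound ωc ω₃ κ ε / √κ + 2 * ε * residualBound ωc ω₃ κ ε) * t ≤ E * t := by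
      rw [hE]
      gcongr
    have h3 : ε₀ / 2 * √κ * s ≤ ε * √κ * s := by gcongr
    have h4 : 1 / 4 - spinorMean (u 0) (v 0) ^ 2 = s := by
      rw [hu0, hv0, spinorMean_coherent, hs]
      ring
    rw [h4]
    linarith

theorem theorem3 (ωc ω₃ lam κ q p θ φ : ℝ)
    (hωc : 0 < ωc) (hω₃ : 0 ≤ ω₃) (hlam : 0 < lam) (hκ : 0 < κ)
    (hn₁ : |Real.sin θ * Real.cos φ| ≠ 1) :
    ∃ c₀ : ℝ, 0 < c₀ ∧ ∃ t₀ : ℝ, 0 < t₀ ∧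
      (∀ μ : ℝ, 0 < μ → μ < 1 / 2 →
        ∃ C : ℝ, ∃ ħ₀ : ℝ, 0 < ħ₀ ∧
          ∀ (n : ℕ) (ħ : ℝ), 0 < ħ → ħ ≤ ħ₀ → ħ * ((n : ℝ) / 2) = κ →
            ∀ Ψ : ℝ → TotalSpace n, IsDickeEvolution n ħ ωc ω₃ lam q p θ φ Ψ →
              ∀ t : ℝ, 0 ≤ t → t ≤ t₀ →
                orbitalPurity n (Ψ t) ≤ (1 + c₀ * κ * t ^ 2) ^ (-(1 / 2 : ℝ)) + C * ħ ^ μ) ∧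
      (∀ t : ℝ, 0 < t → t ≤ t₀ →
        ∃ ħ₁ : ℝ, 0 < ħ₁ ∧
          ∀ (n : ℕ) (ħ : ℝ), 0 < ħ → ħ ≤ ħ₁ → ħ * ((n : ℝ) / 2) = κ →
            ∀ Ψ : ℝ → TotalSpace n, IsDickeEvolution n ħ ωc ω₃ lam q p θ φ Ψ →
              (∀ f : OrbitalSpace, orbitalDensity n (Ψ t) ≠ pureProj f) ∧
              ¬ ∃ (f : OrbitalSpace) (v : SpinSpace n),
                  Ψ t =ᵐ[volume] (fun x => f x • v)) := by
  obtain ⟨b, hb, t₀, ht₀, ħ₀, hħ₀, H⟩ :=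
    exists_orbitalPurity_le ωc ω₃ lam κ q p θ φ hlam hκ hn₁
  have hx : ∀ t : ℝ, 4 * b ^ 2 / κ * κ * t ^ 2 = 4 * (b * t) ^ 2 := fun t => by
    field_simp
  -- With `x = 4 (b t)²` the bound `1 - 2 (b t)²` is `1 - x / 2`, which fixes `c₀`. The estimate is
  -- uniform in `ħ`, so `C = 0` works for every `μ`, and the same `ħ₀` serves every `t` in the
  -- second claim.
  refine ⟨4 * b ^ 2 / κ, by positivity, t₀, ht₀, fun μ _ _ => ⟨0, ħ₀, hħ₀, ?_⟩,
    fun t ht htle => ⟨ħ₀, hħ₀, ?_⟩⟩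
  · intro n ħ hħ hħle hn Ψ hΨ t ht htle
    rw [zero_mul, add_zero, hx]
    refine (H n ħ hħ hħle hn Ψ hΨ t ht htle).2.trans (le_trans (le_of_eq ?_)
      (one_sub_half_le_rpow (by positivity)))
    ring
  · intro n ħ hħ hħle hn Ψ hΨ
    obtain ⟨h1, h2⟩ := H n ħ hħ hħle hn Ψ hΨ t ht.le htle
    have h3 : orbitalPurity n (Ψ t) ≠ 1 := by
      have : 0 < (b * t) ^ 2 := by positivity
      exact (lt_of_le_of_lt h2 (by linarith)).ne
    exact ⟨fun f hf => h3 (orbitalPurity_of_pure h1 hf),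
      fun ⟨f, v, hfv⟩ => h3 (orbitalPurity_of_product h1 hfv)⟩
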